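/- Let $r\ge 2$ and $n\ge 2r+1$ be integers. Let $\Omega_S$ be the set of all $2r$-regular simple graphs on the vertex set $\{1,\dots,n\}$ and $\Omega_F\subseteq\Omega_S$ the set of connected ones. **Chains.** One step of the switch chain $\mathcal M_S$ on $\Omega_S$ from $G$: choose uniformly at random an unordered pair of non-adjacent (vertex-disjoint) edges $ab,cd$ of $G$ and a perfect matching $M$ of $\{a,b,c,d\}$; if no edge of $M$ is an edge of $G$, delete $ab,cd$ and add the edges of $M$; otherwise do nothing. The connected switch chain $\mathcal M_{SC}$ on $\Omega_F$ is obtained from $\mathcal M_S$ by replacing each transition to a disconnected graph by a self-loop. Both have uniform stationary distribution. For a chain $\mathcal M$ with transition matrix $P$ and stationary distribution $\pi$, let $E(\mathcal M)$ be the set of pairs $xy$ with $x\ne y$ and $P(x,y)>0$. A set $\Gamma=\{\gamma_{xy}\}$ of canonical paths contains one directed path (walk) $\gamma_{xy}$ with steps in $E(\mathcal M)$ for each ordered pair of states, and its congestion is $$\bar\rho(\Gamma)=\max_{uv\in E(\mathcal M)}\frac1{\pi(u)P(u,v)}\sum_{x,y:\ uv\in\gamma_{xy}}\pi(x)\pi(y)|\gamma_{xy}|$$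 ($0$ if $E(\mathcal M)=\emptyset$). In a multicommodity flow, $\pi(x)\pi(y)$ is divided among finitely many paths from $x$ to $y$, and its congestion is defined analogously, as the maximum of $\frac{1}{\pi(u)P(u,v)}\sum_{p\ni uv} f(p)\,|p|$, where $f(p)$ is the flow along $p$. **Chaining.** Let $G\in\Omega_S$ have components $H_1,\dots,H_k$, let $v_i$ be the highest-labelled vertex of $H_i$ (its entry vertex), ordered so that $v_1<\dots<v_k$, and $v_{k+1}=v_1$. For a choice of neighbours $x_i$ of $v_i$ (exit vertices), chaining $G$ with exits $x_1,\dots,x_k$ means removing the edges $v_ix_i$ and adding the edges $x_iv_{i+1}$, $1\le i\le k$. Let $h(G)$ be the result when each $x_i$ is the highest-labelled neighbour of $v_i$. **Claim.** $h$ maps $\Omega_S$ into $\Omega_F$, is surjective, satisfies $h(G)=G$ for all $G\in\Omega_F$, and $|h^{-1}(G)|\le 2rn$ for all $G\in\Omega_F$. There is a set of simulation paths: for every $(W,W')\in E(\mathcal M_S)$ a path $\sigma_{WW'}$ of $\mathcal M_{SC}$ from $h(W)$ to $h(W')$, of length at most $5$, in which every step is a connected switch, with the following structure (steps in brackets may be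 absent; a bridge change or bridge rectification changes the exit vertex of one component in a chained graph; the simulating switch deletes and adds exactly the edges that $W\to W'$ deletes and adds, the graph before it being a chaining of $W$ in the neutral and the reconnecting case and the graph after it a chaining of $W'$ in the neutral and the disconnecting case; in the reconnecting case the housekeeping switch leads to a chaining of $W'$): * if $W,W'$ have the same number of components (neutral): [bridge change], simulating switch, [bridge rectification]; * if $W'$ has one more component (disconnecting): [bridge change], housekeeping switch, simulating switch, [bridge rectification], [bridge rectification]; * if $W'$ has one fewer component (reconnecting): [bridge change], [bridge change], simulating switch, housekeeping switch, [bridge rectification]. Moreover, for every set $\Gamma_S$ of canonical paths for $\mathcal M_S$, let $\Gamma_{SC}$ be the set of canonical paths for $\mathcal M_{SC}$ whose path from $x$ to $y$ ($x,y\in\Omega_F$) is the concatenation of the simulation paths of the successive transitions of the path of $\Gamma_S$ from $x$ to $y$. Then $$\bar\rho(\Gamma_{SC})\le 120\,r\,n^3\,\bar\rho(\Gamma_S).$$ The same holds for every multicommodity flow for $\mathcal M_S$ and the flow for $\mathcal M_{SC}$ obtained from it by replacing each path between states of $\Omega_F$ by its concatenated simulation path. -/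

import Mathlib

namespace SwitchChain

/-! ### Finite Markov chains, paths, congestion -/

/-- A Markov chain on a finite state space, given by its transition probabilities `P` and its
stationary distribution `π`. -/
structure FinChain (Ω : Type*) where
  P : Ω → Ω → ℝ
  π : Ω → ℝ

namespace FinChain

variable {Ω Ω' : Type*}

/-- The (directed, loop-free) transitions of the chain. -/
def Edge (M : FinChain Ω) (x y : Ω) : Prop := x ≠ y ∧ 0 < M.P x y

/-- A directed path from `x` to `y` in the graph underlying the chain. -/
inductive Path (M : FinChain Ω) : Ω → Ω → Type _
  | nil (x : Ω) : Path M x x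
  | cons {x y z : Ω} (h : M.Edge x y) (p : Path M y z) : Path M x z

namespace Path

variable {M : FinChain Ω} {M' : FinChain Ω'}

/-- The number of transitions of a path. -/
def length : {x y : Ω} → M.Path x y → ℕ
  | _, _, nil _ => 0
  | _, _, cons _ p => p.length + 1

/-- The transitions of a path, in order. -/
def edges : {x y : Ω} → M.Path x y → List (Ω × Ω)
  | _, _, nil _ => []
  | _, _, cons (x := x) (y := y) _ p => (x, y) :: p.edges

/-- The states visited by a path, in order. -/
def states : {x y : Ω} → M.Path x y → List Ω
  | _, _, nil x => [x]
  | _, _, cons (x := x) _ p => x :: p.states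

/-- Concatenation of paths. -/
def append : {x y z : Ω} → M.Path x y → M.Path y z → M.Path x z
  | _, _, _, nil _, q => q
  | _, _, _, cons h p, q => cons h (p.append q)

/-- Replace the end-points of a path by equal ones. -/
def copy {x y x' y' : Ω} (p : M.Path x y) (hx : x = x') (hy : y = y') : M.Path x' y' :=
  hx ▸ hy ▸ p

end Path

/-- A set of canonical paths: one path for each ordered pair of states. -/
def CanonicalPaths (M : FinChain Ω) : Type _ := ∀ x y : Ω, M.Path x y

open Classical in
/-- The congestion `max_e Q(e)⁻¹ ∑_{x, y : e ∈ γ_xy} π(x) π(y) |γ_xy|`, where `e = uv` runs over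
the transitions of the chain and `Q(e) = π(u) P(u,v)`  (it is `0` if there are no transitions). -/
noncomputable def congestion [Fintype Ω] (M : FinChain Ω) (Γ : M.CanonicalPaths) : ℝ :=
  ⨆ e : {e : Ω × Ω // M.Edge e.1 e.2},
    (M.π e.1.1 * M.P e.1.1 e.1.2)⁻¹ *
      ∑ x, ∑ y, if e.1 ∈ (Γ x y).edges then M.π x * M.π y * ((Γ x y).length : ℝ) else 0

/-- A multicommodity flow: for each ordered pair `(x, y)` the flow `π(x) π(y)` is divided among
finitely many paths from `x` to `y`; `frac x y p` is the proportion that is sent along `p`. -/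
structure Flow (M : FinChain Ω) where
  frac : ∀ x y : Ω, M.Path x y →₀ ℝ
  nonneg : ∀ x y p, 0 ≤ frac x y p
  sum_eq_one : ∀ x y, ((frac x y).sum fun _ c => c) = 1

open Classical in
/-- The congestion of a family of path weights:
`max_e Q(e)⁻¹ ∑_{x, y} ∑_{p : e ∈ p} π(x) π(y) frac(p) |p|`. -/
noncomputable def fracCongestion [Fintype Ω] (M : FinChain Ω)
    (frac : ∀ x y : Ω, M.Path x y →₀ ℝ) : ℝ :=
  ⨆ e : {e : Ω × Ω // M.Edge e.1 e.2},
    (M.π e.1.1 * M.P e.1.1 e.1.2)⁻¹ *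
      ∑ x, ∑ y, (frac x y).sum fun p c =>
        if e.1 ∈ p.edges then M.π x * M.π y * c * (p.length : ℝ) else 0

/-- The congestion of a multicommodity flow. -/
noncomputable def Flow.congestion [Fintype Ω] {M : FinChain Ω} (f : M.Flow) : ℝ :=
  M.fracCongestion f.frac

/-! ### The two-stage direct construction -/

/-- A set of `(M, M')`-simulation paths with respect to `h`: every transition `(z, w)` of `M'` is
simulated by a path of `M` from `h z` to `h w`. -/
def SimulationPaths (M : FinChain Ω) (M' : FinChain Ω') (h : Ω' → Ω) : Type _ :=
  ∀ z w : Ω', M'.Edge z w → M.Path (h z) (h w)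

/-- Simulate a path of `M'` in `M`, by concatenating the simulation paths of its transitions. -/
def SimulationPaths.run {M : FinChain Ω} {M' : FinChain Ω'} {h : Ω' → Ω}
    (σ : SimulationPaths M M' h) : {z w : Ω'} → M'.Path z w → M.Path (h z) (h w)
  | _, _, .nil z => .nil (h z)
  | _, _, .cons e p => (σ _ _ e).append (σ.run p)

/-- The two-stage path from `x` to `y` that simulates a path of `M'` from `x` to `y`. Here `ι` is
the inclusion of the state space of `M` in that of `M'`, and `h` fixes all states of `M`. -/
def SimulationPaths.runBetween {M : FinChain Ω} {M' : FinChain Ω'} {h : Ω' → Ω}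
    (σ : SimulationPaths M M' h) (ι : Ω → Ω') (hι : ∀ x, h (ι x) = x) (x y : Ω)
    (p : M'.Path (ι x) (ι y)) : M.Path x y :=
  (σ.run p).copy (hι x) (hι y)

/-- The canonical paths for `M` obtained from canonical paths for `M'` by simulation. -/
def CanonicalPaths.simulate {M : FinChain Ω} {M' : FinChain Ω'} {h : Ω' → Ω}
    (Γ' : M'.CanonicalPaths) (σ : SimulationPaths M M' h) (ι : Ω → Ω')
    (hι : ∀ x, h (ι x) = x) : M.CanonicalPaths :=
  fun x y => σ.runBetween ι hι x y (Γ' (ι x) (ι y))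

/-- The flow for `M` obtained from a flow for `M'` by simulation: each path of the flow between
two states of `M` is replaced by the path that simulates it. -/
noncomputable def Flow.simulate {M : FinChain Ω} {M' : FinChain Ω'} {h : Ω' → Ω}
    (f' : M'.Flow) (σ : SimulationPaths M M' h) (ι : Ω → Ω')
    (hι : ∀ x, h (ι x) = x) : M.Flow where
  frac x y := (f'.frac (ι x) (ι y)).mapDomain (σ.runBetween ι hι x y)
  nonneg x y p := by
    classical
    rw [Finsupp.mapDomain, Finsupp.sum, Finsupp.finsetSum_apply]
    refine Finset.sum_nonneg fun q _ => ?_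
    rw [Finsupp.single_apply]
    split_ifs
    · exact f'.nonneg _ _ _
    · exact le_rfl
  sum_eq_one x y := by
    rw [Finsupp.sum_mapDomain_index (fun _ => rfl) (fun _ _ _ => rfl)]
    exact f'.sum_eq_one _ _

end FinChain

/-! ### The switch chain and the connected switch chain -/

open Classical in
/-- All `2r`-regular (simple) graphs on `n` labelled vertices. -/
def OmegaS (n r : ℕ) : Type := {G : SimpleGraph (Fin n) // G.IsRegularOfDegree (2 * r)}

/-- All connected `2r`-regular graphs on `n` labelled vertices. -/
def OmegaF (n r : ℕ) : Type := {G : OmegaS n r // G.1.Connected}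

noncomputable instance (n r : ℕ) : Fintype (OmegaS n r) :=
  haveI : Finite (OmegaS n r) := Subtype.finite
  Fintype.ofFinite _

noncomputable instance (n r : ℕ) : Fintype (OmegaF n r) :=
  haveI : Finite (OmegaF n r) := Subtype.finite
  Fintype.ofFinite _

/-- The vertices that are covered by a set of edges. -/
def endpoints {n : ℕ} (R : Finset (Sym2 (Fin n))) : Finset (Fin n) :=
  Finset.univ.filter fun v => ∃ e ∈ R, v ∈ e

/-- `R` consists of two edges (not loops) without a common vertex. -/
def IsDisjointPair {n : ℕ} (R : Finset (Sym2 (Fin n))) : Prop :=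
  R.card = 2 ∧ (endpoints R).card = 4

open Classical in
/-- The random choices of one step of the switch chain at `G`: a pair `c.1 = {ab, cd}` of
non-adjacent edges of `G`, and a perfect matching `c.2` of the four vertices `{a, b, c, d}`. -/
noncomputable def switchChoices {n : ℕ} (G : SimpleGraph (Fin n)) :
    Finset (Finset (Sym2 (Fin n)) × Finset (Sym2 (Fin n))) :=
  Finset.univ.filter fun c =>
    (c.1 : Set (Sym2 (Fin n))) ⊆ G.edgeSet ∧ IsDisjointPair c.1 ∧
      IsDisjointPair c.2 ∧ endpoints c.2 = endpoints c.1

open Classical in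
/-- The graph after one step with choice `c`: if no edge of the matching `c.2` is present, the two
edges in `c.1` are deleted and those of `c.2` are added; otherwise nothing is done. -/
noncomputable def switchOutcome {n : ℕ} (G : SimpleGraph (Fin n))
    (c : Finset (Sym2 (Fin n)) × Finset (Sym2 (Fin n))) : SimpleGraph (Fin n) :=
  if Disjoint (c.2 : Set (Sym2 (Fin n))) G.edgeSet then
    G.deleteEdges c.1 ⊔ SimpleGraph.fromEdgeSet c.2
  else G

open Classical in
/-- The probability that one step of the switch chain, with uniformly random choices, goes from
`G` to `G'`. -/
noncomputable def switchProb {n : ℕ} (G G' : SimpleGraph (Fin n)) : ℝ :=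
  (((switchChoices G).filter fun c => switchOutcome G c = G').card : ℝ) /
    ((switchChoices G).card : ℝ)

/-- The switch chain on `2r`-regular graphs, with its (uniform) stationary distribution. -/
noncomputable def switchChain (n r : ℕ) : FinChain (OmegaS n r) where
  P x y := switchProb x.1 y.1
  π _ := ((Fintype.card (OmegaS n r) : ℝ))⁻¹

open Classical in
/-- The connected switch chain: the switch chain on connected `2r`-regular graphs, where every
transition to a disconnected graph is replaced by a self-loop; its stationary distribution is
uniform. -/
noncomputable def connectedSwitchChain (n r : ℕ) : FinChain (OmegaF n r) where
  P x y := (switchChain n r).P x.1 y.1 +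
    if x = y then
      ∑ z ∈ Finset.univ.filter (fun z : OmegaS n r => ¬ z.1.Connected), (switchChain n r).P x.1 z
    else 0
  π _ := ((Fintype.card (OmegaF n r) : ℝ))⁻¹

/-! ### Chaining -/

section Chaining

variable {n : ℕ} (G : SimpleGraph (Fin n))

/-- `v` is an entry vertex: it has the highest label in its component. -/
def IsEntry (v : Fin n) : Prop := ∀ u, G.Reachable v u → u ≤ v

/-- `w` is the entry vertex that follows the entry vertex `v` in the cyclic order
`v₁ < v₂ < ⋯ < v_k`, `v_{k+1} = v₁`, of all entry vertices. -/
def IsNextEntry (v w : Fin n) : Prop :=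
  IsEntry G v ∧ IsEntry G w ∧
    ((v < w ∧ ∀ u, IsEntry G u → u ≤ v ∨ w ≤ u) ∨ (∀ u, IsEntry G u → u ≤ v ∧ w ≤ u))

/-- Choice of an exit vertex for each component: a neighbour `x v` of each entry vertex `v`. -/
def IsExitChoice (x : Fin n → Fin n) : Prop := ∀ v, IsEntry G v → G.Adj v (x v)

/-- Chaining with exit vertices `x`: the bridge edges `v_i x(v_i)` are removed, and replaced by the
chain edges `x(v_i) v_{i+1}`, with indices taken cyclically. -/
def chainWith (x : Fin n → Fin n) : SimpleGraph (Fin n) :=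
  G.deleteEdges {e | ∃ v, IsEntry G v ∧ e = s(v, x v)} ⊔
    SimpleGraph.fromEdgeSet {e | ∃ v w, IsNextEntry G v w ∧ e = s(x v, w)}

open Classical in
/-- The neighbour of `v` with the highest label (`v` itself if `v` has no neighbour). -/
noncomputable def topNeighbor (v : Fin n) : Fin n :=
  if h : (Finset.univ.filter fun w => G.Adj v w).Nonempty then
    (Finset.univ.filter fun w => G.Adj v w).max' h
  else v

/-- The chaining procedure: the exit vertex of each component is the highest-labelled neighbour of
its entry vertex. -/
noncomputable def chain : SimpleGraph (Fin n) := chainWith G (topNeighbor G)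

end Chaining

/-! ### Shape of the simulation paths -/

section Shape

variable {n : ℕ}

/-- The number of connected components. -/
noncomputable def numComponents (G : SimpleGraph (Fin n)) : ℕ := Nat.card G.ConnectedComponent

/-- The step from `Z` to `Z'` removes the same edges and inserts the same edges as the step from
`W` to `W'`. -/
def SameSwitch (Z Z' W W' : SimpleGraph (Fin n)) : Prop :=
  Z.edgeSet \ Z'.edgeSet = W.edgeSet \ W'.edgeSet ∧
    Z'.edgeSet \ Z.edgeSet = W'.edgeSet \ W.edgeSet

open Classical in
/-- The sequence of graphs `l` is `stages`, with consecutive repetitions deleted. -/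
def HasStages (l stages : List (SimpleGraph (Fin n))) : Prop :=
  l = stages.destutter (· ≠ ·)

/-- The admissible sequences of graphs for the simulation of the switch from `W` to `W'`. A bridge
change (or bridge rectification) replaces the exit vertex in one component of a chained graph.
* Neutral switch: [bridge change], simulating switch, [bridge rectification].
* Disconnecting switch: [bridge change], housekeeping switch, simulating switch,
  [bridge rectification], [bridge rectification].
* Reconnecting switch: [bridge change], [bridge change], simulating switch, housekeeping switch,
  [bridge rectification].
The steps in brackets may be absent (then two consecutive stages are equal), and the simulating
switch removes and inserts the same edges as the switch from `W` to `W'`. -/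
def IsSimulationSequence (W W' : SimpleGraph (Fin n)) (l : List (SimpleGraph (Fin n))) : Prop :=
  (numComponents W' = numComponents W ∧
    ∃ x x', IsExitChoice W x ∧ IsExitChoice W' x' ∧
      SameSwitch (chainWith W x) (chainWith W' x') W W' ∧
      HasStages l [chain W, chainWith W x, chainWith W' x', chain W']) ∨
  (numComponents W' = numComponents W + 1 ∧
    ∃ x Z x' x'', IsExitChoice W x ∧ IsExitChoice W' x' ∧ IsExitChoice W' x'' ∧
      SameSwitch Z (chainWith W' x') W W' ∧
      HasStages l [chain W, chainWith W x, Z, chainWith W' x', chainWith W' x'', chain W']) ∨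
  (numComponents W' + 1 = numComponents W ∧
    ∃ x x' Z x'', IsExitChoice W x ∧ IsExitChoice W x' ∧ IsExitChoice W' x'' ∧
      SameSwitch (chainWith W x') Z W W' ∧
      HasStages l [chain W, chainWith W x, chainWith W x', Z, chainWith W' x'', chain W'])

end Shape

end SwitchChain

/-! All degrees equal `2r`, so every edge cut is even and no component has a cut edge. Chaining
therefore keeps each component connected when its bridge edge `v_i x_i` is removed, and the chain
edges join the components in a cycle. A connected graph has one entry vertex, which is its own
successor, so chaining removes and restores the same edge; this gives `h(G) = G` and surjectivity.

Recovery. The vertex with the highest label is always an entry vertex. A chaining `K` together with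
its last chain edge, directed from the exit of the last component to the first entry, determines `W`
(`chainWith_injective`): outside that edge, the first components can only be left towards entries
with larger labels. As `K` has `2rn` darts, it is a chaining of at most `2rn` graphs. If any
directed chain edge `pq` is prescribed, at most `n/(2r-1)` graphs remain
(`card_chainings_through_le`): the part of the chain from `q` on has at most two boundary edges in
`K`, it determines `W`, and posimodularity of cuts makes these parts nested, with gaps of at least
`2r-1` vertices.

Simulation. Changing one exit vertex is a switch or does nothing (`bridge_change`). If a switch
preserves the components, it can be performed in the chained graph once the exit avoids the deleted
edges. If it splits a component, the exits of both parts are chosen so that the new entry vertex can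
first be inserted into the chain (housekeeping) and the switch performed afterwards, all graphs
staying connected; the conditions exclude at most three neighbours of a vertex, and the degree is at
least 4. A reconnecting switch is a disconnecting one read backwards, since switches are reversible.

Congestion. All non-loop transitions of both chains have the same probability, because the number of
choices depends on `n` and `r` only. Hence the congestion grows at most by the product of the path
length 5, the ratio of the numbers of states, and the number of transitions simulated through a
given one. The ratio is at most 4/3: switches that increase the boundary of a vertex set show that
at most 1/16 of the regular graphs are disconnected (`card_disconnected_le`). A simulation step
either deletes a chain edge of a chaining of `W`, or creates one of a chaining of `W'`, or is the
simulating switch itself with a chaining at one end; counting `W` by the recovery bounds, and the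
other graph by the number of choices or by the switch itself, gives at most `18 r n³`
(`card_usedIn_le`). Finally `5 · 4/3 · 18 = 120`. -/

namespace SwitchChain

/-! ### Neighbourhoods, cuts and parity -/

section Cuts

variable {n : ℕ} {G : SimpleGraph (Fin n)}

open Classical in
/-- The neighbours of a vertex, as a finite set. -/
noncomputable def nbrs (G : SimpleGraph (Fin n)) (v : Fin n) : Finset (Fin n) :=
  Finset.univ.filter fun w => G.Adj v w

theorem mem_nbrs {v w : Fin n} : w ∈ nbrs G v ↔ G.Adj v w := by simp [nbrs]

/-- All vertices have degree `d`. -/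
def Reg (G : SimpleGraph (Fin n)) (d : ℕ) : Prop := ∀ v, (nbrs G v).card = d

theorem reg_iff (G : SimpleGraph (Fin n)) [G.LocallyFinite] (d : ℕ) :
    G.IsRegularOfDegree d ↔ Reg G d := by
  refine forall_congr' fun v => ?_
  have : (nbrs G v) = G.neighborFinset v := by
    ext w; simp [mem_nbrs]
  rw [this, SimpleGraph.card_neighborFinset_eq_degree]

open Classical in
/-- The darts that leave `S`. -/
noncomputable def cutDarts (G : SimpleGraph (Fin n)) (S : Set (Fin n)) :
    Finset (Fin n × Fin n) :=
  Finset.univ.filter fun p => G.Adj p.1 p.2 ∧ p.1 ∈ S ∧ p.2 ∉ S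

open Classical in
/-- The darts inside `S`. -/
noncomputable def insideDarts (G : SimpleGraph (Fin n)) (S : Set (Fin n)) :
    Finset (Fin n × Fin n) :=
  Finset.univ.filter fun p => G.Adj p.1 p.2 ∧ p.1 ∈ S ∧ p.2 ∈ S

theorem mem_cutDarts {S : Set (Fin n)} {p : Fin n × Fin n} :
    p ∈ cutDarts G S ↔ G.Adj p.1 p.2 ∧ p.1 ∈ S ∧ p.2 ∉ S := by
  simp [cutDarts]

theorem mem_insideDarts {S : Set (Fin n)} {p : Fin n × Fin n} :
    p ∈ insideDarts G S ↔ G.Adj p.1 p.2 ∧ p.1 ∈ S ∧ p.2 ∈ S := by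
  simp [insideDarts]

/-- Reversal of darts is an involution without fixed points, so the count vanishes modulo 2. -/
theorem even_card_insideDarts (G : SimpleGraph (Fin n)) (S : Set (Fin n)) :
    Even (insideDarts G S).card := by
  rw [← ZMod.natCast_eq_zero_iff_even, Finset.card_eq_sum_ones, Nat.cast_sum]
  refine Finset.sum_involution (fun p _ => p.swap) ?_ ?_ ?_ ?_
  · intro p _; simp; decide
  · rintro ⟨a, b⟩ h _ he
    rw [mem_insideDarts] at h
    simp only [Prod.swap_prod_mk, Prod.mk.injEq] at he
    exact h.1.ne he.2
  · rintro ⟨a, b⟩ h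
    rw [mem_insideDarts] at h ⊢
    exact ⟨h.1.symm, h.2.2, h.2.1⟩
  · rintro ⟨a, b⟩ _; rfl

theorem card_insideDarts_add (G : SimpleGraph (Fin n)) (S : Set (Fin n)) [DecidablePred (· ∈ S)] :
    (insideDarts G S).card + (cutDarts G S).card =
      ∑ v ∈ Finset.univ.filter (· ∈ S), (nbrs G v).card := by
  classical
  rw [← Finset.card_sigma, ← Finset.card_union_of_disjoint]
  · refine Finset.card_bij' (fun p _ => ⟨p.1, p.2⟩) (fun q _ => (q.1, q.2)) ?_ ?_ ?_ ?_
    · rintro ⟨a, b⟩ h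
      simp only [Finset.mem_union, mem_insideDarts, mem_cutDarts] at h
      simp only [Finset.mem_sigma, Finset.mem_filter, Finset.mem_univ, true_and, mem_nbrs]
      tauto
    · rintro ⟨a, b⟩ h
      simp only [Finset.mem_sigma, Finset.mem_filter, Finset.mem_univ, true_and, mem_nbrs] at h
      simp only [Finset.mem_union, mem_insideDarts, mem_cutDarts]
      tauto
    · intros; rfl
    · intros; rfl
  · rw [Finset.disjoint_left]
    rintro p h h'
    rw [mem_insideDarts] at h
    rw [mem_cutDarts] at h'
    exact h'.2.2 h.2.2

/-- The darts that start in `S` number `d |S|`, which is even, and so is the number of those that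
stay inside. This parity is the source of all connectivity arguments below: a cut with at most one
edge is empty. -/
theorem even_card_cutDarts {d : ℕ} (hG : Reg G d) (hd : Even d) (S : Set (Fin n)) :
    Even (cutDarts G S).card := by
  classical
  have h := card_insideDarts_add G S
  rw [Finset.sum_congr rfl fun v _ => hG v, Finset.sum_const, smul_eq_mul] at h
  have h1 : Even ((insideDarts G S).card + (cutDarts G S).card) := h ▸ hd.mul_left _
  exact (Nat.even_add.mp h1).mp (even_card_insideDarts G S)

/-- `S` is a union of connected components. -/
def IsClosedSet (G : SimpleGraph (Fin n)) (S : Set (Fin n)) : Prop :=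
  ∀ p q, G.Adj p q → p ∈ S → q ∈ S

theorem IsClosedSet.compl {S : Set (Fin n)} (h : IsClosedSet G S) : IsClosedSet G Sᶜ :=
  fun p q hpq hp hq => hp (h q p hpq.symm hq)

theorem IsClosedSet.mem_of_reachable {S : Set (Fin n)} (h : IsClosedSet G S) {u v : Fin n}
    (huv : G.Reachable u v) (hu : u ∈ S) : v ∈ S := by
  obtain ⟨p⟩ := huv
  induction p with
  | nil => exact hu
  | cons hadj _ ih => exact ih (h _ _ hadj hu)

theorem isClosedSet_reachable (G : SimpleGraph (Fin n)) (u : Fin n) :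
    IsClosedSet G {v | G.Reachable u v} :=
  fun _ _ hpq hp => SimpleGraph.Reachable.trans hp hpq.reachable

theorem connected_of_isClosedSet (u : Fin n)
    (h : ∀ S : Set (Fin n), IsClosedSet G S → u ∈ S → ∀ v, v ∈ S) : G.Connected := by
  have h1 : ∀ v, G.Reachable u v :=
    h _ (isClosedSet_reachable G u) (SimpleGraph.Reachable.refl u)
  have : Nonempty (Fin n) := ⟨u⟩
  exact ⟨fun v w => (h1 v).symm.trans (h1 w)⟩

/-- A set whose boundary consists of at most one edge has an empty boundary. -/
theorem isClosedSet_of_boundary {d : ℕ} (hG : Reg G d) (hd : Even d) {S : Set (Fin n)}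
    (e : Sym2 (Fin n)) (h : ∀ p q, G.Adj p q → p ∈ S → q ∉ S → s(p, q) = e) :
    IsClosedSet G S := by
  intro p q hpq hp
  by_contra hq
  have hcard : (cutDarts G S).card = 1 := by
    rw [Finset.card_eq_one]
    refine ⟨(p, q), ?_⟩
    ext ⟨p', q'⟩
    rw [mem_cutDarts, Finset.mem_singleton]
    constructor
    · rintro ⟨h1, h2, h3⟩
      have := (h p' q' h1 h2 h3).trans (h p q hpq hp hq).symm
      rw [Sym2.eq_iff] at this
      rcases this with ⟨rfl, rfl⟩ | ⟨rfl, rfl⟩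
      · rfl
      · exact absurd hp h3
    · rintro h
      cases h
      exact ⟨hpq, hp, hq⟩
  have := even_card_cutDarts hG hd S
  rw [hcard] at this
  exact absurd this (by decide)

theorem two_le_card_cutDarts {d : ℕ} (hG : Reg G d) (hd : Even d) (hc : G.Connected)
    {S : Set (Fin n)} (h1 : S.Nonempty) (h2 : Sᶜ.Nonempty) : 2 ≤ (cutDarts G S).card := by
  have h3 : (cutDarts G S).card ≠ 0 := by
    intro h0
    rw [Finset.card_eq_zero] at h0
    obtain ⟨u, hu⟩ := h1
    obtain ⟨w, hw⟩ := h2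
    refine hw (IsClosedSet.mem_of_reachable (G := G) (S := S) ?_ (hc.preconnected u w) hu)
    intro p q hpq hp
    by_contra hq
    have : (p, q) ∈ cutDarts G S := mem_cutDarts.mpr ⟨hpq, hp, hq⟩
    simp [h0] at this
  obtain ⟨k, hk⟩ := even_card_cutDarts hG hd S
  omega

theorem card_cutDarts_compl (G : SimpleGraph (Fin n)) (S : Set (Fin n)) :
    (cutDarts G Sᶜ).card = (cutDarts G S).card := by
  refine Finset.card_bij' (fun p _ => p.swap) (fun p _ => p.swap) ?_ ?_ ?_ ?_
  · rintro ⟨a, b⟩ h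
    rw [mem_cutDarts] at h ⊢
    simp only [Set.mem_compl_iff, not_not] at h
    exact ⟨h.1.symm, h.2.2, h.2.1⟩
  · rintro ⟨a, b⟩ h
    rw [mem_cutDarts] at h ⊢
    simp only [Set.mem_compl_iff, not_not]
    exact ⟨h.1.symm, h.2.2, h.2.1⟩
  · intros; rfl
  · intros; rfl

/-- A nonempty set with a small boundary is large. -/
theorem le_ncard_of_card_cutDarts_le {d : ℕ} (hG : Reg G d) {S : Set (Fin n)}
    (h1 : S.Nonempty) {k : ℕ} (h2 : (cutDarts G S).card ≤ k) : d + 1 ≤ S.ncard + k := by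
  classical
  obtain ⟨v, hv⟩ := h1
  -- Each neighbour of `v` outside `S` uses up its own boundary dart, so at most `k` of the `d`
  -- neighbours are outside; the others and `v` itself lie in `S`.
  have h3 : ((nbrs G v).filter (· ∉ S)).card ≤ (cutDarts G S).card := by
    refine Finset.card_le_card_of_injOn (fun w => (v, w)) ?_ ?_
    · intro w hw
      simp only [Finset.coe_filter, Set.mem_ofPred_eq, mem_nbrs] at hw
      simp only [Finset.mem_coe, mem_cutDarts]
      exact ⟨hw.1, hv, hw.2⟩
    · intro w _ w' _ h
      simpa using h
  have h4 : ((nbrs G v).filter (· ∈ S)).card + 1 ≤ S.ncard := by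
    rw [Set.ncard_eq_toFinset_card']
    have h5 : v ∉ (nbrs G v).filter (· ∈ S) := by simp [mem_nbrs]
    rw [← Finset.card_insert_of_notMem h5]
    refine Finset.card_le_card ?_
    intro w hw
    rw [Finset.mem_insert, Finset.mem_filter] at hw
    rw [Set.mem_toFinset]
    rcases hw with rfl | hw
    · exact hv
    · exact hw.2
  have h5 := Finset.card_filter_add_card_filter_not (s := nbrs G v) (· ∈ S)
  rw [hG v] at h5
  omega

/-- Posimodularity of the cut function, with the gain for an edge that leaves both sets. -/
theorem card_cutDarts_sdiff_add {S T : Set (Fin n)} {p q : Fin n} (hpq : G.Adj p q)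
    (hS : p ∈ S ∧ q ∉ S) (hT : p ∈ T ∧ q ∉ T) :
    (cutDarts G (S \ T)).card + (cutDarts G (T \ S)).card + 2 ≤
      (cutDarts G S).card + (cutDarts G T).card := by
  classical
  -- Summing over ordered pairs counts every boundary edge twice. The inequality then holds term by
  -- term, and the two orientations of `pq` each gain 2, since `pq` leaves `S` and `T` but neither
  -- difference.
  let g : Set (Fin n) → Fin n × Fin n → ℤ :=
    fun S e => if G.Adj e.1 e.2 ∧ ¬ (e.1 ∈ S ↔ e.2 ∈ S) then 1 else 0
  have f : ∀ S : Set (Fin n), ((cutDarts G S).card : ℤ) * 2 =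
      ∑ e : Fin n × Fin n, g S e := by
    intro S
    simp only [g]
    rw [Finset.sum_boole, mul_two]
    nth_rewrite 2 [← card_cutDarts_compl]
    rw [← Nat.cast_add, ← Finset.card_union_of_disjoint]
    · congr 2
      ext e
      simp only [Finset.mem_union, mem_cutDarts, Finset.mem_filter, Finset.mem_univ, true_and,
        Set.mem_compl_iff]
      tauto
    · rw [Finset.disjoint_left]
      intro e h h'
      rw [mem_cutDarts] at h h'
      exact h'.2.1 h.2.1
  have hne : (p, q) ≠ (q, p) := fun h => hpq.ne (congrArg Prod.fst h)
  have h2 : ∑ e : Fin n × Fin n, (if e = (p, q) ∨ e = (q, p) then (2 : ℤ) else 0) = 4 := by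
    rw [← Finset.sum_filter, Finset.sum_const]
    have : (Finset.univ.filter fun e : Fin n × Fin n => e = (p, q) ∨ e = (q, p)) =
        {(p, q), (q, p)} := by ext; simp
    rw [this, Finset.card_pair hne]; rfl
  have h3 : ∑ e : Fin n × Fin n,
      (g (S \ T) e + g (T \ S) e + (if e = (p, q) ∨ e = (q, p) then (2 : ℤ) else 0)) ≤
      ∑ e : Fin n × Fin n, (g S e + g T e) := by
    refine Finset.sum_le_sum fun e _ => ?_
    simp only [g]
    by_cases he : e = (p, q) ∨ e = (q, p)
    · have hadj : G.Adj e.1 e.2 := by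
        rcases he with rfl | rfl
        · exact hpq
        · exact hpq.symm
      have a1 : ¬ (e.1 ∈ S ↔ e.2 ∈ S) := by rcases he with rfl | rfl <;> simp <;> tauto
      have a2 : ¬ (e.1 ∈ T ↔ e.2 ∈ T) := by rcases he with rfl | rfl <;> simp <;> tauto
      have a3 : (e.1 ∈ S \ T ↔ e.2 ∈ S \ T) := by rcases he with rfl | rfl <;> simp <;> tauto
      have a4 : (e.1 ∈ T \ S ↔ e.2 ∈ T \ S) := by rcases he with rfl | rfl <;> simp <;> tauto
      simp [a1, a2, a3, a4, hadj, he]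
    · by_cases hadj : G.Adj e.1 e.2
      · by_cases a1 : e.1 ∈ S <;> by_cases a2 : e.2 ∈ S <;> by_cases a3 : e.1 ∈ T <;>
          by_cases a4 : e.2 ∈ T <;> simp [a1, a2, a3, a4, hadj, he]
      · simp [hadj, he]
  rw [Finset.sum_add_distrib, Finset.sum_add_distrib, Finset.sum_add_distrib, h2, ← f, ← f, ← f,
    ← f] at h3
  omega

end Cuts

/-! ### Switches -/

section Switches

variable {n : ℕ} {G G' : SimpleGraph (Fin n)} {a b c d : Fin n}

/-- `G'` is obtained from `G` by deleting the edges `ab`, `cd` and inserting `ac`, `bd`. -/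
structure IsSw (G G' : SimpleGraph (Fin n)) (a b c d : Fin n) : Prop where
  hac : a ≠ c
  had : a ≠ d
  hbc : b ≠ c
  hbd : b ≠ d
  adj_ab : G.Adj a b
  adj_cd : G.Adj c d
  not_ac : ¬ G.Adj a c
  not_bd : ¬ G.Adj b d
  adj_iff : ∀ p q, G'.Adj p q ↔
    (G.Adj p q ∧ s(p, q) ≠ s(a, b) ∧ s(p, q) ≠ s(c, d)) ∨ s(p, q) = s(a, c) ∨ s(p, q) = s(b, d)

theorem IsSw.hab (h : IsSw G G' a b c d) : a ≠ b := h.adj_ab.ne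

theorem IsSw.hcd (h : IsSw G G' a b c d) : c ≠ d := h.adj_cd.ne

theorem IsSw.flip (h : IsSw G G' a b c d) : IsSw G G' b a d c where
  hac := h.hbd
  had := h.hbc
  hbc := h.had
  hbd := h.hac
  adj_ab := h.adj_ab.symm
  adj_cd := h.adj_cd.symm
  not_ac := h.not_bd
  not_bd := h.not_ac
  adj_iff p q := by
    rw [h.adj_iff, Sym2.eq_swap (a := b) (b := a), Sym2.eq_swap (a := d) (b := c)]
    tauto

theorem IsSw.rotate (h : IsSw G G' a b c d) : IsSw G G' c d a b where
  hac := h.hac.symm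
  had := h.hbc.symm
  hbc := h.had.symm
  hbd := h.hbd.symm
  adj_ab := h.adj_cd
  adj_cd := h.adj_ab
  not_ac h' := h.not_ac h'.symm
  not_bd h' := h.not_bd h'.symm
  adj_iff p q := by
    rw [h.adj_iff, Sym2.eq_swap (a := c) (b := a), Sym2.eq_swap (a := d) (b := b)]
    tauto

theorem sym2_ne_of_left {p q t u : Fin n} (h1 : p ≠ t) (h2 : p ≠ u) : s(p, q) ≠ s(t, u) := by
  rw [Ne, Sym2.eq_iff]; tauto

theorem sym2_ne_of_right {p q t u : Fin n} (h1 : q ≠ t) (h2 : q ≠ u) : s(p, q) ≠ s(t, u) := by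
  rw [Ne, Sym2.eq_iff]; tauto

theorem IsSw.adj_ac (h : IsSw G G' a b c d) : G'.Adj a c :=
  (h.adj_iff _ _).mpr (Or.inr (Or.inl rfl))

theorem IsSw.adj_bd (h : IsSw G G' a b c d) : G'.Adj b d :=
  (h.adj_iff _ _).mpr (Or.inr (Or.inr rfl))

theorem IsSw.not_ab (h : IsSw G G' a b c d) : ¬ G'.Adj a b := by
  rw [h.adj_iff]
  rintro (h' | h' | h')
  · exact h'.2.1 rfl
  · exact sym2_ne_of_right h.hab.symm h.hbc h'
  · exact sym2_ne_of_left h.hab h.had h'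

theorem IsSw.not_cd (h : IsSw G G' a b c d) : ¬ G'.Adj c d := h.rotate.not_ab

theorem adj_of_sym2_eq {p q t u : Fin n} (h : s(p, q) = s(t, u)) : G.Adj p q ↔ G.Adj t u := by
  rw [← SimpleGraph.mem_edgeSet, h, SimpleGraph.mem_edgeSet]

theorem IsSw.adj_of_ne (h : IsSw G G' a b c d) {p q : Fin n} (h1 : G.Adj p q)
    (h2 : s(p, q) ≠ s(a, b)) (h3 : s(p, q) ≠ s(c, d)) : G'.Adj p q :=
  (h.adj_iff p q).mpr (Or.inl ⟨h1, h2, h3⟩)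

theorem IsSw.symm (h : IsSw G G' a b c d) : IsSw G' G a c b d where
  hac := h.hab
  had := h.had
  hbc := h.hbc.symm
  hbd := h.hcd
  adj_ab := h.adj_ac
  adj_cd := h.adj_bd
  not_ac := h.not_ab
  not_bd := h.not_cd
  adj_iff p q := by
    rw [h.adj_iff]
    constructor
    · intro hpq
      by_cases h1 : s(p, q) = s(a, b)
      · exact Or.inr (Or.inl h1)
      by_cases h2 : s(p, q) = s(c, d)
      · exact Or.inr (Or.inr h2)
      refine Or.inl ⟨Or.inl ⟨hpq, h1, h2⟩, ?_, ?_⟩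
      · intro h3; exact h.not_ac ((adj_of_sym2_eq h3).mp hpq)
      · intro h3; exact h.not_bd ((adj_of_sym2_eq h3).mp hpq)
    · rintro (⟨h1, h2, h3⟩ | h1 | h1)
      · rcases h1 with h1 | h1 | h1
        · exact h1.1
        · exact absurd h1 h2
        · exact absurd h1 h3
      · exact (adj_of_sym2_eq h1).mpr h.adj_ab
      · exact (adj_of_sym2_eq h1).mpr h.adj_cd

theorem IsSw.ne (h : IsSw G G' a b c d) : G ≠ G' := by
  rintro rfl
  exact h.not_ab h.adj_ab

theorem IsSw.card_nbrs_left (h : IsSw G G' a b c d) : (nbrs G' a).card = (nbrs G a).card := by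
  have h1 : nbrs G' a = insert c ((nbrs G a).erase b) := by
    ext q
    rw [mem_nbrs, Finset.mem_insert, Finset.mem_erase, mem_nbrs, h.adj_iff]
    constructor
    · rintro (⟨h1, h2, _⟩ | h1 | h1)
      · refine Or.inr ⟨?_, h1⟩
        rintro rfl
        exact h2 rfl
      · rw [Sym2.congr_right] at h1
        exact Or.inl h1
      · exact absurd h1 (sym2_ne_of_left h.hab h.had)
    · rintro (rfl | ⟨h1, h2⟩)
      · exact Or.inr (Or.inl rfl)
      · refine Or.inl ⟨h2, ?_, sym2_ne_of_left h.hac h.had⟩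
        rwa [Ne, Sym2.congr_right]
  have h2 : c ∉ (nbrs G a).erase b := by
    rw [Finset.mem_erase, mem_nbrs]
    exact fun h' => h.not_ac h'.2
  rw [h1, Finset.card_insert_of_notMem h2, Finset.card_erase_add_one (mem_nbrs.mpr h.adj_ab)]

theorem IsSw.reg (h : IsSw G G' a b c d) {k : ℕ} (hG : Reg G k) : Reg G' k := by
  intro p
  by_cases ha : p = a
  · rw [ha, h.card_nbrs_left, hG]
  by_cases hb : p = b
  · rw [hb, h.flip.card_nbrs_left, hG]
  by_cases hc : p = c
  · rw [hc, h.rotate.card_nbrs_left, hG]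
  by_cases hd : p = d
  · rw [hd, h.rotate.flip.card_nbrs_left, hG]
  rw [← hG p]
  congr 1
  ext q
  rw [mem_nbrs, mem_nbrs, h.adj_iff]
  constructor
  · rintro (h1 | h1 | h1)
    · exact h1.1
    · exact absurd h1 (sym2_ne_of_left ha hc)
    · exact absurd h1 (sym2_ne_of_left hb hd)
  · intro h1
    exact Or.inl ⟨h1, sym2_ne_of_left ha hb, sym2_ne_of_left hc hd⟩

/-! ### Pairs of disjoint edges and matchings -/

theorem endpoints_pair (a b c d : Fin n) :
    endpoints {s(a, b), s(c, d)} = {a, b, c, d} := by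
  ext v
  simp [endpoints]
  tauto

theorem distinct_of_card_eq_four (h : ({a, b, c, d} : Finset (Fin n)).card = 4) :
    a ≠ b ∧ a ≠ c ∧ a ≠ d ∧ b ≠ c ∧ b ≠ d ∧ c ≠ d := by
  have h3 : ∀ x y z : Fin n, ({x, y, z} : Finset (Fin n)).card ≠ 4 := fun x y z h =>
    absurd (h ▸ Finset.card_le_three) (by decide)
  refine ⟨?_, ?_, ?_, ?_, ?_, ?_⟩ <;> rintro rfl
  · exact h3 a c d (by simpa using h)
  · exact h3 a b d (by rw [← h]; congr 1; ext; simp; tauto)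
  · exact h3 a b c (by rw [← h]; congr 1; ext; simp; tauto)
  · exact h3 a b d (by simpa using h)
  · exact h3 a b c (by rw [← h]; congr 1; ext; simp; tauto)
  · exact h3 a b c (by simpa using h)

theorem card_four (h : a ≠ b ∧ a ≠ c ∧ a ≠ d ∧ b ≠ c ∧ b ≠ d ∧ c ≠ d) :
    ({a, b, c, d} : Finset (Fin n)).card = 4 := by
  obtain ⟨h1, h2, h3, h4, h5, h6⟩ := h
  rw [Finset.card_insert_of_notMem (by simp [*]), Finset.card_insert_of_notMem (by simp [*]),
    Finset.card_pair h6]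

theorem isDisjointPair_pair (h : a ≠ b ∧ a ≠ c ∧ a ≠ d ∧ b ≠ c ∧ b ≠ d ∧ c ≠ d) :
    IsDisjointPair {s(a, b), s(c, d)} := by
  refine ⟨Finset.card_pair (sym2_ne_of_left h.2.1 h.2.2.1), ?_⟩
  rw [endpoints_pair, card_four h]

theorem IsDisjointPair.exists_eq {R : Finset (Sym2 (Fin n))} (h : IsDisjointPair R) :
    ∃ a b c d : Fin n, (a ≠ b ∧ a ≠ c ∧ a ≠ d ∧ b ≠ c ∧ b ≠ d ∧ c ≠ d) ∧
      R = {s(a, b), s(c, d)} := by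
  obtain ⟨e, f, _, rfl⟩ := Finset.card_eq_two.mp h.1
  induction e with | _ a b
  induction f with | _ c d
  have h2 := h.2
  rw [endpoints_pair] at h2
  exact ⟨a, b, c, d, distinct_of_card_eq_four h2, rfl⟩

theorem pair_eq_of_insert_eq {t u b c : Fin n} {s : Finset (Fin n)} (hs : s = {b, c})
    (hs' : s = {t, u}) : s(t, u) = s(b, c) := by
  rw [hs'] at hs
  rw [Sym2.eq_iff]
  have h1 : t ∈ ({b, c} : Finset (Fin n)) := hs ▸ by simp
  have h2 : u ∈ ({b, c} : Finset (Fin n)) := hs ▸ by simp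
  have h3 : b ∈ ({t, u} : Finset (Fin n)) := hs ▸ by simp
  have h4 : c ∈ ({t, u} : Finset (Fin n)) := hs ▸ by simp
  simp only [Finset.mem_insert, Finset.mem_singleton] at h1 h2 h3 h4
  rcases h1 with rfl | rfl <;> rcases h2 with rfl | rfl <;> simp_all

/-- A perfect matching of four points is determined by the partner of `a`. -/
theorem matching_cases (h : a ≠ b ∧ a ≠ c ∧ a ≠ d ∧ b ≠ c ∧ b ≠ d ∧ c ≠ d)
    {R : Finset (Sym2 (Fin n))} (hR : IsDisjointPair R) (hR' : endpoints R = {a, b, c, d}) :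
    R = {s(a, b), s(c, d)} ∨ R = {s(a, c), s(b, d)} ∨ R = {s(a, d), s(b, c)} := by
  obtain ⟨h1, h2, h3, h4, h5, h6⟩ := h
  have key : ∀ q t u : Fin n, (a ≠ q ∧ a ≠ t ∧ a ≠ u ∧ q ≠ t ∧ q ≠ u ∧ t ≠ u) →
      ({a, q, t, u} : Finset (Fin n)) = {a, b, c, d} → R = {s(a, q), s(t, u)} →
      R = {s(a, b), s(c, d)} ∨ R = {s(a, c), s(b, d)} ∨ R = {s(a, d), s(b, c)} := by
    rintro q t u ⟨g1, g2, g3, g4, g5, g6⟩ hs rfl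
    have e1 : q ∈ ({a, b, c, d} : Finset (Fin n)) := hs ▸ by simp
    have e2 : (({a, q, t, u} : Finset (Fin n)).erase a).erase q = {t, u} := by
      rw [Finset.erase_insert (by simp [*]), Finset.erase_insert (by simp [*])]
    rw [hs, Finset.erase_insert (by simp [*])] at e2
    simp only [Finset.mem_insert, Finset.mem_singleton] at e1
    rcases e1 with e1 | rfl | rfl | rfl
    · exact absurd e1.symm g1
    · left
      rw [pair_eq_of_insert_eq (b := c) (c := d) _ e2.symm.symm]
      rw [Finset.erase_insert (by simp [*])]
    · right; left
      rw [pair_eq_of_insert_eq (b := b) (c := d) _ e2.symm.symm]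
      ext x; simp only [Finset.mem_erase, Finset.mem_insert, Finset.mem_singleton]; grind
    · right; right
      rw [pair_eq_of_insert_eq (b := b) (c := c) _ e2.symm.symm]
      ext x; simp only [Finset.mem_erase, Finset.mem_insert, Finset.mem_singleton]; grind
  obtain ⟨p, q, t, u, g, hRR⟩ := hR.exists_eq
  have hs := hR'
  rw [hRR, endpoints_pair] at hs
  obtain ⟨g1, g2, g3, g4, g5, g6⟩ := g
  have e1 : a ∈ ({p, q, t, u} : Finset (Fin n)) := hs ▸ by simp
  simp only [Finset.mem_insert, Finset.mem_singleton] at e1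
  rcases e1 with rfl | rfl | rfl | rfl
  · exact key q t u ⟨g1, g2, g3, g4, g5, g6⟩ hs hRR
  · refine key p t u ⟨g1.symm, g4, g5, g2, g3, g6⟩ ?_ ?_
    · rw [← hs]; exact Finset.insert_comm _ _ _
    · rw [hRR, Sym2.eq_swap (a := p)]
  · refine key u p q ⟨g6, g2.symm, g4.symm, g3.symm, g5.symm, g1⟩ ?_ ?_
    · rw [← hs]; ext; simp; tauto
    · rw [hRR, Finset.pair_comm]
  · refine key t p q ⟨g6.symm, g3.symm, g5.symm, g2.symm, g4.symm, g1⟩ ?_ ?_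
    · rw [← hs]; ext; simp; tauto
    · rw [hRR, Finset.pair_comm, Sym2.eq_swap (a := t)]

end Switches

/-! ### Transition probabilities of the switch chain -/

section Probabilities

variable {n : ℕ} {G G' : SimpleGraph (Fin n)}

theorem not_isDiag_of_mem {R : Finset (Sym2 (Fin n))} (hR : IsDisjointPair R) {e : Sym2 (Fin n)}
    (he : e ∈ R) : ¬ e.IsDiag := by
  obtain ⟨a, b, c, d, h, rfl⟩ := hR.exists_eq
  simp only [Finset.mem_insert, Finset.mem_singleton] at he
  rcases he with rfl | rfl
  · simpa using h.1
  · simpa using h.2.2.2.2.2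

theorem mem_switchChoices {c : Finset (Sym2 (Fin n)) × Finset (Sym2 (Fin n))} :
    c ∈ switchChoices G ↔ (c.1 : Set (Sym2 (Fin n))) ⊆ G.edgeSet ∧ IsDisjointPair c.1 ∧
      IsDisjointPair c.2 ∧ endpoints c.2 = endpoints c.1 := by
  simp [switchChoices]

theorem isSw_outcome {a b c d : Fin n}
    (h : a ≠ b ∧ a ≠ c ∧ a ≠ d ∧ b ≠ c ∧ b ≠ d ∧ c ≠ d) (hab : G.Adj a b) (hcd : G.Adj c d)
    (hac : ¬ G.Adj a c) (hbd : ¬ G.Adj b d)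
    (hG' : G' = G.deleteEdges (({s(a, b), s(c, d)} : Finset (Sym2 (Fin n))) : Set (Sym2 (Fin n))) ⊔
      SimpleGraph.fromEdgeSet (({s(a, c), s(b, d)} : Finset (Sym2 (Fin n))) : Set (Sym2 (Fin n)))) :
    IsSw G G' a b c d where
  hac := h.2.1
  had := h.2.2.1
  hbc := h.2.2.2.1
  hbd := h.2.2.2.2.1
  adj_ab := hab
  adj_cd := hcd
  not_ac := hac
  not_bd := hbd
  adj_iff p q := by
    subst hG'
    simp only [SimpleGraph.sup_adj, SimpleGraph.deleteEdges_adj, SimpleGraph.fromEdgeSet_adj,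
      Finset.coe_insert, Finset.coe_singleton, Set.mem_insert_iff, Set.mem_singleton_iff]
    constructor
    · tauto
    · rintro (h1 | h1 | h1)
      · tauto
      · refine Or.inr ⟨Or.inl h1, ?_⟩
        rintro rfl
        rw [Sym2.eq_iff] at h1
        rcases h1 with ⟨h2, h3⟩ | ⟨h2, h3⟩
        · exact h.2.1 (h2.symm.trans h3)
        · exact h.2.1 (h3.symm.trans h2)
      · refine Or.inr ⟨Or.inr h1, ?_⟩
        rintro rfl
        rw [Sym2.eq_iff] at h1
        rcases h1 with ⟨h2, h3⟩ | ⟨h2, h3⟩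
        · exact h.2.2.2.2.1 (h2.symm.trans h3)
        · exact h.2.2.2.2.1 (h3.symm.trans h2)

theorem exists_isSw_of_outcome {c : Finset (Sym2 (Fin n)) × Finset (Sym2 (Fin n))}
    (hc : c ∈ switchChoices G) (ho : switchOutcome G c = G') (hne : G ≠ G') :
    ∃ a b c d, IsSw G G' a b c d := by
  obtain ⟨R, R'⟩ := c
  obtain ⟨h1, h2, h3, h4⟩ := mem_switchChoices.mp hc
  simp only at h1 h2 h3 h4
  unfold switchOutcome at ho
  split_ifs at ho with hd
  swap
  · exact absurd ho hne
  simp only at ho hd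
  obtain ⟨a, b, c, d, h, rfl⟩ := h2.exists_eq
  rw [endpoints_pair] at h4
  have e1 : s(a, b) ∈ G.edgeSet := h1 (by simp)
  have e2 : s(c, d) ∈ G.edgeSet := h1 (by simp)
  rw [Set.disjoint_left] at hd
  rcases matching_cases h h3 h4 with rfl | rfl | rfl
  · exact absurd e1 (hd (by simp))
  · have e3 : s(a, c) ∉ G.edgeSet := hd (by simp)
    have e4 : s(b, d) ∉ G.edgeSet := hd (by simp)
    exact ⟨a, b, c, d, isSw_outcome h e1 e2 e3 e4 ho.symm⟩
  · have e3 : s(a, d) ∉ G.edgeSet := hd (by simp)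
    have e4 : s(b, c) ∉ G.edgeSet := hd (by simp)
    refine ⟨a, b, d, c, isSw_outcome ⟨h.1, h.2.2.1, h.2.1, h.2.2.2.2.1, h.2.2.2.1,
      h.2.2.2.2.2.symm⟩ e1 (G.adj_symm e2) e3 e4 ?_⟩
    rw [← ho, Sym2.eq_swap (a := d) (b := c)]

/-- The random choice can be read off from the two graphs, so distinct choices that change the graph
have distinct outcomes. -/
theorem edgeSet_outcome {c : Finset (Sym2 (Fin n)) × Finset (Sym2 (Fin n))}
    (hc : c ∈ switchChoices G) (ho : switchOutcome G c = G') (hne : G ≠ G') :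
    (c.1 : Set (Sym2 (Fin n))) = G.edgeSet \ G'.edgeSet ∧
      (c.2 : Set (Sym2 (Fin n))) = G'.edgeSet \ G.edgeSet := by
  obtain ⟨h1, h2, h3, h4⟩ := mem_switchChoices.mp hc
  unfold switchOutcome at ho
  split_ifs at ho with hd
  swap
  · exact absurd ho hne
  subst ho
  have h5 : ∀ e ∈ (c.2 : Set (Sym2 (Fin n))), ¬ e.IsDiag := fun e he => not_isDiag_of_mem h3 he
  rw [SimpleGraph.edgeSet_sup, SimpleGraph.edgeSet_deleteEdges, SimpleGraph.edgeSet_fromEdgeSet]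
  rw [Set.disjoint_left] at hd
  have h6 : ∀ e ∈ Sym2.diagSet (α := Fin n), e.IsDiag := fun e he => by simpa using he
  constructor
  · ext e
    simp only [Set.mem_sdiff, Set.mem_union]
    have := @h1 e
    have := @hd e
    tauto
  · ext e
    simp only [Set.mem_sdiff, Set.mem_union]
    have := @h1 e
    have := @hd e
    have := h5 e
    have := h6 e
    tauto

theorem IsSw.edgeSet_sdiff {a b c d : Fin n} (h : IsSw G G' a b c d) :
    G.edgeSet \ G'.edgeSet = {s(a, b), s(c, d)} := by
  ext e
  induction e with | _ p q
  simp only [Set.mem_sdiff, SimpleGraph.mem_edgeSet, Set.mem_insert_iff, Set.mem_singleton_iff]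
  rw [h.adj_iff]
  constructor
  · tauto
  · rintro (h1 | h1)
    · have := h.not_ab
      rw [← adj_of_sym2_eq h1, h.adj_iff] at this
      exact ⟨(adj_of_sym2_eq h1).mpr h.adj_ab, this⟩
    · have := h.not_cd
      rw [← adj_of_sym2_eq h1, h.adj_iff] at this
      exact ⟨(adj_of_sym2_eq h1).mpr h.adj_cd, this⟩

-- Every proper transition comes from exactly one choice, hence has probability one over the number
-- of choices.
open Classical in
theorem IsSw.card_choices {a b c d : Fin n} (h : IsSw G G' a b c d) :
    ((switchChoices G).filter fun c => switchOutcome G c = G').card = 1 := by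
  have hd : a ≠ b ∧ a ≠ c ∧ a ≠ d ∧ b ≠ c ∧ b ≠ d ∧ c ≠ d :=
    ⟨h.hab, h.hac, h.had, h.hbc, h.hbd, h.hcd⟩
  have hd' : a ≠ c ∧ a ≠ b ∧ a ≠ d ∧ c ≠ b ∧ c ≠ d ∧ b ≠ d :=
    ⟨h.hac, h.hab, h.had, h.hbc.symm, h.hcd, h.hbd⟩
  have h1 : (({s(a, b), s(c, d)}, {s(a, c), s(b, d)}) :
      Finset (Sym2 (Fin n)) × Finset (Sym2 (Fin n))) ∈ switchChoices G := by
    rw [mem_switchChoices]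
    refine ⟨?_, isDisjointPair_pair hd, isDisjointPair_pair hd', ?_⟩
    · intro e he
      simp only [Finset.coe_insert, Finset.coe_singleton, Set.mem_insert_iff,
        Set.mem_singleton_iff] at he
      rcases he with rfl | rfl
      · exact h.adj_ab
      · exact h.adj_cd
    · rw [endpoints_pair, endpoints_pair]
      congr 1
      exact Finset.insert_comm _ _ _
  have h2 : switchOutcome G ({s(a, b), s(c, d)}, {s(a, c), s(b, d)}) = G' := by
    unfold switchOutcome
    rw [if_pos]
    · ext p q
      rw [(isSw_outcome hd h.adj_ab h.adj_cd h.not_ac h.not_bd rfl).adj_iff, h.adj_iff]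
    · rw [Set.disjoint_left]
      intro e he
      simp only [Finset.coe_insert, Finset.coe_singleton, Set.mem_insert_iff,
        Set.mem_singleton_iff] at he
      rcases he with rfl | rfl
      · exact h.not_ac
      · exact h.not_bd
  rw [Finset.card_eq_one]
  refine ⟨({s(a, b), s(c, d)}, {s(a, c), s(b, d)}), ?_⟩
  ext c'
  rw [Finset.mem_filter, Finset.mem_singleton]
  constructor
  · rintro ⟨g1, g2⟩
    have e1 := edgeSet_outcome g1 g2 h.ne
    have e2 := edgeSet_outcome h1 h2 h.ne
    refine Prod.ext ?_ ?_
    · exact Finset.coe_injective (e1.1.trans e2.1.symm)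
    · exact Finset.coe_injective (e1.2.trans e2.2.symm)
  · rintro rfl
    exact ⟨h1, h2⟩

theorem IsSw.switchProb_eq {a b c d : Fin n} (h : IsSw G G' a b c d) :
    switchProb G G' = ((switchChoices G).card : ℝ)⁻¹ := by
  unfold switchProb
  rw [h.card_choices, Nat.cast_one, one_div]

theorem exists_isSw_of_switchProb_pos (hne : G ≠ G') (h : 0 < switchProb G G') :
    ∃ a b c d, IsSw G G' a b c d := by
  classical
  unfold switchProb at h
  have h1 : (((switchChoices G).filter fun c => switchOutcome G c = G').card : ℝ) ≠ 0 := by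
    intro h0
    rw [h0, zero_div] at h
    exact lt_irrefl _ h
  rw [Nat.cast_ne_zero, Finset.card_ne_zero] at h1
  obtain ⟨c, hc⟩ := h1
  rw [Finset.mem_filter] at hc
  exact exists_isSw_of_outcome hc.1 hc.2 hne

theorem IsSw.choices_nonempty {a b c d : Fin n} (h : IsSw G G' a b c d) :
    0 < (switchChoices G).card := by
  classical
  have h1 := h.card_choices
  have h2 := Finset.card_filter_le (switchChoices G) fun c => switchOutcome G c = G'
  omega

theorem IsSw.switchProb_pos {a b c d : Fin n} (h : IsSw G G' a b c d) : 0 < switchProb G G' := by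
  rw [h.switchProb_eq, inv_pos, Nat.cast_pos]
  exact h.choices_nonempty

/-- The number of graphs that are one switch away is at most the number of choices. -/
theorem card_le_card_switchChoices (s : Finset (SimpleGraph (Fin n)))
    (h : ∀ G' ∈ s, ∃ a b c d, IsSw G G' a b c d) : s.card ≤ (switchChoices G).card := by
  classical
  have h1 : ∀ G' : s, ∃ c ∈ switchChoices G, switchOutcome G c = G'.1 := by
    rintro ⟨G', hG'⟩
    obtain ⟨a, b, c, d, hs⟩ := h G' hG'
    have h2 := hs.card_choices
    have h3 : ((switchChoices G).filter fun c => switchOutcome G c = G').Nonempty := by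
      rw [← Finset.card_pos, h2]; exact one_pos
    obtain ⟨c, hc⟩ := h3
    rw [Finset.mem_filter] at hc
    exact ⟨c, hc.1, hc.2⟩
  choose f hf1 hf2 using h1
  rw [← Finset.card_attach]
  refine Finset.card_le_card_of_injOn f (fun G' _ => hf1 G') ?_
  intro x _ y _ hxy
  exact Subtype.ext ((hf2 x).symm.trans (hxy ▸ hf2 y))

/-! ### The number of choices -/

open Classical in
/-- The edges of a graph, as a finite set. -/
noncomputable def edgesOf (G : SimpleGraph (Fin n)) : Finset (Sym2 (Fin n)) :=
  Finset.univ.filter fun e => e ∈ G.edgeSet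

theorem mem_edgesOf {e : Sym2 (Fin n)} : e ∈ edgesOf G ↔ e ∈ G.edgeSet := by simp [edgesOf]

open Classical in
/-- The edges that contain a vertex. -/
noncomputable def edgesAt (G : SimpleGraph (Fin n)) (v : Fin n) : Finset (Sym2 (Fin n)) :=
  (edgesOf G).filter fun e => v ∈ e

theorem card_edgesAt (G : SimpleGraph (Fin n)) (v : Fin n) :
    (edgesAt G v).card = (nbrs G v).card := by
  classical
  symm
  refine Finset.card_bij (fun w _ => s(v, w)) ?_ ?_ ?_
  · intro w hw
    rw [mem_nbrs] at hw
    simp [edgesAt, mem_edgesOf, hw]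
  · intro w _ w' _ h
    rwa [Sym2.congr_right] at h
  · intro e he
    simp only [edgesAt, mem_edgesOf, Finset.mem_filter] at he
    obtain ⟨w, rfl⟩ := he.2
    exact ⟨w, mem_nbrs.mpr he.1, rfl⟩

theorem two_mul_card_edgesOf {k : ℕ} (hG : Reg G k) : 2 * (edgesOf G).card = n * k := by
  classical
  have h1 := Finset.sum_card_bipartiteAbove_eq_sum_card_bipartiteBelow
    (s := edgesOf G) (t := (Finset.univ : Finset (Fin n))) (fun e v => v ∈ e)
  have h2 : ∀ e ∈ edgesOf G,
      (Finset.bipartiteAbove (fun e v => v ∈ e) (Finset.univ : Finset (Fin n)) e).card = 2 := by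
    intro e he
    induction e with | _ p q
    rw [mem_edgesOf, SimpleGraph.mem_edgeSet] at he
    rw [← Finset.card_pair he.ne]
    congr 1
    ext v
    simp [Finset.bipartiteAbove]
  have h3 : ∀ v ∈ (Finset.univ : Finset (Fin n)),
      (Finset.bipartiteBelow (fun e v => v ∈ e) (edgesOf G) v).card = k := by
    intro v _
    rw [← hG v, ← card_edgesAt]
    rfl
  rw [Finset.sum_congr rfl h2, Finset.sum_congr rfl h3] at h1
  simp at h1
  omega

open Classical in
/-- The pairs of disjoint edges. -/
noncomputable def disjointPairs (G : SimpleGraph (Fin n)) : Finset (Finset (Sym2 (Fin n))) :=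
  Finset.univ.filter fun R => (R : Set (Sym2 (Fin n))) ⊆ G.edgeSet ∧ IsDisjointPair R

/-- Exactly `2k - 1` edges meet `ab`, including `ab` itself; any other edge completes the pair. -/
theorem card_disjointPairs_containing {k : ℕ} (hG : Reg G k) {a b : Fin n} (hab : G.Adj a b) :
    ((disjointPairs G).filter fun R => s(a, b) ∈ R).card + 2 * k = (edgesOf G).card + 1 := by
  classical
  have h1 : ((disjointPairs G).filter fun R => s(a, b) ∈ R).card =
      ((edgesOf G) \ (edgesAt G a ∪ edgesAt G b)).card := by
    symm
    refine Finset.card_bij (fun f _ => {s(a, b), f}) ?_ ?_ ?_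
    · intro f hf
      induction f with | _ c d
      simp only [edgesAt, mem_edgesOf, Finset.mem_filter, Finset.mem_sdiff, Finset.mem_union,
        SimpleGraph.mem_edgeSet, Sym2.mem_iff] at hf
      simp only [disjointPairs, Finset.mem_filter, Finset.mem_univ, true_and]
      refine ⟨⟨?_, isDisjointPair_pair ?_⟩, by simp⟩
      · intro e he
        simp only [Finset.coe_insert, Finset.coe_singleton, Set.mem_insert_iff,
          Set.mem_singleton_iff] at he
        rcases he with rfl | rfl
        · exact hab
        · exact hf.1
      · have := hab.ne
        have := hf.1.ne
        tauto
    · intro f hf f' hf' h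
      have h2 : f ≠ s(a, b) := by
        rintro rfl
        simp [edgesAt, mem_edgesOf, hab] at hf
      have h3 : f ∈ ({s(a, b), f'} : Finset (Sym2 (Fin n))) := h ▸ by simp
      simp only [Finset.mem_insert, Finset.mem_singleton] at h3
      tauto
    · intro R hR
      simp only [disjointPairs, Finset.mem_filter, Finset.mem_univ, true_and] at hR
      obtain ⟨⟨hR1, hR2⟩, hR3⟩ := hR
      obtain ⟨p, q, c, d, hd, rfl⟩ := hR2.exists_eq
      have key : ∀ p q c d : Fin n, (p ≠ q ∧ p ≠ c ∧ p ≠ d ∧ q ≠ c ∧ q ≠ d ∧ c ≠ d) →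
          G.Adj c d → s(a, b) = s(p, q) →
          s(c, d) ∈ edgesOf G \ (edgesAt G a ∪ edgesAt G b) := by
        intro p q c d hd hcd he
        simp only [edgesAt, mem_edgesOf, Finset.mem_filter, Finset.mem_sdiff, Finset.mem_union,
          SimpleGraph.mem_edgeSet, Sym2.mem_iff]
        rw [Sym2.eq_iff] at he
        refine ⟨hcd, ?_⟩
        rcases he with ⟨rfl, rfl⟩ | ⟨rfl, rfl⟩ <;> tauto
      have h1 : s(p, q) ∈ G.edgeSet := hR1 (by simp)
      have h2 : s(c, d) ∈ G.edgeSet := hR1 (by simp)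
      simp only [Finset.mem_insert, Finset.mem_singleton] at hR3
      rcases hR3 with h | h
      · exact ⟨s(c, d), key p q c d hd h2 h, by rw [h]⟩
      · refine ⟨s(p, q), key c d p q (by tauto) h1 h, by rw [h, Finset.pair_comm]⟩
  have h2 : edgesAt G a ∩ edgesAt G b = {s(a, b)} := by
    ext e
    simp only [edgesAt, mem_edgesOf, Finset.mem_filter, Finset.mem_inter, Finset.mem_singleton]
    constructor
    · rintro ⟨⟨_, ha⟩, _, hb⟩
      exact (Sym2.mem_and_mem_iff hab.ne).mp ⟨ha, hb⟩
    · rintro rfl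
      simp [hab]
  have h3 := Finset.card_union_add_card_inter (edgesAt G a) (edgesAt G b)
  rw [h2, card_edgesAt, card_edgesAt, hG, hG, Finset.card_singleton] at h3
  have h4 : edgesAt G a ∪ edgesAt G b ⊆ edgesOf G :=
    Finset.union_subset (Finset.filter_subset _ _) (Finset.filter_subset _ _)
  have h5 := Finset.card_sdiff_add_card_eq_card h4
  omega

/-- Double counting of the incidences between disjoint pairs and their two edges, written without
subtraction. -/
theorem card_disjointPairs {k : ℕ} (hG : Reg G k) :
    2 * (disjointPairs G).card + (edgesOf G).card * (2 * k) =
      (edgesOf G).card * ((edgesOf G).card + 1) := by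
  classical
  have h1 := Finset.sum_card_bipartiteAbove_eq_sum_card_bipartiteBelow
    (s := disjointPairs G) (t := edgesOf G) (fun R e => e ∈ R)
  have h2 : ∀ R ∈ disjointPairs G,
      (Finset.bipartiteAbove (fun R e => e ∈ R) (edgesOf G) R).card = 2 := by
    intro R hR
    simp only [disjointPairs, Finset.mem_filter, Finset.mem_univ, true_and] at hR
    rw [← hR.2.1]
    congr 1
    ext e
    simp only [Finset.bipartiteAbove, Finset.mem_filter, mem_edgesOf]
    exact ⟨fun h => h.2, fun h => ⟨hR.1 h, h⟩⟩
  have h3 : ∀ e ∈ edgesOf G,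
      (Finset.bipartiteBelow (fun R e => e ∈ R) (disjointPairs G) e).card + 2 * k =
        (edgesOf G).card + 1 := by
    intro e he
    induction e with | _ a b
    exact card_disjointPairs_containing hG (mem_edgesOf.mp he)
  have h4 := Finset.sum_congr rfl h3
  rw [Finset.sum_add_distrib, ← h1, Finset.sum_congr rfl h2] at h4
  simp only [Finset.sum_const, smul_eq_mul] at h4
  rw [mul_comm 2]
  exact h4

theorem card_switchChoices (G : SimpleGraph (Fin n)) :
    (switchChoices G).card = (disjointPairs G).card * 3 := by
  classical
  have h1 : switchChoices G = (disjointPairs G).biUnion fun R =>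
      (Finset.univ.filter fun R' => IsDisjointPair R' ∧ endpoints R' = endpoints R).map
        ⟨fun R' => (R, R'), fun x y h => by simpa using h⟩ := by
    ext ⟨R, R'⟩
    simp only [mem_switchChoices, disjointPairs, Finset.mem_biUnion, Finset.mem_filter,
      Finset.mem_univ, true_and, Finset.mem_map]
    constructor
    · rintro ⟨h1, h2, h3, h4⟩
      exact ⟨R, ⟨h1, h2⟩, R', ⟨h3, h4⟩, rfl⟩
    · rintro ⟨_, ⟨h1, h2⟩, _, ⟨h3, h4⟩, he⟩
      obtain ⟨rfl, rfl⟩ := Prod.mk.inj he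
      exact ⟨h1, h2, h3, h4⟩
  rw [h1, Finset.card_biUnion]
  · refine Finset.sum_const_nat fun R hR => ?_
    rw [Finset.card_map]
    simp only [disjointPairs, Finset.mem_filter, Finset.mem_univ, true_and] at hR
    obtain ⟨a, b, c, d, h, rfl⟩ := hR.2.exists_eq
    obtain ⟨h1, h2, h3, h4, h5, h6⟩ := h
    rw [Finset.card_eq_three]
    refine ⟨{s(a, b), s(c, d)}, {s(a, c), s(b, d)}, {s(a, d), s(b, c)}, ?_, ?_, ?_, ?_⟩
    · intro h
      have : s(a, b) ∈ ({s(a, c), s(b, d)} : Finset (Sym2 (Fin n))) := h ▸ by simp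
      simp at this
      grind
    · intro h
      have : s(a, b) ∈ ({s(a, d), s(b, c)} : Finset (Sym2 (Fin n))) := h ▸ by simp
      simp at this
      grind
    · intro h
      have : s(a, c) ∈ ({s(a, d), s(b, c)} : Finset (Sym2 (Fin n))) := h ▸ by simp
      simp at this
      grind
    · ext R'
      simp only [Finset.mem_filter, Finset.mem_univ, true_and, Finset.mem_insert,
        Finset.mem_singleton, endpoints_pair]
      constructor
      · rintro ⟨g1, g2⟩
        exact matching_cases ⟨h1, h2, h3, h4, h5, h6⟩ g1 g2
      · rintro (rfl | rfl | rfl)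
        · exact ⟨isDisjointPair_pair ⟨h1, h2, h3, h4, h5, h6⟩, endpoints_pair _ _ _ _⟩
        · refine ⟨isDisjointPair_pair ⟨h2, h1, h3, h4.symm, h6, h5⟩, ?_⟩
          rw [endpoints_pair]; ext; simp; tauto
        · refine ⟨isDisjointPair_pair ⟨h3, h1, h2, h5.symm, h6.symm, h4⟩, ?_⟩
          rw [endpoints_pair]; ext; simp; tauto
  · intro R _ R' _ hne
    rw [Function.onFun, Finset.disjoint_left]
    rintro ⟨A, B⟩ h h'
    rw [Finset.mem_map] at h h'
    obtain ⟨_, _, he⟩ := h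
    obtain ⟨_, _, he'⟩ := h'
    exact hne ((Prod.mk.inj he).1.trans (Prod.mk.inj he').1.symm)

/-- Since regularity fixes the number of choices, all non-loop transitions of the switch chain are
equally likely; the congestion comparison relies on this. -/
theorem card_switchChoices_eq {k : ℕ} {H : SimpleGraph (Fin n)} (hG : Reg G k) (hH : Reg H k) :
    (switchChoices G).card = (switchChoices H).card := by
  have h1 := two_mul_card_edgesOf hG
  have h2 := two_mul_card_edgesOf hH
  have h3 := card_disjointPairs hG
  have h4 := card_disjointPairs hH
  rw [card_switchChoices, card_switchChoices]
  have h5 : (edgesOf G).card = (edgesOf H).card := by omega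
  rw [h5] at h3
  omega

theorem two_mul_card_switchChoices_le {r : ℕ} (hr : 1 ≤ r) (hG : Reg G (2 * r)) :
    2 * (switchChoices G).card ≤ 3 * (r * n) ^ 2 := by
  have h1 := two_mul_card_edgesOf hG
  have h3 := card_disjointPairs hG
  have h5 : (edgesOf G).card = r * n := by
    have : n * (2 * r) = 2 * (r * n) := by ring
    omega
  rw [h5] at h3
  rw [card_switchChoices]
  nlinarith [Nat.zero_le (r * n), mul_le_mul_of_nonneg_left hr (Nat.zero_le (r * n))]

end Probabilities

/-! ### The proportion of disconnected graphs -/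

section Numerics

/-- Half the number of quadruples `(a, b, c, d)`, up to the ones that are counted with a negative
sign, such that `ab` lies inside a set of `s` vertices with `2j` boundary edges and `cd` outside. -/
def crossing (r s n j : ℕ) : ℤ :=
  2 * ((r * s - j : ℤ) * (r * (n - s) - j)) - 2 * j * (2 * r - 1) ^ 2

theorem factorial_two_mul_eq (s : ℕ) :
    (2 * s).factorial = s.factorial * ∏ j ∈ Finset.range s, 2 * (2 * j + 1) := by
  induction s with
  | zero => rfl
  | succ s ih =>
    rw [Finset.prod_range_succ, mul_add_one, Nat.factorial_succ, Nat.factorial_succ, ih,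
      Nat.factorial_succ]
    ring

/-- Both sides equal `(2s)! / s!`. -/
theorem prod_two_mul_add_one (s : ℕ) :
    ∏ j ∈ Finset.range s, 2 * (2 * j + 1) = ∏ j ∈ Finset.range s, (2 * s - j) := by
  have h1 := factorial_two_mul_eq s
  have h2 := Nat.factorial_mul_descFactorial (n := 2 * s) (k := s) (by omega)
  rw [show 2 * s - s = s by omega, h1] at h2
  rw [← Nat.descFactorial_eq_prod_range]
  exact (Nat.eq_of_mul_eq_mul_left (Nat.factorial_pos s) h2).symm

/-- With `A = rs - j` and `B = r(n-s) - j`, the quantity is `2AB - 2j(2r-1)²`. One copy of `AB` is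
at least `(r-1)² s (n-s)`, which pays for the subtracted term when `n` is large; the other copy is
at least `(2s-j)(n-j)` because `r ≥ 2`. -/
theorem crossing_lower_bound {r s n j : ℕ} (hr : 2 ≤ r) (hn : 2 * s ≤ n) (hj : j < s)
    (hbig : 4 * (2 * r - 1 : ℤ) ^ 2 ≤ n * (r - 1) ^ 2) :
    ((n - j : ℕ) : ℤ) * ((2 * s - j : ℕ) : ℤ) ≤ crossing r s n j := by
  rw [Nat.cast_sub (by omega), Nat.cast_sub (by omega)]
  push_cast
  obtain ⟨t, rfl⟩ : ∃ t, r = t + 2 := ⟨r - 2, by omega⟩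
  obtain ⟨m, rfl⟩ : ∃ m, n = 2 * s + m := ⟨n - 2 * s, by omega⟩
  obtain ⟨i, rfl⟩ : ∃ i, s = j + 1 + i := ⟨s - j - 1, by omega⟩
  unfold crossing
  push_cast at hbig ⊢
  have h1 : (0 : ℤ) ≤ t := by positivity
  have h2 : (0 : ℤ) ≤ m := by positivity
  have h3 : (0 : ℤ) ≤ i := by positivity
  have h4 : (0 : ℤ) ≤ j := by positivity
  generalize (t : ℤ) = t at *
  generalize (m : ℤ) = m at *
  generalize (i : ℤ) = i at *
  generalize (j : ℤ) = j at *
  set A : ℤ := (t + 2) * (j + 1 + i) - j with hA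
  set B : ℤ := (t + 2) * (2 * (j + 1 + i) + m - (j + 1 + i)) - j with hB
  have hA1 : (t + 1) * (j + 1 + i) ≤ A := by rw [hA]; nlinarith
  have hA2 : 2 * (j + 1 + i) - j ≤ A := by rw [hA]; nlinarith
  have hB1 : (t + 1) * (j + 1 + i + m) ≤ B := by rw [hB]; nlinarith
  have hB2 : 2 * (j + 1 + i) + m - j ≤ B := by rw [hB]; nlinarith
  have hAB : (2 * (j + 1 + i) - j) * (2 * (j + 1 + i) + m - j) ≤ A * B :=
    mul_le_mul hA2 hB2 (by linarith) (by linarith)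
  have hAB' : (t + 1) * (j + 1 + i) * ((t + 1) * (j + 1 + i + m)) ≤ A * B :=
    mul_le_mul hA1 hB1 (by positivity) (by nlinarith)
  have h5 : 2 * j * (2 * (t + 2) - 1) ^ 2 ≤ A * B := by
    refine le_trans ?_ hAB'
    have h6 : j * (4 * (2 * (t + 2) - 1) ^ 2) ≤
        j * ((2 * (j + 1 + i) + m) * (t + 2 - 1) ^ 2) := mul_le_mul_of_nonneg_left hbig h4
    have h7 : 0 ≤ (t + 1) ^ 2 * (2 * (1 + i) * (j + 1 + i + m) + j * m) := by positivity
    nlinarith [h6, h7]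
  nlinarith [hAB, h5]

theorem exists_crossing_bound_of_large {r s n : ℕ} (hr : 2 ≤ r) (hn : 2 * s ≤ n)
    (hbig : 4 * (2 * r - 1 : ℤ) ^ 2 ≤ n * (r - 1) ^ 2) :
    ∃ J : ℕ, (∀ j < J, 0 < crossing r s n j) ∧
      (n.choose s : ℤ) * (∏ j ∈ Finset.range J, ((j + 1 : ℤ) * (2 * j + 1))) * 2 ^ s ≤
        ∏ j ∈ Finset.range J, crossing r s n j := by
  refine ⟨s, fun j hj => ?_, ?_⟩
  · refine lt_of_lt_of_le ?_ (crossing_lower_bound hr hn hj hbig)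
    have h1 : 0 < n - j := by omega
    have h2 : 0 < 2 * s - j := by omega
    positivity
  -- The lower bounds multiply up exactly: `∏ (n-j)` is `s!` times the binomial coefficient, `∏
  -- (j+1) = s!`, and `∏ 2(2j+1) = ∏ (2s-j)`. This is why `J = s` works.
  · have h1 : (n.choose s) * (∏ j ∈ Finset.range s, ((j + 1) * (2 * j + 1))) * 2 ^ s =
        ∏ j ∈ Finset.range s, ((n - j) * (2 * s - j)) := by
      rw [Finset.prod_mul_distrib, Finset.prod_mul_distrib, ← prod_two_mul_add_one,
        ← Nat.descFactorial_eq_prod_range, Nat.descFactorial_eq_factorial_mul_choose,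
        Finset.prod_mul_distrib, Finset.prod_const, Finset.card_range,
        Finset.prod_range_add_one_eq_factorial]
      ring
    have h2 := congrArg (Nat.cast : ℕ → ℤ) h1
    push_cast at h2
    rw [h2]
    refine Finset.prod_le_prod (fun j _ => by positivity) fun j hj => ?_
    exact crossing_lower_bound hr hn (Finset.mem_range.mp hj) hbig

-- The finitely many `(r, n)` that the estimate for large `n` misses: `4(2r-1)² ≤ n(r-1)²` holds
-- from `n = 36, 25, 22` on for `r = 2, 3, 4`. Here the boundary is raised `s/2 + 1` times only, and
-- the falling factorial replaces the binomial coefficient to ease evaluation.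
set_option maxRecDepth 100000 in
theorem crossing_bound_small :
    ∀ rn ∈ [(2, 36), (3, 25), (4, 22)], ∀ n < rn.2, ∀ s < n, 2 * rn.1 + 1 ≤ s → 2 * s ≤ n →
      (∀ j < s / 2 + 1, 0 < crossing rn.1 s n j) ∧
      (n.descFactorial s : ℤ) * (∏ j ∈ Finset.range (s / 2 + 1), ((j + 1 : ℤ) * (2 * j + 1))) *
          2 ^ s ≤
        s.factorial * ∏ j ∈ Finset.range (s / 2 + 1), crossing rn.1 s n j := by
  decide +kernel

theorem exists_crossing_bound {r s n : ℕ} (hr : 2 ≤ r) (hs : 2 * r + 1 ≤ s) (hn : 2 * s ≤ n) :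
    ∃ J : ℕ, (∀ j < J, 0 < crossing r s n j) ∧
      (n.choose s : ℤ) * (∏ j ∈ Finset.range J, ((j + 1 : ℤ) * (2 * j + 1))) * 2 ^ s ≤
        ∏ j ∈ Finset.range J, crossing r s n j := by
  by_cases hbig : 4 * (2 * r - 1 : ℤ) ^ 2 ≤ n * (r - 1) ^ 2
  · exact exists_crossing_bound_of_large hr hn hbig
  -- For `r ≥ 5` one has `n ≥ 2s ≥ 4r + 2 ≥ 22`, which already makes `n` large.
  · have h5 : r < 5 := by
      by_contra h5
      refine hbig ?_
      obtain ⟨t, rfl⟩ : ∃ t, r = t + 5 := ⟨r - 5, by omega⟩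
      have h6 : (22 : ℤ) ≤ n := by exact_mod_cast (by omega : 22 ≤ n)
      push_cast
      have h7 : (0 : ℤ) ≤ t := by positivity
      nlinarith [mul_le_mul_of_nonneg_right h6 (sq_nonneg ((t : ℤ) + 5 - 1))]
    refine ⟨s / 2 + 1, ?_⟩
    have hrn : (r, if r = 2 then 36 else if r = 3 then 25 else 22) ∈ [(2, 36), (3, 25), (4, 22)] := by
      interval_cases r <;> simp
    obtain ⟨e1, e2⟩ := crossing_bound_small _ hrn n (by
      interval_cases r <;> norm_num at hbig ⊢ <;> omega) s (by omega) hs hn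
    refine ⟨e1, ?_⟩
    rw [Nat.descFactorial_eq_factorial_mul_choose, Nat.cast_mul, mul_assoc, mul_assoc,
      mul_le_mul_iff_right₀ (by positivity), ← mul_assoc] at e2
    exact e2

end Numerics

/-! ### Switching argument: few regular graphs have a vertex set with empty boundary. -/

section Ratio

open Classical

variable {n : ℕ} {G G' H : SimpleGraph (Fin n)} {a b c d : Fin n}

/-- The result of a switch. -/
noncomputable def sw (G : SimpleGraph (Fin n)) (a b c d : Fin n) : SimpleGraph (Fin n) :=
  G.deleteEdges (({s(a, b), s(c, d)} : Finset (Sym2 (Fin n))) : Set (Sym2 (Fin n))) ⊔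
    SimpleGraph.fromEdgeSet (({s(a, c), s(b, d)} : Finset (Sym2 (Fin n))) : Set (Sym2 (Fin n)))

theorem isSw_sw (h : a ≠ b ∧ a ≠ c ∧ a ≠ d ∧ b ≠ c ∧ b ≠ d ∧ c ≠ d) (hab : G.Adj a b)
    (hcd : G.Adj c d) (hac : ¬ G.Adj a c) (hbd : ¬ G.Adj b d) : IsSw G (sw G a b c d) a b c d :=
  isSw_outcome h hab hcd hac hbd rfl

theorem IsSw.left_unique (h : IsSw G G' a b c d) (h' : IsSw H G' a b c d) : G = H := by
  ext p q
  rw [h.symm.adj_iff, h'.symm.adj_iff]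

/-- If `ac` is an edge it is a boundary dart of `S`, and then `b` is one of the other `k - 1`
neighbours of `a`, and `d` one of the other `k - 1` neighbours of `c`. -/
theorem card_bad_quadruples {k : ℕ} (hG : Reg G k) (S : Set (Fin n)) :
    ((insideDarts G S ×ˢ insideDarts G Sᶜ).filter fun q => G.Adj q.1.1 q.2.1).card ≤
      (k - 1) ^ 2 * (cutDarts G S).card := by
  refine Finset.card_le_mul_card_image_of_maps_to (f := fun q => (q.1.1, q.2.1)) ?_ _ ?_
  · rintro ⟨⟨a, b⟩, ⟨c, d⟩⟩ h
    simp only [Finset.mem_filter, Finset.mem_product, mem_insideDarts] at h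
    rw [mem_cutDarts]
    exact ⟨h.2, h.1.1.2.1, h.1.2.2.1⟩
  · rintro ⟨a, c⟩ hac
    rw [mem_cutDarts] at hac
    have h1 : (((nbrs G a).erase c) ×ˢ ((nbrs G c).erase a)).card = (k - 1) ^ 2 := by
      rw [Finset.card_product, Finset.card_erase_of_mem (mem_nbrs.mpr hac.1),
        Finset.card_erase_of_mem (mem_nbrs.mpr hac.1.symm), hG, hG, sq]
    rw [← h1]
    refine Finset.card_le_card_of_injOn (fun q => (q.1.2, q.2.2)) ?_ ?_
    · rintro ⟨⟨a', b⟩, ⟨c', d⟩⟩ h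
      simp only [Finset.coe_filter, Finset.mem_filter, Finset.mem_product, mem_insideDarts,
        Set.mem_ofPred_eq, Prod.mk.injEq] at h
      obtain ⟨⟨⟨⟨g1, h2, h3⟩, h4, h5, h6⟩, h7⟩, rfl, rfl⟩ := h
      simp only [Finset.mem_coe, Finset.mem_product, Finset.mem_erase, mem_nbrs]
      refine ⟨⟨?_, g1⟩, ?_, h4⟩
      · rintro rfl; exact h5 h3
      · rintro rfl; exact h6 h2
    · rintro ⟨⟨a', b⟩, ⟨c', d⟩⟩ h ⟨⟨a'', b'⟩, ⟨c'', d'⟩⟩ h' he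
      simp only [Finset.coe_filter, Set.mem_ofPred_eq, Prod.mk.injEq] at h h' he
      obtain ⟨_, rfl, rfl⟩ := h
      obtain ⟨_, rfl, rfl⟩ := h'
      obtain ⟨rfl, rfl⟩ := he
      rfl

/-- The pairs of darts that can be switched so that two more edges leave `S`. -/
noncomputable def goodQuadruples (G : SimpleGraph (Fin n)) (S : Set (Fin n)) :
    Finset ((Fin n × Fin n) × Fin n × Fin n) :=
  (insideDarts G S ×ˢ insideDarts G Sᶜ).filter fun q =>
    ¬ G.Adj q.1.1 q.2.1 ∧ ¬ G.Adj q.1.2 q.2.2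

theorem card_goodQuadruples {k : ℕ} (hG : Reg G k) (S : Set (Fin n)) :
    (insideDarts G S).card * (insideDarts G Sᶜ).card ≤
      (goodQuadruples G S).card + 2 * ((k - 1) ^ 2 * (cutDarts G S).card) := by
  set P := insideDarts G S ×ˢ insideDarts G Sᶜ with hP
  have h1 : P ⊆ (goodQuadruples G S ∪ P.filter fun q => G.Adj q.1.1 q.2.1) ∪
      P.filter fun q => G.Adj q.1.2 q.2.2 := by
    intro q hq
    simp only [goodQuadruples, Finset.mem_union, Finset.mem_filter, ← hP, hq, true_and]
    tauto
  -- Reversing both darts exchanges the two ways in which a quadruple can be bad.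
  have h2 : (P.filter fun q => G.Adj q.1.2 q.2.2).card =
      (P.filter fun q => G.Adj q.1.1 q.2.1).card := by
    refine Finset.card_bij' (fun q _ => (q.1.swap, q.2.swap)) (fun q _ => (q.1.swap, q.2.swap))
      ?_ ?_ ?_ ?_
    · rintro ⟨⟨a, b⟩, ⟨c, d⟩⟩ h
      simp only [hP, Finset.mem_filter, Finset.mem_product, mem_insideDarts, Prod.fst_swap,
        Prod.snd_swap] at h ⊢
      exact ⟨⟨⟨h.1.1.1.symm, h.1.1.2.2, h.1.1.2.1⟩, h.1.2.1.symm, h.1.2.2.2, h.1.2.2.1⟩, h.2⟩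
    · rintro ⟨⟨a, b⟩, ⟨c, d⟩⟩ h
      simp only [hP, Finset.mem_filter, Finset.mem_product, mem_insideDarts, Prod.fst_swap,
        Prod.snd_swap] at h ⊢
      exact ⟨⟨⟨h.1.1.1.symm, h.1.1.2.2, h.1.1.2.1⟩, h.1.2.1.symm, h.1.2.2.2, h.1.2.2.1⟩, h.2⟩
    · intros; rfl
    · intros; rfl
  have h3 := card_bad_quadruples hG S
  have h4 := (Finset.card_le_card h1).trans (Finset.card_union_le _ _)
  have h5 := Finset.card_union_le (goodQuadruples G S) (P.filter fun q => G.Adj q.1.1 q.2.1)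
  rw [Finset.card_product] at h4
  rw [← hP] at h3
  omega

theorem isSw_of_mem_goodQuadruples {S : Set (Fin n)} {q : (Fin n × Fin n) × Fin n × Fin n}
    (hq : q ∈ goodQuadruples G S) : IsSw G (sw G q.1.1 q.1.2 q.2.1 q.2.2) q.1.1 q.1.2 q.2.1 q.2.2 := by
  obtain ⟨⟨a, b⟩, ⟨c, d⟩⟩ := q
  simp only [goodQuadruples, Finset.mem_filter, Finset.mem_product, mem_insideDarts,
    Set.mem_compl_iff] at hq
  obtain ⟨⟨⟨h1, h2, h3⟩, h4, h5, h6⟩, h7, h8⟩ := hq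
  exact isSw_sw ⟨h1.ne, ne_of_mem_of_not_mem h2 h5, ne_of_mem_of_not_mem h2 h6,
    ne_of_mem_of_not_mem h3 h5, ne_of_mem_of_not_mem h3 h6, h4.ne⟩ h1 h4 h7 h8

theorem IsSw.cutDarts_eq (h : IsSw G G' a b c d) {S : Set (Fin n)} (ha : a ∈ S) (hb : b ∈ S)
    (hc : c ∉ S) (hd : d ∉ S) :
    cutDarts G' S = insert (a, c) (insert (b, d) (cutDarts G S)) := by
  ext ⟨p, q⟩
  rw [mem_cutDarts, Finset.mem_insert, Finset.mem_insert, mem_cutDarts, h.adj_iff]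
  simp only [Sym2.eq_iff, Prod.mk.injEq]
  constructor
  · rintro ⟨h1, h2, h3⟩
    rcases h1 with h1 | (h1 | ⟨rfl, rfl⟩) | (h1 | ⟨rfl, rfl⟩)
    · exact Or.inr (Or.inr ⟨h1.1, h2, h3⟩)
    · exact Or.inl h1
    · exact absurd h2 hc
    · exact Or.inr (Or.inl h1)
    · exact absurd h2 hd
  · rintro (⟨rfl, rfl⟩ | ⟨rfl, rfl⟩ | ⟨h1, h2, h3⟩)
    · exact ⟨Or.inr (Or.inl (Or.inl ⟨rfl, rfl⟩)), ha, hc⟩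
    · exact ⟨Or.inr (Or.inr (Or.inl ⟨rfl, rfl⟩)), hb, hd⟩
    · refine ⟨Or.inl ⟨h1, ?_, ?_⟩, h2, h3⟩
      · rw [Ne, Sym2.eq_iff]; rintro (⟨rfl, rfl⟩ | ⟨rfl, rfl⟩) <;> contradiction
      · rw [Ne, Sym2.eq_iff]; rintro (⟨rfl, rfl⟩ | ⟨rfl, rfl⟩) <;> contradiction

theorem IsSw.card_cutDarts (h : IsSw G G' a b c d) {S : Set (Fin n)} (ha : a ∈ S) (hb : b ∈ S)
    (hc : c ∉ S) (hd : d ∉ S) : (cutDarts G' S).card = (cutDarts G S).card + 2 := by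
  rw [h.cutDarts_eq ha hb hc hd, Finset.card_insert_of_notMem, Finset.card_insert_of_notMem]
  · rw [mem_cutDarts]; exact fun h' => h.not_bd h'.1
  · rw [Finset.mem_insert, mem_cutDarts]
    rintro (h' | h')
    · exact h.hab (Prod.mk.inj h').1
    · exact h.not_ac h'.1

/-- Pairs of a `k`-regular graph and a set of `s` vertices that is left by `2 * j` edges. -/
noncomputable def cutPairs (n k s j : ℕ) : Finset (SimpleGraph (Fin n) × Finset (Fin n)) :=
  Finset.univ.filter fun p => Reg p.1 k ∧ p.2.card = s ∧ (cutDarts p.1 p.2).card = 2 * j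

theorem card_insideDarts_of_mem_cutPairs {k s j : ℕ} {p : SimpleGraph (Fin n) × Finset (Fin n)}
    (hp : p ∈ cutPairs n k s j) :
    (insideDarts p.1 p.2).card + 2 * j = s * k ∧
      (insideDarts p.1 (p.2 : Set (Fin n))ᶜ).card + 2 * j = (n - s) * k := by
  simp only [cutPairs, Finset.mem_filter, Finset.mem_univ, true_and] at hp
  obtain ⟨h1, h2, h3⟩ := hp
  constructor
  · have h := card_insideDarts_add p.1 (p.2 : Set (Fin n))
    rw [h3, Finset.sum_congr rfl fun v _ => h1 v, Finset.sum_const, smul_eq_mul] at h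
    rw [h, ← h2]
    congr 2
    ext; simp
  · have h := card_insideDarts_add p.1 (p.2 : Set (Fin n))ᶜ
    rw [card_cutDarts_compl, h3, Finset.sum_congr rfl fun v _ => h1 v, Finset.sum_const,
      smul_eq_mul] at h
    have h4 := Finset.card_compl p.2
    rw [h2, Fintype.card_fin] at h4
    rw [h, ← h4]
    congr 2
    ext; simp

/-- Performing the switch creates the boundary darts `(a, c)` and `(b, d)`. The new graph and this
ordered pair of darts determine the old graph and the quadruple, as a switch can be undone, and
among `2j + 2` boundary darts there are `(2j+2)(2j+1)` ordered pairs. -/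
theorem sum_card_goodQuadruples_le (n k s j : ℕ) :
    ∑ p ∈ cutPairs n k s j, (goodQuadruples p.1 p.2).card ≤
      (cutPairs n k s (j + 1)).card * ((2 * j + 2) * (2 * j + 1)) := by
  have h1 : ∑ p ∈ cutPairs n k s (j + 1), (cutDarts p.1 (p.2 : Set (Fin n))).offDiag.card =
      (cutPairs n k s (j + 1)).card * ((2 * j + 2) * (2 * j + 1)) := by
    refine Finset.sum_const_nat fun p hp => ?_
    simp only [cutPairs, Finset.mem_filter, Finset.mem_univ, true_and] at hp
    rw [Finset.offDiag_card, hp.2.2]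
    rw [show 2 * (j + 1) * (2 * (j + 1)) = (2 * j + 2) * (2 * j + 1) + 2 * (j + 1) by ring]
    simp
  rw [← h1, ← Finset.card_sigma, ← Finset.card_sigma]
  refine Finset.card_le_card_of_injOn
    (fun z => ⟨(sw z.1.1 z.2.1.1 z.2.1.2 z.2.2.1 z.2.2.2, z.1.2),
      ((z.2.1.1, z.2.2.1), (z.2.1.2, z.2.2.2))⟩) ?_ ?_
  · rintro ⟨⟨G, S⟩, ⟨⟨a, b⟩, ⟨c, d⟩⟩⟩ hz
    rw [Finset.mem_coe, Finset.mem_sigma] at hz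
    obtain ⟨h2, h3⟩ := hz
    have h4 := isSw_of_mem_goodQuadruples h3
    simp only [cutPairs, goodQuadruples, Finset.mem_filter, Finset.mem_univ, true_and,
      Finset.mem_product, mem_insideDarts, Set.mem_compl_iff, Finset.mem_coe] at h2 h3 h4
    obtain ⟨⟨⟨_, ha, hb⟩, _, hc, hd⟩, _⟩ := h3
    rw [Finset.mem_coe, Finset.mem_sigma]
    constructor
    · simp only [cutPairs, Finset.mem_filter, Finset.mem_univ, true_and]
      refine ⟨h4.reg h2.1, h2.2.1, ?_⟩
      rw [h4.card_cutDarts (S := (S : Set (Fin n))) ha hb hc hd, h2.2.2]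
      ring
    · simp only [Finset.mem_offDiag, mem_cutDarts]
      exact ⟨⟨h4.adj_ac, ha, hc⟩, ⟨h4.adj_bd, hb, hd⟩, fun h => h4.hab (Prod.mk.inj h).1⟩
  · rintro ⟨⟨G, S⟩, ⟨⟨a, b⟩, ⟨c, d⟩⟩⟩ hz ⟨⟨G', S'⟩, ⟨⟨a', b'⟩, ⟨c', d'⟩⟩⟩ hz' he
    rw [Finset.mem_coe, Finset.mem_sigma] at hz hz'
    have h4 := isSw_of_mem_goodQuadruples hz.2
    have h4' := isSw_of_mem_goodQuadruples hz'.2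
    simp only [Sigma.mk.injEq, Prod.mk.injEq, heq_eq_eq] at he h4 h4'
    obtain ⟨⟨h5, rfl⟩, ⟨rfl, rfl⟩, rfl, rfl⟩ := he
    rw [← h5] at h4'
    rw [h4.left_unique h4']

/-- Each pair with `2j` boundary edges has at least `2 * crossing r s n j` good quadruples, by
subtracting the bad ones from all pairs of inside darts; both sides of the double count have been
halved. -/
theorem card_cutPairs_mul_le {r s : ℕ} (hr : 1 ≤ r) (hs : s ≤ n) (j : ℕ) :
    ((cutPairs n (2 * r) s j).card : ℤ) * crossing r s n j ≤
      (cutPairs n (2 * r) s (j + 1)).card * ((j + 1) * (2 * j + 1)) := by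
  have h1 := sum_card_goodQuadruples_le n (2 * r) s j
  have h2 : ∀ p ∈ cutPairs n (2 * r) s j,
      2 * crossing r s n j ≤ ((goodQuadruples p.1 p.2).card : ℤ) := by
    intro p hp
    obtain ⟨h3, h4⟩ := card_insideDarts_of_mem_cutPairs hp
    simp only [cutPairs, Finset.mem_filter, Finset.mem_univ, true_and] at hp
    have h5 := card_goodQuadruples hp.1 (p.2 : Set (Fin n))
    rw [hp.2.2] at h5
    zify [hs, (by omega : 1 ≤ 2 * r)] at h3 h4 h5
    rw [eq_sub_of_add_eq h3, eq_sub_of_add_eq h4] at h5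
    unfold crossing
    linarith
  have h3 := Finset.sum_le_sum h2
  rw [Finset.sum_const, nsmul_eq_mul] at h3
  zify at h1
  linarith

theorem card_cutPairs_le (n k s j : ℕ) :
    (cutPairs n k s j).card ≤
      n.choose s * (Finset.univ.filter fun G : SimpleGraph (Fin n) => Reg G k).card := by
  have h1 : cutPairs n k s j ⊆ (Finset.univ.filter fun G : SimpleGraph (Fin n) => Reg G k) ×ˢ
      (Finset.univ : Finset (Fin n)).powersetCard s := by
    intro p hp
    simp only [cutPairs, Finset.mem_filter, Finset.mem_univ, true_and] at hp
    simp [Finset.mem_powersetCard, hp.1, hp.2.1]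
  refine (Finset.card_le_card h1).trans ?_
  rw [Finset.card_product, Finset.card_powersetCard, Finset.card_univ, Fintype.card_fin, mul_comm]

/-- The comparisons of consecutive boundary sizes are telescoped; positivity of the factors allows
them to be multiplied. -/
theorem card_cutPairs_zero_mul_prod_le {r s : ℕ} (hr : 1 ≤ r) (hs : s ≤ n) (J : ℕ)
    (hJ : ∀ j < J, 0 < crossing r s n j) :
    ((cutPairs n (2 * r) s 0).card : ℤ) * ∏ j ∈ Finset.range J, crossing r s n j ≤
      (cutPairs n (2 * r) s J).card * ∏ j ∈ Finset.range J, ((j + 1 : ℤ) * (2 * j + 1)) := by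
  induction J with
  | zero => simp
  | succ J ih =>
    rw [Finset.prod_range_succ, Finset.prod_range_succ]
    have h1 := ih fun j hj => hJ j (by omega)
    have h2 := card_cutPairs_mul_le (n := n) hr hs J
    have h3 : (0 : ℤ) ≤ ∏ j ∈ Finset.range J, ((j + 1 : ℤ) * (2 * j + 1)) :=
      Finset.prod_nonneg fun j _ => by positivity
    have h4 := mul_le_mul_of_nonneg_right h1 (hJ J (by omega)).le
    have h5 := mul_le_mul_of_nonneg_right h2 h3
    linarith

/-- After `J` steps the pairs are bounded trivially by all regular graphs times all `s`-sets. The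
numerical bound was arranged so that the binomial coefficient cancels and a factor `2 ^ s` is left.
-/
theorem card_cutPairs_zero_le {r s : ℕ} (hr : 2 ≤ r) (hs : 2 * r + 1 ≤ s) (hn : 2 * s ≤ n) :
    (cutPairs n (2 * r) s 0).card * 2 ^ s ≤
      (Finset.univ.filter fun G : SimpleGraph (Fin n) => Reg G (2 * r)).card := by
  obtain ⟨J, hJ, hle⟩ := exists_crossing_bound hr hs hn
  have h1 := card_cutPairs_zero_mul_prod_le (n := n) (s := s) (by omega : 1 ≤ r) (by omega) J hJ
  have h2 := card_cutPairs_le n (2 * r) s J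
  zify at h2 ⊢
  set R : ℤ := ((Finset.univ.filter fun G : SimpleGraph (Fin n) => Reg G (2 * r)).card : ℤ)
  set C : ℤ := ∏ j ∈ Finset.range J, ((j + 1 : ℤ) * (2 * j + 1)) with hC
  have h3 : 0 < C := Finset.prod_pos fun j _ => by positivity
  have h4 : (0 : ℤ) < ∏ j ∈ Finset.range J, crossing r s n j :=
    Finset.prod_pos fun j hj => hJ j (Finset.mem_range.mp hj)
  have h5 : (0 : ℤ) ≤ (cutPairs n (2 * r) s 0).card := by positivity
  have h6 := mul_le_mul_of_nonneg_right h2 h3.le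
  have h7 := mul_le_mul_of_nonneg_left hle h5
  have h8 : (0 : ℤ) < n.choose s := by
    have := Nat.choose_pos (by omega : s ≤ n)
    exact_mod_cast this
  refine le_of_mul_le_mul_right (a := (n.choose s : ℤ) * C) ?_ (by positivity)
  linarith

theorem card_component_ge {k : ℕ} (hG : Reg G k) {S : Finset (Fin n)} (hS : S.Nonempty)
    (hc : IsClosedSet G S) : k + 1 ≤ S.card := by
  have h1 : (cutDarts G S).card ≤ 0 := by
    rw [Nat.le_zero, Finset.card_eq_zero, Finset.eq_empty_iff_forall_notMem]
    intro p hp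
    rw [mem_cutDarts] at hp
    exact hp.2.2 (hc _ _ hp.1 hp.2.1)
  have h2 := le_ncard_of_card_cutDarts_le hG (S := (S : Set (Fin n))) (by simpa using hS) h1
  rwa [Set.ncard_coe_finset, Nat.add_zero] at h2

theorem exists_cutPair_of_not_connected {k : ℕ} (hG : Reg G k) (hn : 0 < n)
    (hc : ¬ G.Connected) : ∃ S : Finset (Fin n), k + 1 ≤ S.card ∧ 2 * S.card ≤ n ∧
      (G, S) ∈ cutPairs n k S.card 0 := by
  have h1 : ∃ S : Finset (Fin n), S.Nonempty ∧ Sᶜ.Nonempty ∧ IsClosedSet G S := by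
    by_contra h
    refine hc (connected_of_isClosedSet (G := G) ⟨0, hn⟩ fun S hS h0 v => ?_)
    by_contra hv
    refine h ⟨Finset.univ.filter (· ∈ S), ⟨⟨0, hn⟩, by simpa using h0⟩, ⟨v, by simpa using hv⟩, ?_⟩
    convert hS
    ext; simp
  have h2 : ∀ S : Finset (Fin n), S.Nonempty → IsClosedSet G S → 2 * S.card ≤ n →
      ∃ S : Finset (Fin n), k + 1 ≤ S.card ∧ 2 * S.card ≤ n ∧
      (G, S) ∈ cutPairs n k S.card 0 := by
    intro S hS hS' hcard
    refine ⟨S, card_component_ge hG hS hS', hcard, ?_⟩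
    simp only [cutPairs, Finset.mem_filter, Finset.mem_univ, true_and, mul_zero,
      Finset.card_eq_zero, Finset.eq_empty_iff_forall_notMem]
    refine ⟨hG, fun p hp => ?_⟩
    rw [mem_cutDarts] at hp
    exact hp.2.2 (hS' _ _ hp.1 hp.2.1)
  obtain ⟨S, hS1, hS2, hS3⟩ := h1
  by_cases h : 2 * S.card ≤ n
  · exact h2 S hS1 hS3 h
  · refine h2 Sᶜ hS2 (by simpa using hS3.compl) ?_
    rw [Finset.card_compl, Fintype.card_fin]
    omega

/-- At most one sixteenth of the regular graphs are disconnected. -/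
theorem card_disconnected_le {r : ℕ} (hr : 2 ≤ r) (hn : 0 < n) :
    16 * (Finset.univ.filter fun G : SimpleGraph (Fin n) =>
        Reg G (2 * r) ∧ ¬ G.Connected).card ≤
      (Finset.univ.filter fun G : SimpleGraph (Fin n) => Reg G (2 * r)).card := by
  set R := (Finset.univ.filter fun G : SimpleGraph (Fin n) => Reg G (2 * r)).card with hR
  have h1 : (Finset.univ.filter fun G : SimpleGraph (Fin n) => Reg G (2 * r) ∧ ¬ G.Connected) ⊆
      ((Finset.Icc (2 * r + 1) (n / 2)).biUnion fun s => cutPairs n (2 * r) s 0).image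
        Prod.fst := by
    intro G hG
    simp only [Finset.mem_filter, Finset.mem_univ, true_and] at hG
    obtain ⟨S, hS1, hS2, hS3⟩ := exists_cutPair_of_not_connected hG.1 hn hG.2
    rw [Finset.mem_image]
    refine ⟨(G, S), ?_, rfl⟩
    rw [Finset.mem_biUnion]
    exact ⟨S.card, Finset.mem_Icc.mpr ⟨hS1, by omega⟩, hS3⟩
  have h2 := (Finset.card_le_card h1).trans (Finset.card_image_le.trans Finset.card_biUnion_le)
  -- Geometric series. It starts at 5 because a component has at least `2r + 1 ≥ 5` vertices; for `m
  -- ≤ 4` the sum is empty and the truncated exponent `m - 4 = 0` makes the right side zero.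
  have h3 : ∀ m : ℕ, (∑ s ∈ Finset.Icc 5 m, (R : ℝ) / 2 ^ s) ≤ R / 16 - R / 16 * (1 / 2) ^ (m - 4) := by
    intro m
    induction m with
    | zero => simp
    | succ m ih =>
      by_cases hm : 5 ≤ m + 1
      · rw [Finset.sum_Icc_succ_top hm]
        obtain ⟨i, rfl⟩ : ∃ i, m = i + 4 := ⟨m - 4, by omega⟩
        have e1 : i + 4 + 1 - 4 = i + 1 := by omega
        have e2 : i + 4 - 4 = i := by omega
        rw [e2] at ih
        rw [e1]
        have e3 : (R : ℝ) / 2 ^ (i + 4 + 1) = R / 16 * (1 / 2) ^ i / 2 := by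
          rw [one_div, inv_pow]
          field_simp
          ring
        rw [e3, pow_succ]
        linarith
      · rw [Finset.Icc_eq_empty (by omega), Finset.sum_empty]
        have e1 : m + 1 - 4 = 0 := by omega
        rw [e1]; simp
  have h4 : (∑ s ∈ Finset.Icc (2 * r + 1) (n / 2), ((cutPairs n (2 * r) s 0).card : ℝ)) ≤
      ∑ s ∈ Finset.Icc 5 (n / 2), (R : ℝ) / 2 ^ s := by
    refine (Finset.sum_le_sum (g := fun s => (R : ℝ) / 2 ^ s) ?_).trans
      (Finset.sum_le_sum_of_subset_of_nonneg ?_ ?_)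
    · intro s hs
      rw [Finset.mem_Icc] at hs
      rw [le_div_iff₀ (by positivity)]
      exact_mod_cast card_cutPairs_zero_le hr hs.1 (by omega)
    · exact Finset.Icc_subset_Icc (by omega) le_rfl
    · intros; positivity
  have h5 := h3 (n / 2)
  have h6 : (0 : ℝ) ≤ R / 16 * (1 / 2) ^ (n / 2 - 4) := by positivity
  have h7 : ((Finset.univ.filter fun G : SimpleGraph (Fin n) =>
        Reg G (2 * r) ∧ ¬ G.Connected).card : ℝ) ≤
      ∑ s ∈ Finset.Icc (2 * r + 1) (n / 2), ((cutPairs n (2 * r) s 0).card : ℝ) := by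
    exact_mod_cast h2
  have h8 : (16 : ℝ) * ((Finset.univ.filter fun G : SimpleGraph (Fin n) =>
        Reg G (2 * r) ∧ ¬ G.Connected).card : ℝ) ≤ R := by linarith
  exact_mod_cast h8

end Ratio

/-! ### Cyclic successors in a set of labels -/

section Cyclic

variable {n : ℕ} {E : Set (Fin n)} {u v w m : Fin n}

/-- `w` follows `v` in the cyclic order of `E`. -/
def IsNextIn (E : Set (Fin n)) (v w : Fin n) : Prop :=
  v ∈ E ∧ w ∈ E ∧ ((v < w ∧ ∀ u ∈ E, u ≤ v ∨ w ≤ u) ∨ (∀ u ∈ E, u ≤ v ∧ w ≤ u))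

theorem exists_isLeast_fin {T : Set (Fin n)} (h : T.Nonempty) : ∃ m ∈ T, ∀ u ∈ T, m ≤ u :=
  Set.exists_min_image T id (Set.toFinite T) h

theorem exists_isGreatest_fin {T : Set (Fin n)} (h : T.Nonempty) : ∃ m ∈ T, ∀ u ∈ T, u ≤ m :=
  Set.exists_max_image T id (Set.toFinite T) h

theorem exists_isNextIn (hv : v ∈ E) : ∃ w, IsNextIn E v w := by
  by_cases h : {u ∈ E | v < u}.Nonempty
  · obtain ⟨m, hm, hmin⟩ := exists_isLeast_fin h
    refine ⟨m, hv, hm.1, Or.inl ⟨hm.2, fun u hu => ?_⟩⟩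
    by_cases huv : u ≤ v
    · exact Or.inl huv
    · exact Or.inr (hmin u ⟨hu, not_le.mp huv⟩)
  · obtain ⟨m, hm, hmin⟩ := exists_isLeast_fin ⟨v, hv⟩
    refine ⟨m, hv, hm, Or.inr fun u hu => ⟨?_, hmin u hu⟩⟩
    by_contra huv
    exact h ⟨u, hu, not_le.mp huv⟩

theorem exists_isPrevIn (hw : w ∈ E) : ∃ v, IsNextIn E v w := by
  by_cases h : {u ∈ E | u < w}.Nonempty
  · obtain ⟨m, hm, hmax⟩ := exists_isGreatest_fin h
    refine ⟨m, hm.1, hw, Or.inl ⟨hm.2, fun u hu => ?_⟩⟩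
    by_cases huv : w ≤ u
    · exact Or.inr huv
    · exact Or.inl (hmax u ⟨hu, not_le.mp huv⟩)
  · obtain ⟨m, hm, hmax⟩ := exists_isGreatest_fin ⟨w, hw⟩
    refine ⟨m, hm, hw, Or.inr fun u hu => ⟨hmax u hu, ?_⟩⟩
    by_contra huv
    exact h ⟨u, hu, not_le.mp huv⟩

theorem IsNextIn.right_unique (h : IsNextIn E v w) (h' : IsNextIn E v m) : w = m := by
  obtain ⟨h1, h2, h3⟩ := h
  obtain ⟨_, h2', h3'⟩ := h'
  grind

theorem IsNextIn.left_unique (h : IsNextIn E v w) (h' : IsNextIn E m w) : v = m := by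
  obtain ⟨h1, h2, h3⟩ := h
  obtain ⟨h1', h2', h3'⟩ := h'
  grind

theorem IsNextIn.ne (h : IsNextIn E v w) (h1 : u ∈ E) (h2 : m ∈ E) (h3 : u ≠ m) : v ≠ w := by
  obtain ⟨_, _, h⟩ := h
  grind

/-- The successor relation is a single cycle. The successor of the greatest element with `P` must
wrap around, so the maximum of `E` has `P`; the least element without `P` would then have a
predecessor with `P`. -/
theorem IsNextIn.induction {P : Fin n → Prop} (h : ∀ v w, IsNextIn E v w → P v → P w)
    (hv : v ∈ E) (hP : P v) : ∀ w ∈ E, P w := by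
  obtain ⟨m, ⟨hm, hPm⟩, hmax⟩ := exists_isGreatest_fin (T := {u ∈ E | P u}) ⟨v, hv, hP⟩
  obtain ⟨w, hw⟩ := exists_isNextIn hm
  have hPw := h m w hw hPm
  have hm' : ∀ u ∈ E, u ≤ m ∧ w ≤ u := by
    rcases hw.2.2 with h1 | h1
    · exact absurd (hmax w ⟨hw.2.1, hPw⟩) (not_le.mpr h1.1)
    · exact h1
  by_contra hcon
  push Not at hcon
  obtain ⟨u, ⟨hu, hPu⟩, hmin⟩ := exists_isLeast_fin (T := {u ∈ E | ¬ P u}) hcon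
  obtain ⟨t, ht⟩ := exists_isPrevIn hu
  refine hPu (h t u ht ?_)
  rcases ht.2.2 with h1 | h1
  · by_contra hPt
    exact absurd (hmin t ⟨ht.1, hPt⟩) (not_le.mpr h1.1)
  · rwa [le_antisymm (hm' t ht.1).1 (h1 m hm).1]

/-- A new label subdivides exactly one step `u → w` of the cycle. It describes how the chain changes
when a component splits. -/
theorem exists_isNextIn_insert (hm : m ∉ E) (hE : E.Nonempty) :
    ∃ u ∈ E, ∃ w ∈ E, IsNextIn E u w ∧ IsNextIn (insert m E) u m ∧ IsNextIn (insert m E) m w ∧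
      ∀ z z', IsNextIn E z z' → z ≠ u → IsNextIn (insert m E) z z' := by
  obtain ⟨t, ht⟩ := hE
  have htm : t ≠ m := fun h => hm (h ▸ ht)
  obtain ⟨u, hu⟩ := exists_isPrevIn (E := insert m E) (w := m) (Set.mem_insert _ _)
  obtain ⟨w, hw⟩ := exists_isNextIn (E := insert m E) (v := m) (Set.mem_insert _ _)
  have hum : u ≠ m := hu.ne (Set.mem_insert_of_mem _ ht) (Set.mem_insert _ _) htm
  have hmw : m ≠ w := hw.ne (Set.mem_insert_of_mem _ ht) (Set.mem_insert _ _) htm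
  have huE : u ∈ E := hu.1.resolve_left hum
  have hwE : w ∈ E := hw.2.1.resolve_left hmw.symm
  refine ⟨u, huE, w, hwE, ⟨huE, hwE, ?_⟩, hu, hw, ?_⟩
  · obtain ⟨_, _, h1⟩ := hu
    obtain ⟨_, _, h2⟩ := hw
    simp only [Set.mem_insert_iff, forall_eq_or_imp] at h1 h2
    grind
  · rintro z z' ⟨hz, hz', h3⟩ hzu
    by_contra hcon
    have key : ∀ h : IsNextIn (insert m E) z m, False := fun h => hzu (h.left_unique hu)
    simp only [IsNextIn, Set.mem_insert_iff, forall_eq_or_imp, hz, hz', or_true, true_and,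
      true_or] at hcon key
    grind

end Cyclic

/-! ### Entry vertices -/

section Entries

variable {n : ℕ} {G W : SimpleGraph (Fin n)} {u v w : Fin n}

open Classical in
/-- The entry vertex of the component of `v`. -/
noncomputable def ent (G : SimpleGraph (Fin n)) (v : Fin n) : Fin n :=
  (Finset.univ.filter fun u => G.Reachable v u).max' ⟨v, by simp⟩

theorem reachable_ent (G : SimpleGraph (Fin n)) (v : Fin n) : G.Reachable v (ent G v) := by
  classical
  have h := Finset.max'_mem (Finset.univ.filter fun u => G.Reachable v u) ⟨v, by simp⟩
  rw [Finset.mem_filter] at h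
  exact h.2

theorem le_ent (h : G.Reachable v u) : u ≤ ent G v := by
  classical
  exact Finset.le_max' _ _ (by simpa using h)

theorem ent_eq_of_reachable (h : G.Reachable u v) : ent G u = ent G v :=
  le_antisymm (le_ent (h.symm.trans (reachable_ent G u))) (le_ent (h.trans (reachable_ent G v)))

theorem reachable_iff_ent_eq : G.Reachable u v ↔ ent G u = ent G v :=
  ⟨ent_eq_of_reachable, fun h => (reachable_ent G u).trans (h ▸ (reachable_ent G v).symm)⟩

theorem ent_eq_of_adj (h : G.Adj u v) : ent G u = ent G v := ent_eq_of_reachable h.reachable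

theorem isEntry_iff : IsEntry G v ↔ ent G v = v :=
  ⟨fun h => le_antisymm (h _ (reachable_ent G v)) (le_ent (SimpleGraph.Reachable.refl v)),
    fun h _ hu => h ▸ le_ent hu⟩

theorem ent_ent (G : SimpleGraph (Fin n)) (v : Fin n) : ent G (ent G v) = ent G v :=
  (ent_eq_of_reachable (reachable_ent G v)).symm

theorem isEntry_ent (G : SimpleGraph (Fin n)) (v : Fin n) : IsEntry G (ent G v) :=
  isEntry_iff.mpr (ent_ent G v)

theorem le_ent_self (G : SimpleGraph (Fin n)) (v : Fin n) : v ≤ ent G v :=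
  le_ent (SimpleGraph.Reachable.refl v)

/-- The set of entry vertices. -/
def entries (G : SimpleGraph (Fin n)) : Set (Fin n) := {v | IsEntry G v}

theorem isNextEntry_iff : IsNextEntry G v w ↔ IsNextIn (entries G) v w := Iff.rfl

theorem numComponents_eq (G : SimpleGraph (Fin n)) : numComponents G = (entries G).ncard := by
  rw [numComponents, ← Nat.card_coe_set_eq]
  symm
  refine Nat.card_congr (Equiv.ofBijective (fun v => G.connectedComponentMk v.1) ⟨?_, ?_⟩)
  · rintro ⟨v, hv⟩ ⟨w, hw⟩ h
    have h1 := ent_eq_of_reachable (SimpleGraph.ConnectedComponent.eq.mp h)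
    rw [isEntry_iff.mp hv, isEntry_iff.mp hw] at h1
    exact Subtype.ext h1
  · intro C
    induction C using SimpleGraph.ConnectedComponent.ind with | _ v
    exact ⟨⟨ent G v, isEntry_ent G v⟩,
      SimpleGraph.ConnectedComponent.eq.mpr (reachable_ent G v).symm⟩

theorem connected_iff_ent (v : Fin n) : G.Connected ↔ ∀ u w, ent G u = ent G w := by
  constructor
  · exact fun h u w => ent_eq_of_reachable (h.preconnected u w)
  · intro h
    have : Nonempty (Fin n) := ⟨v⟩
    exact ⟨fun u w => reachable_iff_ent_eq.mpr (h u w)⟩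

/-- If a set can only be left within a component by a single edge, then it contains the whole
component. -/
theorem component_subset {k : ℕ} (hG : Reg G k) (hk : Even k) {S : Set (Fin n)} (e : Sym2 (Fin n))
    (h : ∀ p q, G.Adj p q → ent G p = v → p ∈ S → q ∉ S → s(p, q) = e) (hu : ent G u = v)
    (huS : u ∈ S) : ∀ t, ent G t = v → t ∈ S := by
  intro t ht
  have h1 : IsClosedSet G (S ∩ {t | ent G t = v}) := by
    refine isClosedSet_of_boundary hG hk e fun p q hpq hp hq => ?_
    refine h p q hpq hp.2 hp.1 fun hqS => hq ⟨hqS, ?_⟩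
    exact (ent_eq_of_adj hpq).symm.trans hp.2
  exact (h1.mem_of_reachable (reachable_iff_ent_eq.mpr (hu.trans ht.symm)) ⟨huS, hu⟩).1

end Entries

/-! ### Chaining -/

section ChainFacts

variable {n : ℕ} {W : SimpleGraph (Fin n)} {x y : Fin n → Fin n} {p q u v w : Fin n}

theorem ent_exit (hx : IsExitChoice W x) (hv : IsEntry W v) : ent W (x v) = v :=
  (ent_eq_of_adj (hx v hv)).symm.trans (isEntry_iff.mp hv)

/-- The exit lies in the component of `v`, whose only entry vertex is `v` itself. This gives every
chain edge a well-defined direction. -/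
theorem exit_ne_entry (hx : IsExitChoice W x) (hv : IsEntry W v) (hw : IsEntry W w) : x v ≠ w := by
  intro h
  have h1 := ent_exit hx hv
  rw [h, isEntry_iff.mp hw] at h1
  exact (hx v hv).ne (h1.symm.trans h.symm)

theorem chainWith_adj (hx : IsExitChoice W x) : (chainWith W x).Adj p q ↔
    (W.Adj p q ∧ ∀ v, IsEntry W v → s(p, q) ≠ s(v, x v)) ∨
      ∃ v w, IsNextEntry W v w ∧ s(p, q) = s(x v, w) := by
  simp only [chainWith, SimpleGraph.sup_adj, SimpleGraph.deleteEdges_adj,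
    SimpleGraph.fromEdgeSet_adj, Set.mem_ofPred_eq]
  refine or_congr (and_congr_right fun _ => by push Not; rfl) ?_
  refine ⟨fun h => h.1, fun h => ⟨h, ?_⟩⟩
  obtain ⟨v, w, h1, h2⟩ := h
  rintro rfl
  rw [Sym2.eq_iff] at h2
  refine exit_ne_entry hx h1.1 h1.2.1 ?_
  rcases h2 with ⟨rfl, rfl⟩ | ⟨rfl, rfl⟩ <;> rfl

theorem chainWith_adj_chain (hx : IsExitChoice W x) (h : IsNextEntry W v w) :
    (chainWith W x).Adj (x v) w :=
  (chainWith_adj hx).mpr (Or.inr ⟨v, w, h, rfl⟩)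

theorem chainWith_adj_of_adj (hx : IsExitChoice W x) (h : W.Adj p q)
    (h' : ∀ v, IsEntry W v → s(p, q) ≠ s(v, x v)) : (chainWith W x).Adj p q :=
  (chainWith_adj hx).mpr (Or.inl ⟨h, h'⟩)

theorem chainWith_eq_self (hx : IsExitChoice W x) (hc : ∀ u w, ent W u = ent W w) :
    chainWith W x = W := by
  have h1 : ∀ v w, IsEntry W v → IsEntry W w → v = w := fun v w hv hw => by
    rw [← isEntry_iff.mp hv, ← isEntry_iff.mp hw]; exact hc v w
  ext p q
  rw [chainWith_adj hx]
  constructor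
  · rintro (h | ⟨v, w, h, h2⟩)
    · exact h.1
    · rw [adj_of_sym2_eq h2, h1 w v h.2.1 h.1]
      exact (hx v h.1).symm
  · intro h
    by_cases h2 : ∀ v, IsEntry W v → s(p, q) ≠ s(v, x v)
    · exact Or.inl ⟨h, h2⟩
    · push Not at h2
      obtain ⟨v, hv, h2⟩ := h2
      -- The only entry vertex follows itself, by the wrap-around alternative of `IsNextEntry`, so
      -- the deleted bridge edge is put back.
      refine Or.inr ⟨v, v, ⟨hv, hv, Or.inr fun u hu => ?_⟩, h2.trans Sym2.eq_swap⟩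
      rw [h1 u v hu hv]
      exact ⟨le_rfl, le_rfl⟩

theorem ent_ne_of_chain_edge (hx : IsExitChoice W x) (h : IsNextEntry W v w)
    (he : s(p, q) = s(x v, w)) {t : Fin n} (hu : ent W u ≠ ent W t) : ent W p ≠ ent W q := by
  have h1 : v ≠ w := IsNextIn.ne (isNextEntry_iff.mp h) (isEntry_ent W u) (isEntry_ent W t) hu
  rw [Sym2.eq_iff] at he
  rcases he with ⟨rfl, rfl⟩ | ⟨rfl, rfl⟩
  · rw [ent_exit hx h.1, isEntry_iff.mp h.2.1]; exact h1
  · rw [ent_exit hx h.1, isEntry_iff.mp h.2.1]; exact h1.symm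

/-- Edges of the chained graph inside a component of the original graph. -/
theorem chainWith_adj_of_ent_eq (hx : IsExitChoice W x) (he : ent W p = ent W q)
    (h : (chainWith W x).Adj p q) : W.Adj p q := by
  by_cases hc : ∀ u w, ent W u = ent W w
  · rwa [chainWith_eq_self hx hc] at h
  · push Not at hc
    obtain ⟨u, t, hu⟩ := hc
    rcases (chainWith_adj hx).mp h with h | ⟨v, w, h1, h2⟩
    · exact h.1
    · exact absurd he (ent_ne_of_chain_edge hx h1 h2 hu)

theorem chainWith_adj_of_ent_ne (hx : IsExitChoice W x) (he : ent W p ≠ ent W q)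
    (h : (chainWith W x).Adj p q) : ∃ v w, IsNextEntry W v w ∧ s(p, q) = s(x v, w) := by
  rcases (chainWith_adj hx).mp h with h | h
  · exact absurd (ent_eq_of_adj h.1) he
  · exact h

/-- By parity a component stays connected without its bridge edge, so a closed set containing one of
its vertices contains its exit, hence the next entry; this propagates around the cycle. -/
theorem chainWith_connected {k : ℕ} (hW : Reg W k) (hk : Even k) (hx : IsExitChoice W x)
    (u : Fin n) : (chainWith W x).Connected := by
  refine connected_of_isClosedSet u fun S hS hu t => ?_
  have h1 : ∀ v, IsEntry W v → ∀ u, ent W u = v → u ∈ S → ∀ t, ent W t = v → t ∈ S := by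
    intro v hv u hu huS
    refine component_subset hW hk s(v, x v) (fun p q hpq hp hpS hqS => ?_) hu huS
    by_contra hne
    refine hqS (hS p q (chainWith_adj_of_adj hx hpq fun v' hv' he => hne ?_) hpS)
    have h2 : ent W p = v' := by
      rw [Sym2.eq_iff] at he
      rcases he with ⟨rfl, _⟩ | ⟨rfl, _⟩
      · exact isEntry_iff.mp hv'
      · exact ent_exit hx hv'
    rw [he, ← h2, hp]
  have h2 : ∀ w ∈ entries W, w ∈ S := by
    refine IsNextIn.induction (v := ent W u) (fun v w hvw hv => ?_) (isEntry_ent W u)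
      (h1 _ (isEntry_ent W u) u rfl hu _ (ent_ent W u))
    have h3 : x v ∈ S := h1 v hvw.1 v (isEntry_iff.mp hvw.1) hv _ (ent_exit hx hvw.1)
    exact hS _ _ (chainWith_adj_chain hx (isNextEntry_iff.mpr hvw)) h3
  exact h1 _ (isEntry_ent W t) _ (ent_ent W t) (h2 _ (isEntry_ent W t)) t rfl

/-- With at least two components, an entry vertex exchanges its exit for the previous exit and an
exit exchanges its entry for the next entry; each new neighbour lies in another component, hence is
really new. -/
theorem chainWith_reg {k : ℕ} (hW : Reg W k) (hx : IsExitChoice W x) : Reg (chainWith W x) k := by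
  by_cases hc : ∀ u w, ent W u = ent W w
  · rwa [chainWith_eq_self hx hc]
  push Not at hc
  obtain ⟨u₀, w₀, hu₀⟩ := hc
  intro p
  by_cases hp : IsEntry W p
  · obtain ⟨u, hu⟩ := exists_isPrevIn (E := entries W) hp
    have hup : u ≠ p := hu.ne (isEntry_ent W u₀) (isEntry_ent W w₀) hu₀
    have h1 : nbrs (chainWith W x) p = insert (x u) ((nbrs W p).erase (x p)) := by
      ext q
      rw [mem_nbrs, Finset.mem_insert, Finset.mem_erase, mem_nbrs, chainWith_adj hx]
      constructor
      · rintro (⟨h1, h2⟩ | ⟨v, w, h1, h2⟩)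
        · refine Or.inr ⟨?_, h1⟩
          rintro rfl
          exact h2 p hp rfl
        · rw [Sym2.eq_iff] at h2
          rcases h2 with ⟨h3, _⟩ | ⟨h3, h4⟩
          · exact absurd h3.symm (exit_ne_entry hx h1.1 hp)
          · left
            subst h3
            rw [h4, hu.left_unique (isNextEntry_iff.mp h1)]
      · rintro (rfl | ⟨h1, h2⟩)
        · exact Or.inr ⟨u, p, hu, Sym2.eq_swap⟩
        · refine Or.inl ⟨h2, fun v hv he => ?_⟩
          rw [Sym2.eq_iff] at he
          rcases he with ⟨rfl, rfl⟩ | ⟨h3, _⟩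
          · exact h1 rfl
          · exact exit_ne_entry hx hv hp h3.symm
    have h2 : x u ∉ (nbrs W p).erase (x p) := by
      rw [Finset.mem_erase, mem_nbrs]
      rintro ⟨_, h2⟩
      have h3 := ent_eq_of_adj h2
      rw [ent_exit hx hu.1, isEntry_iff.mp hp] at h3
      exact hup h3.symm
    rw [h1, Finset.card_insert_of_notMem h2, Finset.card_erase_add_one (mem_nbrs.mpr (hx p hp)),
      hW]
  by_cases hp' : ∃ v, IsEntry W v ∧ p = x v
  · obtain ⟨v, hv, rfl⟩ := hp'
    obtain ⟨w, hw⟩ := exists_isNextIn (E := entries W) hv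
    have hvw : v ≠ w := hw.ne (isEntry_ent W u₀) (isEntry_ent W w₀) hu₀
    have h1 : nbrs (chainWith W x) (x v) = insert w ((nbrs W (x v)).erase v) := by
      ext q
      rw [mem_nbrs, Finset.mem_insert, Finset.mem_erase, mem_nbrs, chainWith_adj hx]
      constructor
      · rintro (⟨h1, h2⟩ | ⟨v', w', h1, h2⟩)
        · refine Or.inr ⟨?_, h1⟩
          rintro rfl
          exact h2 q hv Sym2.eq_swap
        · rw [Sym2.eq_iff] at h2
          rcases h2 with ⟨h3, h4⟩ | ⟨h3, h4⟩
          · left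
            have h5 : v' = v := by rw [← ent_exit hx h1.1, ← h3, ent_exit hx hv]
            subst h5
            rw [h4, hw.right_unique (isNextEntry_iff.mp h1)]
          · exact absurd h3 (exit_ne_entry hx hv h1.2.1)
      · rintro (rfl | ⟨h1, h2⟩)
        · exact Or.inr ⟨v, q, hw, rfl⟩
        · refine Or.inl ⟨h2, fun v' hv' he => ?_⟩
          rw [Sym2.eq_iff] at he
          rcases he with ⟨h3, _⟩ | ⟨h3, h4⟩
          · exact exit_ne_entry hx hv hv' h3
          · refine h1 ?_
            rw [h4, ← ent_exit hx hv', ← h3, ent_exit hx hv]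
    have h2 : w ∉ (nbrs W (x v)).erase v := by
      rw [Finset.mem_erase, mem_nbrs]
      rintro ⟨_, h2⟩
      have h3 := ent_eq_of_adj h2
      rw [ent_exit hx hv, isEntry_iff.mp hw.2.1] at h3
      exact hvw h3
    rw [h1, Finset.card_insert_of_notMem h2,
      Finset.card_erase_add_one (mem_nbrs.mpr (hx v hv).symm), hW]
  · rw [← hW p]
    congr 1
    ext q
    rw [mem_nbrs, mem_nbrs, chainWith_adj hx]
    constructor
    · rintro (h1 | ⟨v, w, h1, h2⟩)
      · exact h1.1
      · rw [Sym2.eq_iff] at h2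
        rcases h2 with ⟨h3, _⟩ | ⟨h3, _⟩
        · exact absurd ⟨v, h1.1, h3⟩ hp'
        · exact absurd (h3 ▸ h1.2.1) hp
    · refine fun h1 => Or.inl ⟨h1, fun v hv he => ?_⟩
      rw [Sym2.eq_iff] at he
      rcases he with ⟨h3, _⟩ | ⟨h3, _⟩
      · exact hp (h3 ▸ hv)
      · exact hp' ⟨v, hv, h3⟩

theorem adj_topNeighbor (h : (nbrs W v).Nonempty) : W.Adj v (topNeighbor W v) := by
  classical
  have h1 : (Finset.univ.filter fun w => W.Adj v w).Nonempty := by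
    obtain ⟨w, hw⟩ := h
    exact ⟨w, by simpa [mem_nbrs] using hw⟩
  unfold topNeighbor
  rw [dif_pos h1]
  have h2 := Finset.max'_mem _ h1
  rw [Finset.mem_filter] at h2
  exact h2.2

theorem isExitChoice_topNeighbor {k : ℕ} (hW : Reg W k) (hk : 0 < k) :
    IsExitChoice W (topNeighbor W) := fun v _ =>
  adj_topNeighbor (Finset.card_pos.mp (by rw [hW]; exact hk))

theorem topNeighbor_congr {W' : SimpleGraph (Fin n)} (h : ∀ w, W.Adj v w ↔ W'.Adj v w) :
    topNeighbor W v = topNeighbor W' v := by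
  classical
  have h1 : (Finset.univ.filter fun w => W.Adj v w) = Finset.univ.filter fun w => W'.Adj v w :=
    Finset.filter_congr fun w _ => h w
  have key : ∀ s t : Finset (Fin n), s = t → (if h : s.Nonempty then s.max' h else v) =
      if h : t.Nonempty then t.max' h else v := by
    rintro s _ rfl; rfl
  unfold topNeighbor
  convert key _ _ h1

/-- Chaining depends on the exit vertices only. -/
theorem chainWith_congr (h : ∀ v, IsEntry W v → x v = y v) : chainWith W x = chainWith W y := by
  unfold chainWith
  congr 2
  · ext e
    simp only [Set.mem_ofPred_eq]
    constructor
    · rintro ⟨v, h1, h2⟩; exact ⟨v, h1, by rw [h2, h v h1]⟩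
    · rintro ⟨v, h1, h2⟩; exact ⟨v, h1, by rw [h2, h v h1]⟩
  · ext e
    simp only [Set.mem_ofPred_eq]
    constructor
    · rintro ⟨v, w, h1, h2⟩; exact ⟨v, w, h1, by rw [h2, h v h1.1]⟩
    · rintro ⟨v, w, h1, h2⟩; exact ⟨v, w, h1, by rw [h2, h v h1.1]⟩

end ChainFacts

/-! ### Recovering a graph from its chaining. -/

section Recovery

variable {n : ℕ} {W W' K : SimpleGraph (Fin n)} {x y : Fin n → Fin n} {p q u v w v' w' : Fin n}

theorem bridge_unique (hy : IsExitChoice W y) (hv : IsEntry W v)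
    (hv' : IsEntry W v') (h : s(v, x v) = s(v', y v')) : v = v' ∧ x v = y v' := by
  rw [Sym2.eq_iff] at h
  rcases h with h | ⟨h, _⟩
  · exact h
  · exact absurd h.symm (exit_ne_entry hy hv' hv)

theorem chain_edge_unique (hx : IsExitChoice W x) (hy : IsExitChoice W y) (h : IsNextEntry W v w)
    (h' : IsNextEntry W v' w') (he : s(x v, w) = s(y v', w')) : v = v' ∧ x v = y v' ∧ w = w' := by
  rw [Sym2.eq_iff] at he
  rcases he with ⟨h1, h2⟩ | ⟨h1, _⟩
  · refine ⟨?_, h1, h2⟩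
    rw [← ent_exit hx h.1, h1, ent_exit hy h'.1]
  · exact absurd h1 (exit_ne_entry hx h.1 h'.2.1)

/-- Changing the exit vertex of one component is a switch of the chained graph. -/
theorem bridge_change (hx : IsExitChoice W x) (hy : IsExitChoice W y) (hv : IsEntry W v)
    (hxy : ∀ u, IsEntry W u → u ≠ v → x u = y u) :
    chainWith W x = chainWith W y ∨ ∃ w, IsNextEntry W v w ∧
      IsSw (chainWith W x) (chainWith W y) (x v) w v (y v) := by
  by_cases hxv : x v = y v
  · left
    refine chainWith_congr fun u hu => ?_
    by_cases huv : u = v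
    · rw [huv, hxv]
    · exact hxy u hu huv
  by_cases hc : ∀ u w, ent W u = ent W w
  · left
    rw [chainWith_eq_self hx hc, chainWith_eq_self hy hc]
  right
  push Not at hc
  obtain ⟨u₀, w₀, hu₀⟩ := hc
  obtain ⟨w, hw⟩ := exists_isNextIn (E := entries W) hv
  have hvw : v ≠ w := hw.ne (isEntry_ent W u₀) (isEntry_ent W w₀) hu₀
  have hew : ent W w = w := isEntry_iff.mp hw.2.1
  have hev : ent W v = v := isEntry_iff.mp hv
  have hex : ent W (x v) = v := ent_exit hx hv
  have hey : ent W (y v) = v := ent_exit hy hv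
  refine ⟨w, isNextEntry_iff.mpr hw, ?_⟩
  have cross : ∀ {z z' a b}, IsNextEntry W z z' → s(a, b) = s(x z, z') → ent W a ≠ ent W b :=
    fun h he => ent_ne_of_chain_edge hx h he hu₀
  have cross' : ∀ {z z' a b}, IsNextEntry W z z' → s(a, b) = s(y z, z') → ent W a ≠ ent W b :=
    fun h he => ent_ne_of_chain_edge hy h he hu₀
  refine ⟨exit_ne_entry hx hv hv, hxv, hvw.symm, ?_, chainWith_adj_chain hx hw, ?_, ?_, ?_, ?_⟩
  · exact fun h => hvw (by rw [← hey, ← h, hew])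
  · refine chainWith_adj_of_adj hx (hy v hv) fun u hu he => ?_
    obtain ⟨h1, h2⟩ := bridge_unique hx hv hu he
    exact hxv (by rw [h2, h1])
  · intro h
    rcases (chainWith_adj hx).mp h with h | ⟨z, z', h1, h2⟩
    · exact h.2 v hv Sym2.eq_swap
    · exact cross h1 h2 (hex.trans hev.symm)
  · intro h
    rcases (chainWith_adj hx).mp h with h | ⟨z, z', h1, h2⟩
    · have h3 := ent_eq_of_adj h.1
      rw [hew, hey] at h3
      exact hvw h3.symm
    · obtain ⟨h3, h4, h5⟩ := chain_edge_unique hy hx hw h1 (Sym2.eq_swap.trans h2)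
      exact hxv (by rw [h4, h3])
  · intro p q
    rw [chainWith_adj hy]
    constructor
    · rintro (⟨h1, h2⟩ | ⟨z, z', h1, h2⟩)
      · by_cases h3 : s(p, q) = s(x v, v)
        · exact Or.inr (Or.inl h3)
        · refine Or.inl ⟨chainWith_adj_of_adj hx h1 fun z hz he => ?_, fun he => ?_, h2 v hv⟩
          · by_cases hzv : z = v
            · subst hzv
              exact h3 (he.trans Sym2.eq_swap)
            · exact h2 z hz (by rw [he, hxy z hz hzv])
          · exact cross hw he (ent_eq_of_adj h1)
      · by_cases hzv : z = v
        · subst hzv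
          have h3 := hw.right_unique (isNextEntry_iff.mp h1)
          subst h3
          exact Or.inr (Or.inr (h2.trans Sym2.eq_swap))
        · rw [← hxy z h1.1 hzv] at h2
          refine Or.inl ⟨(chainWith_adj hx).mpr (Or.inr ⟨z, z', h1, h2⟩), fun he => ?_,
            fun he => ?_⟩
          · exact hzv (chain_edge_unique hx hx h1 hw (h2.symm.trans he)).1
          · exact cross h1 (he.symm.trans h2) (hev.trans hey.symm)
    · rintro (⟨h1, h2, h3⟩ | h1 | h1)
      · rcases (chainWith_adj hx).mp h1 with ⟨h1, h4⟩ | ⟨z, z', h4, h5⟩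
        · refine Or.inl ⟨h1, fun z hz he => ?_⟩
          by_cases hzv : z = v
          · exact h3 (hzv ▸ he)
          · exact h4 z hz (by rw [he, hxy z hz hzv])
        · refine Or.inr ⟨z, z', h4, ?_⟩
          by_cases hzv : z = v
          · subst hzv
            have h6 := hw.right_unique (isNextEntry_iff.mp h4)
            subst h6
            exact absurd h5 h2
          · rw [← hxy z h4.1 hzv, h5]
      · refine Or.inl ⟨(adj_of_sym2_eq h1).mpr (hx v hv).symm, fun z hz he => ?_⟩
        obtain ⟨h2, h3⟩ := bridge_unique hy hv hz ((h1.trans Sym2.eq_swap).symm.trans he)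
        exact hxv (by rw [h3, h2])
      · exact Or.inr ⟨v, w, hw, h1.trans Sym2.eq_swap⟩

/-- A graph can be read off from its chaining, its components, and the exit vertices. -/
theorem adj_iff_chainWith (hx : IsExitChoice W x) : W.Adj p q ↔
    ((chainWith W x).Adj p q ∧ ent W p = ent W q) ∨ ∃ v, IsEntry W v ∧ s(p, q) = s(v, x v) := by
  constructor
  · intro h
    by_cases h1 : ∃ v, IsEntry W v ∧ s(p, q) = s(v, x v)
    · exact Or.inr h1
    · push Not at h1
      exact Or.inl ⟨chainWith_adj_of_adj hx h h1, ent_eq_of_adj h⟩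
  · rintro (⟨h1, h2⟩ | ⟨v, h1, h2⟩)
    · exact chainWith_adj_of_ent_eq hx h2 h1
    · exact (adj_of_sym2_eq h2).mpr (hx v h1)

section

variable {top v₁ : Fin n}

theorem isNextEntry_first_le (htop : ∀ u : Fin n, u ≤ top) (h : IsNextEntry W top v₁)
    (hu : IsEntry W u) : v₁ ≤ u := by
  rcases h.2.2 with h1 | h1
  · exact absurd (htop v₁) (not_le.mpr h1.1)
  · exact (h1 u hu).2

theorem isNextEntry_cases (htop : ∀ u : Fin n, u ≤ top) (h1 : IsNextEntry W top v₁)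
    (h : IsNextEntry W v w) : v < w ∨ (v = top ∧ w = v₁) := by
  rcases h.2.2 with h2 | h2
  · exact Or.inl h2.1
  · have h3 : v = top := le_antisymm (htop v) (h2 top h1.1).1
    subst h3
    exact Or.inr ⟨rfl, IsNextIn.right_unique (isNextEntry_iff.mp h) (isNextEntry_iff.mp h1)⟩

/-- An edge of the chained graph between vertices with labels at most `t`, other than the last
chain edge, does not leave the first components. -/
theorem ent_le_of_chainWith_adj (htop : ∀ u : Fin n, u ≤ top) (h1 : IsNextEntry W top v₁)
    (hx : IsExitChoice W x) {t : Fin n} (hq : q ≤ t) (h : (chainWith W x).Adj p q)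
    (hne : s(p, q) ≠ s(x top, v₁)) (hpt : ent W p ≤ t) : ent W q ≤ t := by
  by_cases he : ent W p = ent W q
  · rwa [← he]
  · obtain ⟨v, w, h2, h3⟩ := chainWith_adj_of_ent_ne hx he h
    rcases isNextEntry_cases htop h1 h2 with h4 | ⟨rfl, rfl⟩
    · rw [Sym2.eq_iff] at h3
      rcases h3 with ⟨rfl, rfl⟩ | ⟨rfl, rfl⟩
      · rwa [isEntry_iff.mp h2.2.1]
      · rw [ent_exit hx h2.1]
        rw [isEntry_iff.mp h2.2.1] at hpt
        exact h4.le.trans hpt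
    · exact absurd h3 hne

/-- In `W`, the components with entries up to `t` are reached from `v₁` along the chain using only
vertices with labels at most `t` and never the last chain edge. In `W'`, such moves cannot leave the
components with entries up to `t`, because a chain edge that leads further ends in an entry with a
label above `t`. -/
theorem ent_le_of_ent_le {k : ℕ} (hW : Reg W k) (hk : Even k) (htop : ∀ u : Fin n, u ≤ top)
    (hx : IsExitChoice W x) (hy : IsExitChoice W' y) (hK : chainWith W x = chainWith W' y)
    (h1 : IsNextEntry W top v₁) (h1' : IsNextEntry W' top v₁) (hxy : x top = y top)
    (hne : v₁ ≠ top) {t : Fin n} (hu : ent W u ≤ t) : ent W' u ≤ t := by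
  have hcomp : ∀ z, IsEntry W z → z ≤ t → ent W' z ≤ t → ∀ u, ent W u = z → ent W' u ≤ t := by
    intro z hz hzt hzB
    refine component_subset hW hk (S := {u | ent W' u ≤ t}) s(z, x z) (fun p q hpq hp hpS hqS => ?_)
      (isEntry_iff.mp hz) hzB
    by_contra hcon
    have h2 : (chainWith W x).Adj p q := by
      refine chainWith_adj_of_adj hx hpq fun v hv he => hcon ?_
      have h3 : ent W p = v := by
        rw [Sym2.eq_iff] at he
        rcases he with ⟨rfl, _⟩ | ⟨rfl, _⟩
        · exact isEntry_iff.mp hv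
        · exact ent_exit hx hv
      rw [he, ← h3, hp]
    rw [hK] at h2
    have hqt : q ≤ t := by
      refine (le_ent_self W q).trans ?_
      rwa [← ent_eq_of_adj hpq, hp]
    refine hqS (ent_le_of_chainWith_adj htop h1' hy hqt h2 (fun he => ?_) hpS)
    rw [← hxy] at he
    have h3 := ent_eq_of_adj ((adj_of_sym2_eq he).mp hpq)
    rw [ent_exit hx h1.1, isEntry_iff.mp h1.2.1] at h3
    exact hne h3.symm
  have hent : ∀ z ∈ entries W, z ≤ t → ent W' z ≤ t := by
    have base : v₁ ≤ t → ent W' v₁ ≤ t := fun h => by rwa [isEntry_iff.mp h1'.2.1]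
    refine IsNextIn.induction (v := v₁) (fun v w hvw hv hwt => ?_) h1.2.1 base
    by_cases hw : w = v₁
    · subst hw
      exact base hwt
    rcases isNextEntry_cases htop h1 (isNextEntry_iff.mpr hvw) with h2 | ⟨_, h2⟩
    · have hvt : v ≤ t := h2.le.trans hwt
      have h3 := hcomp v hvw.1 hvt (hv hvt) (x v) (ent_exit hx hvw.1)
      have h4 := chainWith_adj_chain hx (isNextEntry_iff.mpr hvw)
      rw [hK] at h4
      refine ent_le_of_chainWith_adj htop h1' hy hwt h4 (fun he => ?_) h3
      rw [← hxy] at he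
      exact hw (chain_edge_unique hx hx (isNextEntry_iff.mpr hvw) h1 he).2.2
    · exact absurd h2 hw
  exact hcomp _ (isEntry_ent W u) hu (hent _ (isEntry_ent W u) hu) u rfl

/-- A graph is determined by its chaining together with the last chain edge. -/
theorem chainWith_injective {k : ℕ} (hW : Reg W k) (hW' : Reg W' k) (hk : Even k)
    (htop : ∀ u : Fin n, u ≤ top) (hx : IsExitChoice W x) (hy : IsExitChoice W' y)
    (hK : chainWith W x = chainWith W' y) (h1 : IsNextEntry W top v₁)
    (h1' : IsNextEntry W' top v₁) (hxy : x top = y top) : W = W' := by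
  by_cases hne : v₁ = top
  · have key : ∀ {U : SimpleGraph (Fin n)}, IsNextEntry U top v₁ → ∀ u w, ent U u = ent U w := by
      intro U hU
      have h2 : ∀ u, ent U u = top := fun u =>
        le_antisymm (htop _) (hne ▸ isNextEntry_first_le htop hU (isEntry_ent U u))
      intro u w
      rw [h2, h2]
    rw [chainWith_eq_self hx (key h1), chainWith_eq_self hy (key h1')] at hK
    exact hK
  -- The threshold is taken to be the entry of `u` itself, once for each graph, so both graphs have
  -- the same components; only the exits remain to be compared, and they are the starting points of
  -- the chain edges.
  have hent : ∀ u, ent W u = ent W' u := fun u => le_antisymm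
    (ent_le_of_ent_le hW' hk htop hy hx hK.symm h1' h1 hxy.symm hne le_rfl)
    (ent_le_of_ent_le hW hk htop hx hy hK h1 h1' hxy hne le_rfl)
  have hentry : ∀ u, IsEntry W u ↔ IsEntry W' u := fun u => by
    rw [isEntry_iff, isEntry_iff, hent]
  have hentries : entries W = entries W' := Set.ext hentry
  have hexit : ∀ v, IsEntry W v → x v = y v := by
    intro v hv
    obtain ⟨w, hw⟩ := exists_isNextIn (E := entries W) hv
    have hvw : v ≠ w := hw.ne h1.2.1 h1.1 hne
    have h2 := chainWith_adj_chain hx (isNextEntry_iff.mpr hw)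
    rw [hK] at h2
    have h3 : ent W' (x v) ≠ ent W' w := by
      rw [← hent, ← hent, ent_exit hx hv, isEntry_iff.mp hw.2.1]
      exact hvw
    obtain ⟨v', w', h4, h5⟩ := chainWith_adj_of_ent_ne hy h3 h2
    rw [Sym2.eq_iff] at h5
    rcases h5 with ⟨h6, _⟩ | ⟨h6, _⟩
    · have h7 : v = v' := by rw [← ent_exit hx hv, hent, h6, ent_exit hy h4.1]
      rw [h6, h7]
    · exact absurd h6 (exit_ne_entry hx hv ((hentry _).mpr h4.2.1))
  ext p q
  rw [adj_iff_chainWith hx, adj_iff_chainWith hy, hK, hent, hent]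
  refine or_congr Iff.rfl (exists_congr fun v => ?_)
  constructor
  · rintro ⟨h2, h3⟩
    exact ⟨(hentry v).mp h2, by rw [h3, hexit v h2]⟩
  · rintro ⟨h2, h3⟩
    exact ⟨(hentry v).mpr h2, by rw [h3, hexit v ((hentry v).mpr h2)]⟩

theorem isEntry_top (htop : ∀ u : Fin n, u ≤ top) (W : SimpleGraph (Fin n)) : IsEntry W top :=
  fun u _ => htop u

open Classical in
/-- A graph is the chaining of at most `k * n` graphs. -/
theorem card_chainings_le {k : ℕ} (hk : Even k) (hn : 0 < n) (K : SimpleGraph (Fin n))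
    (hK : Reg K k) :
    (Finset.univ.filter fun W => Reg W k ∧ ∃ x, IsExitChoice W x ∧ chainWith W x = K).card ≤
      k * n := by
  obtain ⟨top, htop⟩ : ∃ top : Fin n, ∀ u : Fin n, u ≤ top :=
    ⟨⟨n - 1, by omega⟩, fun u => by rw [Fin.le_def]; simp; omega⟩
  have hdarts : (insideDarts K Set.univ).card = k * n := by
    have h1 := card_insideDarts_add K Set.univ
    have h2 : (cutDarts K Set.univ).card = 0 := by
      rw [Finset.card_eq_zero, Finset.eq_empty_iff_forall_notMem]
      intro p hp
      rw [mem_cutDarts] at hp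
      exact hp.2.2 trivial
    rw [h2, Finset.sum_congr rfl fun v _ => hK v, Finset.sum_const] at h1
    simpa [mul_comm] using h1
  -- Each `W` is sent to the dart of `K` formed by its last chain edge, which is an injection.
  rw [← hdarts, ← Finset.card_attach]
  have h1 : ∀ W : {W // W ∈ Finset.univ.filter fun W : SimpleGraph (Fin n) =>
      Reg W k ∧ ∃ x, IsExitChoice W x ∧ chainWith W x = K},
      ∃ d : Fin n × Fin n, ∃ x, IsExitChoice W.1 x ∧ chainWith W.1 x = K ∧ d.1 = x top ∧
        IsNextEntry W.1 top d.2 := by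
    rintro ⟨W, hW⟩
    rw [Finset.mem_filter] at hW
    obtain ⟨_, _, x, hx1, hx2⟩ := hW
    obtain ⟨v₁, h1⟩ := exists_isNextIn (E := entries W) (v := top) (isEntry_top htop W)
    exact ⟨(x top, v₁), x, hx1, hx2, rfl, h1⟩
  choose f y hf1 hf2 hf3 hf4 using h1
  refine Finset.card_le_card_of_injOn f ?_ ?_
  · intro W _
    have h2 := chainWith_adj_chain (hf1 W) (hf4 W)
    rw [hf2 W, ← hf3 W] at h2
    exact mem_insideDarts.mpr ⟨h2, trivial, trivial⟩
  · intro W _ W' _ h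
    refine Subtype.ext (chainWith_injective (Finset.mem_filter.mp W.2).2.1
      (Finset.mem_filter.mp W'.2).2.1 hk htop (hf1 W) (hf1 W') ((hf2 W).trans (hf2 W').symm)
      (hf4 W) ?_ ?_)
    · rw [h]; exact hf4 W'
    · rw [← hf3, ← hf3, h]

/-! ### Chainings with a prescribed chain edge -/

/-- The part of a chained graph from the entry vertex `q` to the last component. -/
def tailSet (W : SimpleGraph (Fin n)) (q : Fin n) : Set (Fin n) := {u | q ≤ ent W u}

/-- The components from `q` on form an interval of the cyclic chain, so its boundary consists of the
chain edge that enters it and the last chain edge; if `q` is the first entry, the interval is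
everything. -/
theorem tailSet_eq_univ_or (htop : ∀ u : Fin n, u ≤ top) (h1 : IsNextEntry W top v₁)
    (hx : IsExitChoice W x) (h : IsNextEntry W v q) :
    (tailSet W q = Set.univ ∧ v = top ∧ q = v₁) ∨
      (x v ∉ tailSet W q ∧ cutDarts (chainWith W x) (tailSet W q) = {(q, x v), (x top, v₁)}) := by
  by_cases hq : q = v₁
  · left
    subst hq
    refine ⟨Set.eq_univ_of_forall fun u => isNextEntry_first_le htop h1 (isEntry_ent W u), ?_, rfl⟩
    exact IsNextIn.left_unique (isNextEntry_iff.mp h) (isNextEntry_iff.mp h1)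
  · right
    have hvq : v < q := (isNextEntry_cases htop h1 h).resolve_right fun h' => hq h'.2
    have hxv : x v ∉ tailSet W q := by
      rw [tailSet, Set.mem_ofPred_eq, ent_exit hx h.1]
      exact not_le.mpr hvq
    have hv₁q : v₁ < q := lt_of_le_of_ne (isNextEntry_first_le htop h1 h.2.1) (Ne.symm hq)
    have htv : ent W top ≠ ent W v₁ := by
      rw [isEntry_iff.mp h1.1, isEntry_iff.mp h1.2.1]
      exact (hv₁q.trans_le (htop q)).ne'
    refine ⟨hxv, ?_⟩
    ext ⟨a, b⟩
    rw [mem_cutDarts, Finset.mem_insert, Finset.mem_singleton]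
    constructor
    · rintro ⟨hab, ha, hb⟩
      simp only [tailSet, Set.mem_ofPred_eq] at ha hb
      have hne : ent W a ≠ ent W b := fun he => hb (he ▸ ha)
      obtain ⟨z, z', h2, h3⟩ := chainWith_adj_of_ent_ne hx hne hab
      rw [Sym2.eq_iff] at h3
      rcases h3 with ⟨rfl, rfl⟩ | ⟨rfl, rfl⟩
      · rw [ent_exit hx h2.1] at ha
        rw [isEntry_iff.mp h2.2.1] at hb
        rcases isNextEntry_cases htop h1 h2 with h3 | ⟨rfl, rfl⟩
        · exact absurd (ha.trans h3.le) hb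
        · exact Or.inr rfl
      · rw [ent_exit hx h2.1, not_le] at hb
        rw [isEntry_iff.mp h2.2.1] at ha
        have h4 : a = q := by
          rcases h2.2.2 with h4 | h4
          · exact le_antisymm ((h4.2 q h.2.1).resolve_left (not_le.mpr hb)) ha
          · exact absurd (h4 q h.2.1).1 (not_le.mpr hb)
        subst h4
        left
        rw [IsNextIn.left_unique (isNextEntry_iff.mp h2) (isNextEntry_iff.mp h)]
    · rintro (he | he)
      · obtain ⟨rfl, rfl⟩ := Prod.mk.inj he
        refine ⟨(chainWith_adj_chain hx h).symm, ?_, hxv⟩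
        rw [tailSet, Set.mem_ofPred_eq, isEntry_iff.mp h.2.1]
      · obtain ⟨rfl, rfl⟩ := Prod.mk.inj he
        refine ⟨chainWith_adj_chain hx h1, ?_, ?_⟩
        · simp only [tailSet, Set.mem_ofPred_eq, ent_exit hx h1.1]
          exact htop q
        · simp only [tailSet, Set.mem_ofPred_eq, isEntry_iff.mp h1.2.1]
          exact not_le.mpr hv₁q

/-- One of the two boundary darts of the tail is the prescribed one, so the tail and `K` reveal the
other, which is the last chain edge. It starts at an exit, hence cannot be confused with the dart
that starts at `q`. -/
theorem tailSet_injective {k : ℕ} (hW : Reg W k) (hW' : Reg W' k) (hk : Even k)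
    (hx : IsExitChoice W x) (hy : IsExitChoice W' y)
    (htop : ∀ u : Fin n, u ≤ top) (hK : chainWith W x = chainWith W' y)
    (h : IsNextEntry W v q) (h' : IsNextEntry W' v' q) (hxy : x v = y v')
    (hS : tailSet W q = tailSet W' q) : W = W' := by
  obtain ⟨v₁, h1⟩ := exists_isNextIn (E := entries W) (v := top) (isEntry_top htop W)
  obtain ⟨v₁', h1'⟩ := exists_isNextIn (E := entries W') (v := top) (isEntry_top htop W')
  rcases tailSet_eq_univ_or htop h1 hx h with ⟨h2, rfl, rfl⟩ | ⟨h2, h3⟩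
  · rcases tailSet_eq_univ_or htop h1' hy h' with ⟨h2', rfl, rfl⟩ | ⟨h2', h3'⟩
    · exact chainWith_injective hW hW' hk htop hx hy hK h h' hxy
    · rw [← hS, h2] at h2'
      exact absurd trivial h2'
  · rcases tailSet_eq_univ_or htop h1' hy h' with ⟨h2', rfl, rfl⟩ | ⟨h2', h3'⟩
    · rw [hS, h2'] at h2
      exact absurd trivial h2
    · rw [hS, hK, h3', hxy] at h3
      have h4 : (x top, v₁) ∈ ({(q, y v'), (y top, v₁')} : Finset (Fin n × Fin n)) := by
        rw [h3]; simp
      rw [Finset.mem_insert, Finset.mem_singleton] at h4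
      rcases h4 with h4 | h4
      · exact absurd (Prod.mk.inj h4).1 (exit_ne_entry hx h1.1 h.2.1)
      · obtain ⟨h5, rfl⟩ := Prod.mk.inj h4
        exact chainWith_injective hW hW' hk htop hx hy hK h1 h1' h5

theorem card_cutDarts_tailSet_le (htop : ∀ u : Fin n, u ≤ top) (hx : IsExitChoice W x)
    (h : IsNextEntry W v q) : (cutDarts (chainWith W x) (tailSet W q)).card ≤ 2 ∧
      (tailSet W q = Set.univ ∨ x v ∉ tailSet W q) := by
  obtain ⟨v₁, h1⟩ := exists_isNextIn (E := entries W) (v := top) (isEntry_top htop W)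
  rcases tailSet_eq_univ_or htop h1 hx h with ⟨h2, _⟩ | ⟨h2, h3⟩
  · refine ⟨?_, Or.inl h2⟩
    rw [h2]
    have : cutDarts (chainWith W x) Set.univ = ∅ := by
      rw [Finset.eq_empty_iff_forall_notMem]
      intro p hp
      rw [mem_cutDarts] at hp
      exact hp.2.2 trivial
    rw [this]; simp
  · rw [h3]
    exact ⟨Finset.card_le_two, Or.inr h2⟩

/-- Two sets that are separated from their complements by a common edge and at most one more
edge each have very different sizes. -/
theorem ncard_gap_of_subset {k : ℕ} (hK : Reg K k) {S T : Set (Fin n)} (hST : S ≠ T)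
    (hsub : S ⊆ T) (hcut : (cutDarts K (T \ S)).card ≤ 2) :
    S.ncard + (k - 1) ≤ T.ncard := by
  have h1 : (T \ S).Nonempty := by
    rw [Set.nonempty_iff_ne_empty, Ne, Set.sdiff_eq_empty]
    exact fun h => hST (hsub.antisymm h)
  have h2 := le_ncard_of_card_cutDarts_le hK h1 hcut
  have h3 := Set.ncard_sdiff_add_ncard_of_subset hsub
  omega

/-- If neither set contained the other, both differences would have at least two boundary edges, and
posimodularity with the gain 2 from the common edge would give `2 + 2 + 2 ≤ 4`. So the sets are
nested, and their difference has at most two boundary edges; by regularity it has at least `k - 1`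
vertices. -/
theorem ncard_gap {k : ℕ} (hK : Reg K k) (hk : Even k) (hc : K.Connected) (hqp : K.Adj q p)
    {S T : Set (Fin n)} (hST : S ≠ T) (hqS : q ∈ S) (hqT : q ∈ T)
    (hS : (cutDarts K S).card ≤ 2) (hT : (cutDarts K T).card ≤ 2)
    (hpS : S = Set.univ ∨ p ∉ S) (hpT : T = Set.univ ∨ p ∉ T) :
    S.ncard + (k - 1) ≤ T.ncard ∨ T.ncard + (k - 1) ≤ S.ncard := by
  rcases hpS with rfl | hpS
  · right
    refine ncard_gap_of_subset hK hST.symm (Set.subset_univ T) ?_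
    rw [← Set.compl_eq_univ_sdiff, card_cutDarts_compl]
    exact hT
  rcases hpT with rfl | hpT
  · left
    refine ncard_gap_of_subset hK hST (Set.subset_univ S) ?_
    rw [← Set.compl_eq_univ_sdiff, card_cutDarts_compl]
    exact hS
  have h1 := card_cutDarts_sdiff_add hqp ⟨hqS, hpS⟩ ⟨hqT, hpT⟩
  by_cases h2 : (S \ T).Nonempty
  · by_cases h3 : (T \ S).Nonempty
    · have h4 := two_le_card_cutDarts hK hk hc h2 ⟨q, fun h => h.2 hqT⟩
      have h5 := two_le_card_cutDarts hK hk hc h3 ⟨q, fun h => h.2 hqS⟩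
      omega
    · right
      rw [Set.not_nonempty_iff_eq_empty, Set.sdiff_eq_empty] at h3
      exact ncard_gap_of_subset hK hST.symm h3 (by omega)
  · left
    rw [Set.not_nonempty_iff_eq_empty, Set.sdiff_eq_empty] at h2
    exact ncard_gap_of_subset hK hST h2 (by omega)

open Classical in
/-- Only few graphs have a given chaining with a given chain edge. -/
theorem card_chainings_through_le {k : ℕ} (hk : Even k) (hk2 : 2 ≤ k) (hn : 0 < n)
    (K : SimpleGraph (Fin n)) (p q : Fin n) :
    (Finset.univ.filter fun W => Reg W k ∧ ∃ x v, IsExitChoice W x ∧ chainWith W x = K ∧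
      IsNextEntry W v q ∧ x v = p).card * (k - 1) ≤ n := by
  obtain ⟨top, htop⟩ : ∃ top : Fin n, ∀ u : Fin n, u ≤ top :=
    ⟨⟨n - 1, by omega⟩, fun u => by rw [Fin.le_def]; simp; omega⟩
  refine (Nat.le_div_iff_mul_le (by omega)).mp ?_
  rw [← Nat.add_sub_cancel (n := n / (k - 1)) (m := 1), ← Nat.card_Icc]
  have hmem : ∀ W ∈ (Finset.univ.filter fun W : SimpleGraph (Fin n) => Reg W k ∧ ∃ x v,
      IsExitChoice W x ∧ chainWith W x = K ∧ IsNextEntry W v q ∧ x v = p),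
      Reg W k ∧ Reg K k ∧ K.Connected ∧ K.Adj q p ∧ q ∈ tailSet W q ∧
        (cutDarts K (tailSet W q)).card ≤ 2 ∧ (tailSet W q = Set.univ ∨ p ∉ tailSet W q) ∧
        ∃ x v, IsExitChoice W x ∧ chainWith W x = K ∧ IsNextEntry W v q ∧ x v = p := by
    intro W hW
    rw [Finset.mem_filter] at hW
    obtain ⟨_, hW, x, v, hx, rfl, h1, rfl⟩ := hW
    obtain ⟨h2, h3⟩ := card_cutDarts_tailSet_le htop hx h1
    refine ⟨hW, chainWith_reg hW hx, chainWith_connected hW hk hx q,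
      (chainWith_adj_chain hx h1).symm, ?_, h2, h3, x, v, hx, rfl, h1, rfl⟩
    rw [tailSet, Set.mem_ofPred_eq, isEntry_iff.mp h1.2.1]
  -- Tail sizes are at least `k - 1`, at most `n`, and differ by at least `k - 1`, so their
  -- quotients by `k - 1` are distinct numbers between 1 and `n / (k - 1)`.
  refine Finset.card_le_card_of_injOn (fun W => (tailSet W q).ncard / (k - 1)) ?_ ?_
  · intro W hW
    obtain ⟨_, hK, _, _, hq, hc, _⟩ := hmem W hW
    have h1 := le_ncard_of_card_cutDarts_le hK ⟨q, hq⟩ hc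
    have h2 : (tailSet W q).ncard ≤ n := by
      have := Set.ncard_le_card (tailSet W q)
      simpa using this
    rw [Finset.coe_Icc, Set.mem_Icc]
    refine ⟨(Nat.le_div_iff_mul_le (by omega)).mpr (by omega), Nat.div_le_div_right h2⟩
  · intro W hW W' hW' he
    obtain ⟨hW1, hK, hcon, hadj, hq, hc, hp, x, v, hx, h1, h2, h3⟩ := hmem W hW
    obtain ⟨hW1', _, _, _, hq', hc', hp', x', v', hx', h1', h2', h3'⟩ := hmem W' hW'
    by_cases hS : tailSet W q = tailSet W' q
    · exact tailSet_injective hW1 hW1' hk hx hx' htop (h1.trans h1'.symm) h2 h2'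
        (h3.trans h3'.symm) hS
    · exfalso
      have hpos : 0 < k - 1 := by omega
      simp only at he
      rcases ncard_gap hK hk hcon hadj hS hq hq' hc hc' hp hp' with h4 | h4
      · have h5 := Nat.div_le_div_right (c := k - 1) h4
        rw [Nat.add_div_right _ hpos] at h5
        omega
      · have h5 := Nat.div_le_div_right (c := k - 1) h4
        rw [Nat.add_div_right _ hpos] at h5
        omega

end

end Recovery

/-! ### Choosing exit vertices -/

section Choice

variable {n : ℕ} {G : SimpleGraph (Fin n)} {b d m : Fin n}

/-- Applied to the neighbours of an entry vertex. Three conditions, each excluding at most one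
neighbour, leave a choice because the degree is `2r ≥ 4`. -/
theorem exists_mem_avoiding {s : Finset (Fin n)} (h : 4 ≤ s.card) {P Q R : Fin n → Prop}
    (hP : ∀ t ∈ s, ∀ t' ∈ s, P t → P t' → t = t') (hQ : ∀ t ∈ s, ∀ t' ∈ s, Q t → Q t' → t = t')
    (hR : ∀ t ∈ s, ∀ t' ∈ s, R t → R t' → t = t') : ∃ t ∈ s, ¬ P t ∧ ¬ Q t ∧ ¬ R t := by
  classical
  by_contra hcon
  push Not at hcon
  have h1 : s ⊆ s.filter P ∪ s.filter Q ∪ s.filter R := by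
    intro t ht
    have := hcon t ht
    simp only [Finset.mem_union, Finset.mem_filter, ht, true_and]
    tauto
  have key : ∀ P : Fin n → Prop, (∀ t ∈ s, ∀ t' ∈ s, P t → P t' → t = t') →
      (s.filter P).card ≤ 1 := by
    intro P hP
    rw [Finset.card_le_one]
    intro t ht t' ht'
    rw [Finset.mem_filter] at ht ht'
    exact hP t ht.1 t' ht'.1 ht.2 ht'.2
  have h2 := Finset.card_le_card h1
  have h3 := Finset.card_union_le (s.filter P ∪ s.filter Q) (s.filter R)
  have h4 := Finset.card_union_le (s.filter P) (s.filter Q)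
  have h5 := key P hP
  have h6 := key Q hQ
  have h7 := key R hR
  omega

/-- The edges `my` and `bd` form a cut that separates `m` and `b` from `y` and `d`, or they
coincide. -/
def CutWith (G : SimpleGraph (Fin n)) (m b d y : Fin n) : Prop :=
  (s(m, y) ≠ s(b, d) ∧ ∃ S : Set (Fin n), m ∈ S ∧ y ∉ S ∧ b ∈ S ∧ d ∉ S ∧
    ∀ p q, G.Adj p q → p ∈ S → q ∉ S → s(p, q) = s(m, y) ∨ s(p, q) = s(b, d)) ∨
  (m = d ∧ y = b)

/-- Let `S` and `T` be the sides belonging to `y ≠ z`. Then `mz` does not leave `S`, so `z` lies in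
`S \ T`, while `m` does not. But `mz` is the only edge that can leave `S \ T`, which contradicts
parity. The degenerate alternative `m = d` is incompatible with a genuine cut, since `m` and `d` lie
on different sides. -/
theorem cutWith_unique {k : ℕ} (hG : Reg G k) (hk : Even k) {y z : Fin n} (hz : G.Adj m z)
    (h1 : CutWith G m b d y) (h2 : CutWith G m b d z) : y = z := by
  rcases h1 with ⟨-, S, hmS, hyS, hbS, hdS, hS⟩ | ⟨rfl, rfl⟩
  · rcases h2 with ⟨hne, T, hmT, hzT, hbT, hdT, hT⟩ | ⟨rfl, rfl⟩
    · by_contra hyz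
      have hclosed : IsClosedSet G (S \ T) := by
        refine isClosedSet_of_boundary hG hk s(m, z) fun p q hpq hp hq => ?_
        by_cases hqS : q ∈ S
        · have hqT : q ∈ T := by
            by_contra hqT
            exact hq ⟨hqS, hqT⟩
          rcases hT q p hpq.symm hqT hp.2 with h | h
          · exact Sym2.eq_swap.trans h
          · rw [Sym2.eq_iff] at h
            rcases h with ⟨_, rfl⟩ | ⟨_, rfl⟩
            · exact absurd hp.1 hdS
            · exact absurd hbT hp.2
        · rcases hS p q hpq hp.1 hqS with h | h
          · rw [Sym2.eq_iff] at h
            rcases h with ⟨rfl, _⟩ | ⟨rfl, _⟩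
            · exact absurd hmT hp.2
            · exact absurd hp.1 hyS
          · rw [Sym2.eq_iff] at h
            rcases h with ⟨rfl, _⟩ | ⟨rfl, _⟩
            · exact absurd hbT hp.2
            · exact absurd hp.1 hdS
      have hzS : z ∈ S := by
        by_contra hzS
        rcases hS m z hz hmS hzS with h | h
        · rw [Sym2.congr_right] at h
          exact hyz h.symm
        · exact hne h
      exact (hclosed z m hz.symm ⟨hzS, hzT⟩).2 hmT
    · exact absurd hmS hdS
  · rcases h2 with ⟨_, T, hmT, hzT, hbT, hdT, hT⟩ | ⟨_, rfl⟩
    · exact absurd hmT hdT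
    · rfl

/-- Every vertex `m` has a neighbour `t` such that `mt` does not form a cut with the edge `bd`,
and that is not the possible exception `P`. -/
theorem exists_neighbor_not_cut {k : ℕ} (hG : Reg G k) (hk : Even k) (hk4 : 4 ≤ k)
    {P : Fin n → Prop} (hP : ∀ t t', G.Adj m t → G.Adj m t' → P t → P t' → t = t') :
    ∃ t, G.Adj m t ∧ s(m, t) ≠ s(b, d) ∧ ¬ P t ∧ ∀ S : Set (Fin n),
      (∀ p q, G.Adj p q → p ∈ S → q ∉ S → s(p, q) = s(m, t) ∨ s(p, q) = s(b, d)) →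
      IsClosedSet G S := by
  obtain ⟨t, ht, h1, h2, h3⟩ := exists_mem_avoiding (s := nbrs G m) (by rw [hG]; exact hk4)
    (P := CutWith G m b d) (Q := CutWith G m d b) (R := P)
    (fun t _ t' ht' h h' => cutWith_unique hG hk (mem_nbrs.mp ht') h h')
    (fun t _ t' ht' h h' => cutWith_unique hG hk (mem_nbrs.mp ht') h h')
    (fun t ht t' ht' => hP t t' (mem_nbrs.mp ht) (mem_nbrs.mp ht'))
  have hne : s(m, t) ≠ s(b, d) := by
    intro h
    rw [Sym2.eq_iff] at h
    rcases h with h | h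
    · exact h2 (Or.inr h)
    · exact h1 (Or.inr h)
  refine ⟨t, mem_nbrs.mp ht, hne, h3, fun S hS => ?_⟩
  by_contra hcon
  have hmt : (m ∈ S ∧ t ∉ S) ∨ (m ∉ S ∧ t ∈ S) := by
    by_contra h
    refine hcon (isClosedSet_of_boundary hG hk s(b, d) fun p q hpq hp hq => ?_)
    refine (hS p q hpq hp hq).resolve_left fun he => h ?_
    rw [Sym2.eq_iff] at he
    rcases he with ⟨rfl, rfl⟩ | ⟨rfl, rfl⟩
    · exact Or.inl ⟨hp, hq⟩
    · exact Or.inr ⟨hq, hp⟩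
  have hbd : (b ∈ S ∧ d ∉ S) ∨ (b ∉ S ∧ d ∈ S) := by
    by_contra h
    refine hcon (isClosedSet_of_boundary hG hk s(m, t) fun p q hpq hp hq => ?_)
    refine (hS p q hpq hp hq).resolve_right fun he => h ?_
    rw [Sym2.eq_iff] at he
    rcases he with ⟨rfl, rfl⟩ | ⟨rfl, rfl⟩
    · exact Or.inl ⟨hp, hq⟩
    · exact Or.inr ⟨hq, hp⟩
  have hS' : ∀ p q, G.Adj p q → p ∈ Sᶜ → q ∉ Sᶜ → s(p, q) = s(m, t) ∨ s(p, q) = s(b, d) := by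
    intro p q hpq hp hq
    rw [Sym2.eq_swap]
    exact hS q p hpq.symm (Set.notMem_compl_iff.mp hq) hp
  have hsw : ∀ {T : Set (Fin n)},
      (∀ p q, G.Adj p q → p ∈ T → q ∉ T → s(p, q) = s(m, t) ∨ s(p, q) = s(b, d)) →
      ∀ p q, G.Adj p q → p ∈ T → q ∉ T → s(p, q) = s(m, t) ∨ s(p, q) = s(d, b) := by
    intro T hT p q h1 h2 h3
    rw [Sym2.eq_swap (a := d)]
    exact hT p q h1 h2 h3
  have hne' : s(m, t) ≠ s(d, b) := by rwa [Sym2.eq_swap (a := d)]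
  rcases hmt with ⟨e1, e2⟩ | ⟨e1, e2⟩ <;> rcases hbd with ⟨e3, e4⟩ | ⟨e3, e4⟩
  · exact h1 (Or.inl ⟨hne, S, e1, e2, e3, e4, hS⟩)
  · exact h2 (Or.inl ⟨hne', S, e1, e2, e4, e3, hsw hS⟩)
  · exact h2 (Or.inl ⟨hne', Sᶜ, e1, Set.notMem_compl_iff.mpr e2, e4,
      Set.notMem_compl_iff.mpr e3, hsw hS'⟩)
  · exact h1 (Or.inl ⟨hne, Sᶜ, e1, Set.notMem_compl_iff.mpr e2, e3,
      Set.notMem_compl_iff.mpr e4, hS'⟩)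

end Choice

/-! ### Steps of the simulation -/

section Steps

variable {n : ℕ} {W W' U V : SimpleGraph (Fin n)} {x y : Fin n → Fin n} {a b c d v : Fin n}

/-- `U` is a chaining of `W`, and a chain edge of it is missing in `V`. -/
def DeletesChainEdge (W U V : SimpleGraph (Fin n)) : Prop :=
  ∃ x z z', IsExitChoice W x ∧ chainWith W x = U ∧ IsNextEntry W z z' ∧ U.Adj (x z) z' ∧
    ¬ V.Adj (x z) z'

/-- `U` is a chaining of `W`, and the step from `U` to `V` simulates the one from `W` to `W'`. -/
def SimulatesFrom (W W' U V : SimpleGraph (Fin n)) : Prop :=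
  ∃ x, IsExitChoice W x ∧ chainWith W x = U ∧ SameSwitch U V W W'

/-- The ways in which a switch from `U` to `V` is used for the simulation of the one from `W` to
`W'`. -/
def UsedIn (W W' U V : SimpleGraph (Fin n)) : Prop :=
  DeletesChainEdge W U V ∨ DeletesChainEdge W' V U ∨ SimulatesFrom W W' U V ∨
    SimulatesFrom W' W V U

/-- A possibly empty step of the simulation. -/
def SimStep (W W' U V : SimpleGraph (Fin n)) : Prop :=
  U = V ∨ ((∃ a b c d, IsSw U V a b c d) ∧ UsedIn W W' U V)

theorem SimStep.symm (h : SimStep W W' U V) : SimStep W' W V U := by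
  rcases h with rfl | ⟨⟨a, b, c, d, h1⟩, h2⟩
  · exact Or.inl rfl
  · refine Or.inr ⟨⟨a, c, b, d, h1.symm⟩, ?_⟩
    unfold UsedIn at h2 ⊢
    tauto

theorem simStep_bridge_change (hx : IsExitChoice W x) (hy : IsExitChoice W y)
    (hxy : ∀ u, IsEntry W u → u ≠ v → x u = y u) (hv : IsEntry W v) (W' : SimpleGraph (Fin n)) :
    SimStep W W' (chainWith W x) (chainWith W y) := by
  rcases bridge_change hx hy hv hxy with h | ⟨w, h1, h2⟩
  · exact Or.inl h
  · exact Or.inr ⟨⟨_, _, _, _, h2⟩, Or.inl ⟨x, v, w, hx, rfl, h1, h2.adj_ab, h2.not_ab⟩⟩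

theorem sameSwitch_of_isSw (h : IsSw U V a b c d) (h' : IsSw W W' a b c d) :
    SameSwitch U V W W' :=
  ⟨h.edgeSet_sdiff.trans h'.edgeSet_sdiff.symm,
    h.symm.edgeSet_sdiff.trans h'.symm.edgeSet_sdiff.symm⟩

theorem ent_eq_of_forall_adj (h : ∀ p q, W.Adj p q → ent W' p = ent W' q) {p q : Fin n}
    (hpq : ent W p = ent W q) : ent W' p = ent W' q := by
  have h1 : IsClosedSet W {t | ent W' p = ent W' t} := fun p' q' hadj hp' => by
    rw [Set.mem_ofPred_eq] at hp' ⊢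
    rw [hp', h _ _ hadj]
  exact h1.mem_of_reachable (reachable_iff_ent_eq.mpr hpq) rfl

theorem ent_le_ent (h : ∀ p q, ent W p = ent W q → ent W' p = ent W' q) (u : Fin n) :
    ent W u ≤ ent W' u := by
  have h1 := h _ _ (ent_ent W u)
  rw [← h1]
  exact le_ent_self W' _

/-- A switch inside a component adds no edge between components, so it can only refine the
partition. -/
theorem IsSw.ent_eq_of_ent_eq (h : IsSw W W' a b c d) (hac : ent W a = ent W c) {p q : Fin n}
    (hpq : ent W' p = ent W' q) : ent W p = ent W q := by
  refine ent_eq_of_forall_adj (fun p q hadj => ?_) hpq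
  rcases (h.adj_iff p q).mp hadj with h1 | h1 | h1
  · exact ent_eq_of_adj h1.1
  · rw [Sym2.eq_iff] at h1
    rcases h1 with ⟨rfl, rfl⟩ | ⟨rfl, rfl⟩
    · exact hac
    · exact hac.symm
  · have h2 : ent W b = ent W d := by
      rw [← ent_eq_of_adj h.adj_ab, ← ent_eq_of_adj h.adj_cd, hac]
    rw [Sym2.eq_iff] at h1
    rcases h1 with ⟨rfl, rfl⟩ | ⟨rfl, rfl⟩
    · exact h2
    · exact h2.symm

theorem IsSw.ent_eq_of_neutral (h : IsSw W W' a b c d) (hac : ent W a = ent W c)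
    (hab : ent W' a = ent W' b) (u : Fin n) : ent W u = ent W' u :=
  le_antisymm (ent_le_ent (fun _ _ => h.symm.ent_eq_of_ent_eq hab) u)
    (ent_le_ent (fun _ _ => h.ent_eq_of_ent_eq hac) u)

/-- If the two deleted edges lie in different components, these are merged. -/
theorem IsSw.ent_eq_of_ent_ne {k : ℕ} (hW : Reg W k) (hk : Even k) (h : IsSw W W' a b c d)
    (hac : ent W a ≠ ent W c) : ent W' a = ent W' b := by
  refine (component_subset hW hk (S := {t | ent W' t = ent W' a}) s(a, b) (v := ent W a)
    (fun p q hpq hp hpS hqS => ?_) rfl rfl b (ent_eq_of_adj h.adj_ab).symm).symm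
  by_contra hne
  rw [Set.mem_ofPred_eq] at hpS hqS
  refine hqS ?_
  rw [← hpS]
  refine (ent_eq_of_adj (h.adj_of_ne hpq hne fun he => hac ?_)).symm
  rw [← hp]
  rw [Sym2.eq_iff] at he
  rcases he with ⟨rfl, _⟩ | ⟨rfl, _⟩
  · rfl
  · exact (ent_eq_of_adj h.adj_cd).symm

theorem IsSw.adj_congr (h : IsSw W W' a b c d) {z : Fin n} (ha : z ≠ a) (hb : z ≠ b) (hc : z ≠ c)
    (hd : z ≠ d) (w : Fin n) : W.Adj z w ↔ W'.Adj z w := by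
  rw [h.adj_iff]
  have h1 := sym2_ne_of_left (q := w) ha hb
  have h2 := sym2_ne_of_left (q := w) hc hd
  have h3 := sym2_ne_of_left (q := w) ha hc
  have h4 := sym2_ne_of_left (q := w) hb hd
  tauto

/-- An entry vertex of another component is not affected by a switch within a component. -/
theorem IsSw.adj_congr_of_entry (h : IsSw W W' a b c d) (hac : ent W a = ent W c) {z : Fin n}
    (hz : IsEntry W z) (hza : z ≠ ent W a) (w : Fin n) : W.Adj z w ↔ W'.Adj z w := by
  have hb := ent_eq_of_adj h.adj_ab
  have hd := ent_eq_of_adj h.adj_cd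
  rw [isEntry_iff] at hz
  refine h.adj_congr ?_ ?_ ?_ ?_ w <;> rintro rfl
  · exact hza hz.symm
  · exact hza (hz.symm.trans hb.symm)
  · exact hza (hz.symm.trans hac.symm)
  · exact hza (hz.symm.trans (hd.symm.trans hac.symm))

/-- The simulation of a switch that does not change the components. -/
theorem neutral_simulation {k : ℕ} (hW : Reg W k) (hk4 : 4 ≤ k)
    (h : IsSw W W' a b c d) (hac : ent W a = ent W c) (hab : ent W' a = ent W' b) :
    ∃ x, IsExitChoice W x ∧ IsExitChoice W' x ∧
      SameSwitch (chainWith W x) (chainWith W' x) W W' ∧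
      SimStep W W' (chain W) (chainWith W x) ∧
      SimStep W W' (chainWith W x) (chainWith W' x) ∧
      SimStep W W' (chainWith W' x) (chain W') := by
  have hW' := h.reg hW
  have hent := h.ent_eq_of_neutral hac hab
  have hentry : ∀ z, IsEntry W' z ↔ IsEntry W z := fun z => by
    rw [isEntry_iff, isEntry_iff, hent]
  have hnext : ∀ z z', IsNextEntry W' z z' ↔ IsNextEntry W z z' := by
    have : entries W' = entries W := Set.ext hentry
    intro z z'
    rw [isNextEntry_iff, isNextEntry_iff, this]
  set v := ent W a with hv
  have hventry : IsEntry W v := isEntry_ent W a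
  -- The new bridge edge must survive the switch, so it has to avoid the two deleted edges; then the
  -- same exits serve before and after. The third exception is void here.
  obtain ⟨x₀, hx₀, h1, h2, -⟩ := exists_mem_avoiding (s := nbrs W v) (by rw [hW]; exact hk4)
    (P := fun t => s(v, t) = s(a, b)) (Q := fun t => s(v, t) = s(c, d)) (R := fun _ => False)
    (fun t _ t' _ e e' => Sym2.congr_right.mp (e.trans e'.symm))
    (fun t _ t' _ e e' => Sym2.congr_right.mp (e.trans e'.symm)) (fun t _ t' _ e => e.elim)
  rw [mem_nbrs] at hx₀
  have htop := isExitChoice_topNeighbor hW (by omega)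
  have htop' := isExitChoice_topNeighbor hW' (by omega)
  set x := Function.update (topNeighbor W) v x₀ with hx
  have hxv : x v = x₀ := by rw [hx, Function.update_self]
  have hxu : ∀ u, u ≠ v → x u = topNeighbor W u := fun u hu => by
    rw [hx, Function.update_of_ne hu]
  have ex : IsExitChoice W x := by
    intro z hz
    by_cases hzv : z = v
    · rw [hzv, hxv]; exact hx₀
    · rw [hxu z hzv]; exact htop z hz
  have ex' : IsExitChoice W' x := by
    intro z hz
    by_cases hzv : z = v
    · rw [hzv, hxv]; exact h.adj_of_ne hx₀ h1 h2
    · rw [← h.adj_congr_of_entry hac ((hentry z).mp hz) hzv]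
      exact ex z ((hentry z).mp hz)
  have hbd : ent W b = ent W d :=
    (ent_eq_of_adj h.adj_ab).symm.trans (hac.trans (ent_eq_of_adj h.adj_cd))
  have hcd' : ent W' c = ent W' d := by rw [← hent, ← hent, ent_eq_of_adj h.adj_cd]
  have nab : ¬ (chainWith W' x).Adj a b := fun hadj =>
    h.not_ab (chainWith_adj_of_ent_eq ex' hab hadj)
  have ncd : ¬ (chainWith W' x).Adj c d := fun hadj =>
    h.not_cd (chainWith_adj_of_ent_eq ex' hcd' hadj)
  have hsw : IsSw (chainWith W x) (chainWith W' x) a b c d := by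
    refine ⟨h.hac, h.had, h.hbc, h.hbd, ?_, ?_, ?_, ?_, ?_⟩
    · exact chainWith_adj_of_adj ex h.adj_ab fun z hz he =>
        h.not_ab ((adj_of_sym2_eq he).mpr (ex' z ((hentry z).mpr hz)))
    · exact chainWith_adj_of_adj ex h.adj_cd fun z hz he =>
        h.not_cd ((adj_of_sym2_eq he).mpr (ex' z ((hentry z).mpr hz)))
    · exact fun hadj => h.not_ac (chainWith_adj_of_ent_eq ex hac hadj)
    · exact fun hadj => h.not_bd (chainWith_adj_of_ent_eq ex hbd hadj)
    · intro p q
      constructor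
      · intro hadj
        have hne1 : s(p, q) ≠ s(a, b) := fun he => nab ((adj_of_sym2_eq he).mp hadj)
        have hne2 : s(p, q) ≠ s(c, d) := fun he => ncd ((adj_of_sym2_eq he).mp hadj)
        rcases (chainWith_adj ex').mp hadj with ⟨h3, h4⟩ | ⟨z, z', h3, h4⟩
        · rcases (h.adj_iff p q).mp h3 with h5 | h5
          · exact Or.inl ⟨chainWith_adj_of_adj ex h5.1 fun z hz => h4 z ((hentry z).mpr hz),
              hne1, hne2⟩
          · exact Or.inr h5
        · exact Or.inl ⟨(chainWith_adj ex).mpr (Or.inr ⟨z, z', (hnext z z').mp h3, h4⟩),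
            hne1, hne2⟩
      · rintro (⟨h3, h4, h5⟩ | h3 | h3)
        · rcases (chainWith_adj ex).mp h3 with ⟨h6, h7⟩ | ⟨z, z', h6, h7⟩
          · exact chainWith_adj_of_adj ex' (h.adj_of_ne h6 h4 h5) fun z hz =>
              h7 z ((hentry z).mp hz)
          · exact (chainWith_adj ex').mpr (Or.inr ⟨z, z', (hnext z z').mpr h6, h7⟩)
        · refine (adj_of_sym2_eq h3).mpr (chainWith_adj_of_adj ex' h.adj_ac fun z hz he => ?_)
          exact h.not_ac ((adj_of_sym2_eq he).mpr (ex z ((hentry z).mp hz)))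
        · refine (adj_of_sym2_eq h3).mpr (chainWith_adj_of_adj ex' h.adj_bd fun z hz he => ?_)
          exact h.not_bd ((adj_of_sym2_eq he).mpr (ex z ((hentry z).mp hz)))
  have hsame := sameSwitch_of_isSw hsw h
  refine ⟨x, ex, ex', hsame, ?_, ?_, ?_⟩
  · exact simStep_bridge_change htop ex (fun u _ hu => (hxu u hu).symm) hventry W'
  · exact Or.inr ⟨⟨a, b, c, d, hsw⟩, Or.inr (Or.inr (Or.inl ⟨x, ex, rfl, hsame⟩))⟩
  · refine (simStep_bridge_change htop' ex' (fun u hu huv => ?_) ((hentry v).mpr hventry) W).symm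
    rw [hxu u huv]
    exact (topNeighbor_congr (h.adj_congr_of_entry hac ((hentry u).mp hu) huv)).symm

end Steps

/-! ### Simulation of a switch that disconnects a component -/

section Splitting

variable {n : ℕ} {W W' Z : SimpleGraph (Fin n)} {x : Fin n → Fin n} {a b c d u w m p q : Fin n}

theorem IsSw.ent_eq_or_of_ent_eq (h : IsSw W W' a b c d) {t : Fin n} (ht : ent W t = ent W a) :
    ent W' t = ent W' a ∨ ent W' t = ent W' b := by
  have hac := ent_eq_of_adj h.adj_ac
  have hbd := ent_eq_of_adj h.adj_bd
  have h1 : IsClosedSet W {t | ent W' t = ent W' a ∨ ent W' t = ent W' b} := by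
    intro p q hpq hp
    rw [Set.mem_ofPred_eq] at hp ⊢
    by_cases h1 : s(p, q) = s(a, b)
    · rw [Sym2.eq_iff] at h1
      rcases h1 with ⟨_, rfl⟩ | ⟨_, rfl⟩
      · exact Or.inr rfl
      · exact Or.inl rfl
    by_cases h2 : s(p, q) = s(c, d)
    · rw [Sym2.eq_iff] at h2
      rcases h2 with ⟨_, rfl⟩ | ⟨_, rfl⟩
      · exact Or.inr hbd.symm
      · exact Or.inl hac.symm
    · rwa [← ent_eq_of_adj (h.adj_of_ne hpq h1 h2)]
  exact h1.mem_of_reachable (reachable_iff_ent_eq.mpr ht.symm) (Or.inl rfl)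

theorem IsSw.ent_eq_of_other (h : IsSw W W' a b c d) (hac : ent W a = ent W c) {t : Fin n}
    (ht : ent W t ≠ ent W a) : ent W' t = ent W t := by
  have hab := ent_eq_of_adj h.adj_ab
  have hcd := ent_eq_of_adj h.adj_cd
  refine le_antisymm (ent_le_ent (fun _ _ => h.ent_eq_of_ent_eq hac) t) ?_
  have h1 : IsClosedSet W {z | ent W z = ent W t ∧ ent W' z = ent W' t} := by
    rintro p q hpq ⟨hp, hp'⟩
    refine ⟨(ent_eq_of_adj hpq).symm.trans hp, ?_⟩
    rw [← ent_eq_of_adj (h.adj_of_ne hpq ?_ ?_)]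
    · exact hp'
    · refine sym2_ne_of_left ?_ ?_ <;> rintro rfl
      · exact ht hp.symm
      · exact ht (hp.symm.trans hab.symm)
    · refine sym2_ne_of_left ?_ ?_ <;> rintro rfl
      · exact ht (hp.symm.trans hac.symm)
      · exact ht (hp.symm.trans (hcd.symm.trans hac.symm))
  have h2 := (h1.mem_of_reachable (reachable_ent W t) ⟨rfl, rfl⟩).2
  rw [← h2]
  exact le_ent_self W' _

theorem IsSw.ent_entry (h : IsSw W W' a b c d) (hac : ent W a = ent W c) :
    ent W' (ent W a) = ent W a := by
  refine le_antisymm ?_ (le_ent_self W' _)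
  have := ent_le_ent (W := W') (W' := W) (fun _ _ => h.ent_eq_of_ent_eq hac) (ent W a)
  rwa [ent_ent] at this

/-- The affected component falls into the parts of `a` and `b`. The part of `a` keeps the old entry,
so the entry of the part of `b` is the only new one. -/
theorem IsSw.entries_eq_insert (h : IsSw W W' a b c d) (hac : ent W a = ent W c)
    (hne : ent W' a ≠ ent W' b) (hv : ent W' a = ent W a) :
    ent W' b ∉ entries W ∧ entries W' = insert (ent W' b) (entries W) := by
  have hm : ent W (ent W' b) = ent W a := by
    rw [ent_eq_of_adj h.adj_ab]
    exact h.ent_eq_of_ent_eq hac (ent_ent W' b)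
  constructor
  · intro hmem
    have h1 := isEntry_iff.mp hmem
    exact hne (hv.trans (hm.symm.trans h1))
  · ext z
    rw [Set.mem_insert_iff]
    constructor
    · intro hz
      have h1 : ent W' z = z := isEntry_iff.mp hz
      by_cases h2 : ent W z = ent W a
      · rcases h.ent_eq_or_of_ent_eq h2 with h3 | h3
        · right
          rw [← h1, h3, hv]
          exact isEntry_ent W a
        · exact Or.inl (h1.symm.trans h3)
      · exact Or.inr (isEntry_iff.mpr ((h.ent_eq_of_other hac h2).symm.trans h1))
    · rintro (rfl | hz)
      · exact isEntry_ent W' b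
      · have h1 : ent W z = z := isEntry_iff.mp hz
        refine isEntry_iff.mpr ?_
        by_cases h2 : ent W z = ent W a
        · have h3 : z = ent W a := h1.symm.trans h2
          rw [h3]
          exact h.ent_entry hac
        · exact (h.ent_eq_of_other hac h2).trans h1

/-- The situation in the simulation of a switch that splits off a component, with entry vertex
`m` between `u` and `w`, with exits `x` that are suitable before and after the switch. -/
structure Splitting (W W' : SimpleGraph (Fin n)) (x : Fin n → Fin n) (a b c d u w m : Fin n) :
    Prop where
  isSw : IsSw W W' a b c d
  ent_b : ent W' b = m
  ent_a_ne : ent W' a ≠ m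
  entries_eq : entries W' = insert m (entries W)
  notMem : m ∉ entries W
  next : IsNextEntry W u w
  next_left : IsNextEntry W' u m
  next_right : IsNextEntry W' m w
  next_of_ne : ∀ z z', IsNextEntry W z z' → z ≠ u → IsNextEntry W' z z'
  exits : IsExitChoice W x
  exits' : IsExitChoice W' x
  adj_exit : W.Adj m (x m)
  not_adj : ∀ z z', IsNextEntry W' z z' → ¬ W.Adj (x z) z'
  isClosedSet : ∀ S : Set (Fin n), (∀ p q, W'.Adj p q → p ∈ S → q ∉ S →
    s(p, q) = s(m, x m) ∨ s(p, q) = s(b, d)) → IsClosedSet W' S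

namespace Splitting

theorem ent_d (H : Splitting W W' x a b c d u w m) : ent W' d = m :=
  (ent_eq_of_adj H.isSw.adj_bd).symm.trans H.ent_b

theorem ent_ne (H : Splitting W W' x a b c d u w m) : ent W' a ≠ ent W' b := by
  rw [H.ent_b]
  exact H.ent_a_ne

theorem adj_bridge (H : Splitting W W' x a b c d u w m) {z : Fin n} (hz : IsEntry W' z) :
    W.Adj z (x z) := by
  have h1 : z ∈ insert m (entries W) := by
    rw [← H.entries_eq]
    exact hz
  rcases h1 with rfl | h1
  · exact H.adj_exit
  · exact H.exits z h1

theorem entry_of_entry (H : Splitting W W' x a b c d u w m) {z : Fin n} (hz : IsEntry W z) :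
    IsEntry W' z := by
  have : z ∈ entries W' := by
    rw [H.entries_eq]
    exact Or.inr hz
  exact this

theorem next_cases (H : Splitting W W' x a b c d u w m) {z z' : Fin n} (h : IsNextEntry W' z z') :
    (z = u ∧ z' = m) ∨ (z = m ∧ z' = w) ∨ (z ≠ u ∧ IsNextEntry W z z') := by
  by_cases h1 : z = u
  · subst h1
    exact Or.inl ⟨rfl, IsNextIn.right_unique (isNextEntry_iff.mp h) H.next_left⟩
  by_cases h2 : z = m
  · subst h2
    exact Or.inr (Or.inl ⟨rfl, IsNextIn.right_unique (isNextEntry_iff.mp h) H.next_right⟩)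
  · have h3 : z ∈ insert m (entries W) := by
      rw [← H.entries_eq]
      exact h.1
    obtain ⟨y, hy⟩ := exists_isNextIn (h3.resolve_left h2)
    have h4 := IsNextIn.right_unique (isNextEntry_iff.mp h) (H.next_of_ne z y hy h1)
    exact Or.inr (Or.inr ⟨h1, h4 ▸ hy⟩)

/-- The simulating switch, read backwards. Since the bridge edges lie in `W`, the edges `ac` and
`bd` are not among them; since no chain edge lies in `W`, the edges `ab` and `cd` are not already
present. -/
theorem isSw_middle (H : Splitting W W' x a b c d u w m) :
    IsSw (chainWith W' x) (sw (chainWith W' x) a c b d) a c b d := by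
  have h := H.isSw
  refine isSw_sw ⟨h.hac, h.hab, h.had, h.hbc.symm, h.hcd, h.hbd⟩ ?_ ?_ ?_ ?_
  · exact chainWith_adj_of_adj H.exits' h.adj_ac fun z hz he =>
      h.not_ac ((adj_of_sym2_eq he).mpr (H.adj_bridge hz))
  · exact chainWith_adj_of_adj H.exits' h.adj_bd fun z hz he =>
      h.not_bd ((adj_of_sym2_eq he).mpr (H.adj_bridge hz))
  · intro hadj
    obtain ⟨z, z', h1, h2⟩ := chainWith_adj_of_ent_ne H.exits' H.ent_ne hadj
    exact H.not_adj z z' h1 ((adj_of_sym2_eq h2).mp h.adj_ab)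
  · intro hadj
    have hne : ent W' c ≠ ent W' d := by
      rw [← ent_eq_of_adj h.adj_ac, ← ent_eq_of_adj h.adj_bd]
      exact H.ent_ne
    obtain ⟨z, z', h1, h2⟩ := chainWith_adj_of_ent_ne H.exits' hne hadj
    exact H.not_adj z z' h1 ((adj_of_sym2_eq h2).mp h.adj_cd)

/-- The intermediate graph is `W` with the bridge and chain edges that belong to `W'`. This form
makes it comparable with the chaining of `W`. -/
theorem middle_adj (H : Splitting W W' x a b c d u w m) :
    (sw (chainWith W' x) a c b d).Adj p q ↔
    (W.Adj p q ∧ ∀ z, IsEntry W' z → s(p, q) ≠ s(z, x z)) ∨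
      ∃ z z', IsNextEntry W' z z' ∧ s(p, q) = s(x z, z') := by
  have h := H.isSw
  have hac := ent_eq_of_adj h.adj_ac
  have hbd := ent_eq_of_adj h.adj_bd
  rw [H.isSw_middle.adj_iff]
  constructor
  · rintro (⟨h1, h2, h3⟩ | h1 | h1)
    · rcases (chainWith_adj H.exits').mp h1 with ⟨h4, h5⟩ | h4
      · rcases (h.adj_iff p q).mp h4 with h6 | h6 | h6
        · exact Or.inl ⟨h6.1, h5⟩
        · exact absurd h6 h2
        · exact absurd h6 h3
      · exact Or.inr h4
    · exact Or.inl ⟨(adj_of_sym2_eq h1).mpr h.adj_ab, fun z hz he =>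
        h.not_ab ((adj_of_sym2_eq (h1.symm.trans he)).mpr (H.exits' z hz))⟩
    · exact Or.inl ⟨(adj_of_sym2_eq h1).mpr h.adj_cd, fun z hz he =>
        h.not_cd ((adj_of_sym2_eq (h1.symm.trans he)).mpr (H.exits' z hz))⟩
  · rintro (⟨h1, h2⟩ | ⟨z, z', h1, h2⟩)
    · by_cases h3 : s(p, q) = s(a, b)
      · exact Or.inr (Or.inl h3)
      by_cases h4 : s(p, q) = s(c, d)
      · exact Or.inr (Or.inr h4)
      · exact Or.inl ⟨chainWith_adj_of_adj H.exits' (h.adj_of_ne h1 h3 h4) h2,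
          fun he => h.not_ac ((adj_of_sym2_eq he).mp h1),
          fun he => h.not_bd ((adj_of_sym2_eq he).mp h1)⟩
    · refine Or.inl ⟨(chainWith_adj H.exits').mpr (Or.inr ⟨z, z', h1, h2⟩), fun he => ?_,
        fun he => ?_⟩
      · exact ent_ne_of_chain_edge H.exits' h1 (he.symm.trans h2) H.ent_ne hac
      · exact ent_ne_of_chain_edge H.exits' h1 (he.symm.trans h2) H.ent_ne hbd

/-- The housekeeping switch. -/
theorem isSw_housekeeping (H : Splitting W W' x a b c d u w m) :
    IsSw (chainWith W x) (sw (chainWith W' x) a c b d) (x u) w m (x m) := by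
  have hm : IsEntry W' m := H.next_right.1
  have hu' : IsEntry W' u := H.next_left.1
  have hw' : IsEntry W' w := H.next_right.2.1
  have hum : u ≠ m := fun e => H.notMem (e ▸ H.next.1)
  have hwm : w ≠ m := fun e => H.notMem (e ▸ H.next.2.1)
  have hexit : ∀ z, IsEntry W' z → x z = x m → z = m := fun z hz e => by
    rw [← ent_exit H.exits' hz, e, ent_exit H.exits' hm]
  refine ⟨exit_ne_entry H.exits' hu' hm, fun e => hum (hexit u hu' e), hwm,
    (exit_ne_entry H.exits' hm hw').symm, chainWith_adj_chain H.exits H.next, ?_, ?_, ?_, ?_⟩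
  · exact chainWith_adj_of_adj H.exits H.adj_exit fun z hz he =>
      H.notMem ((bridge_unique H.exits' hm (H.entry_of_entry hz) he).1 ▸ hz)
  · intro hadj
    rcases (chainWith_adj H.exits).mp hadj with ⟨h1, _⟩ | ⟨z, z', h1, h2⟩
    · exact H.not_adj u m H.next_left h1
    · rw [Sym2.eq_iff] at h2
      rcases h2 with ⟨_, h3⟩ | ⟨h3, _⟩
      · exact H.notMem (h3 ▸ h1.2.1)
      · exact exit_ne_entry H.exits H.next.1 h1.2.1 h3
  · intro hadj
    rcases (chainWith_adj H.exits).mp hadj with ⟨h1, _⟩ | ⟨z, z', h1, h2⟩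
    · exact H.not_adj m w H.next_right h1.symm
    · rw [Sym2.eq_iff] at h2
      rcases h2 with ⟨h3, _⟩ | ⟨_, h3⟩
      · exact exit_ne_entry H.exits h1.1 H.next.2.1 h3.symm
      · exact H.notMem (hexit z (H.entry_of_entry h1.1) h3.symm ▸ h1.1)
  · intro p q
    rw [H.middle_adj]
    constructor
    · rintro (⟨h1, h2⟩ | ⟨z, z', h1, h2⟩)
      · refine Or.inl ⟨chainWith_adj_of_adj H.exits h1 fun z hz => h2 z (H.entry_of_entry hz),
          fun he => ?_, h2 m hm⟩
        have h3 : W.Adj (x u) w := (adj_of_sym2_eq he).mp h1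
        have h4 : u = w := by
          rw [← ent_exit H.exits H.next.1, ent_eq_of_adj h3]
          exact isEntry_iff.mp H.next.2.1
        refine h2 u hu' ?_
        rw [he, ← h4, Sym2.eq_swap]
      · rcases H.next_cases h1 with ⟨rfl, rfl⟩ | ⟨rfl, rfl⟩ | ⟨h3, h4⟩
        · exact Or.inr (Or.inl h2)
        · exact Or.inr (Or.inr (h2.trans Sym2.eq_swap))
        · refine Or.inl ⟨(chainWith_adj H.exits).mpr (Or.inr ⟨z, z', h4, h2⟩), fun he => ?_,
            fun he => ?_⟩
          · exact h3 (chain_edge_unique H.exits H.exits h4 H.next (h2.symm.trans he)).1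
          · have h5 := h2.symm.trans he
            rw [Sym2.eq_iff] at h5
            rcases h5 with ⟨h5, _⟩ | ⟨_, h5⟩
            · exact exit_ne_entry H.exits' h1.1 hm h5
            · exact H.notMem (h5 ▸ h4.2.1)
    · rintro (⟨h1, h2, h3⟩ | h1 | h1)
      · rcases (chainWith_adj H.exits).mp h1 with ⟨h4, h5⟩ | ⟨z, z', h4, h5⟩
        · refine Or.inl ⟨h4, fun z hz => ?_⟩
          have h6 : z ∈ insert m (entries W) := by
            rw [← H.entries_eq]
            exact hz
          rcases h6 with rfl | h6
          · exact h3
          · exact h5 z h6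
        · refine Or.inr ⟨z, z', H.next_of_ne z z' h4 ?_, h5⟩
          rintro rfl
          exact h2 (h5.trans (by rw [IsNextIn.right_unique (isNextEntry_iff.mp h4) H.next]))
      · exact Or.inr ⟨u, m, H.next_left, h1⟩
      · exact Or.inr ⟨m, w, H.next_right, h1.trans Sym2.eq_swap⟩

/-- The part of `m` loses `bd` and its bridge edge, and stays connected because these do not form a
cut. The edges `ab` and `cd` attach `a` and `c` to it, so the missing edge `ac` separates nothing,
and every other part lacks at most its bridge edge, which parity allows. The chain edges then reach
all parts. -/
theorem middle_connected (H : Splitting W W' x a b c d u w m) {k : ℕ} (hW' : Reg W' k) (hk : Even k) :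
    (sw (chainWith W' x) a c b d).Connected := by
  have h := H.isSw
  have hm : IsEntry W' m := H.next_right.1
  refine connected_of_isClosedSet b fun S hS hb => ?_
  have hin : ∀ {p q}, W'.Adj p q → s(p, q) ≠ s(a, c) → s(p, q) ≠ s(b, d) →
      (∀ z, IsEntry W' z → s(p, q) ≠ s(z, x z)) → p ∈ S → q ∈ S := by
    intro p q h1 h2 h3 h4 hp
    refine hS p q (H.middle_adj.mpr (Or.inl ⟨?_, h4⟩)) hp
    rcases (h.adj_iff p q).mp h1 with h5 | h5 | h5
    · exact h5.1
    · exact absurd h5 h2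
    · exact absurd h5 h3
  have hbridge : ∀ {p q z z'}, W'.Adj p q → ent W' p = z → IsEntry W' z' →
      s(p, q) = s(z', x z') → z = z' := by
    intro p q z z' h1 h2 h3 h4
    rw [Sym2.eq_iff] at h4
    rcases h4 with ⟨rfl, _⟩ | ⟨_, rfl⟩
    · exact h2.symm.trans (isEntry_iff.mp h3)
    · exact h2.symm.trans ((ent_eq_of_adj h1).trans (isEntry_iff.mp h3))
  have hcomp_m : ∀ t, ent W' t = m → t ∈ S := by
    have h1 : IsClosedSet W' {t | ent W' t = m ∧ t ∈ S} := by
      refine H.isClosedSet _ fun p q hpq hp hq => ?_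
      by_contra hcon
      rw [not_or] at hcon
      refine hq ⟨(ent_eq_of_adj hpq).symm.trans hp.1, hin hpq ?_ hcon.2 ?_ hp.2⟩
      · refine sym2_ne_of_left ?_ ?_ <;> rintro rfl
        · exact H.ent_a_ne hp.1
        · exact H.ent_a_ne ((ent_eq_of_adj h.adj_ac).trans hp.1)
      · intro z hz he
        exact hcon.1 ((hbridge hpq hp.1 hz he) ▸ he)
    intro t ht
    exact (h1.mem_of_reachable (reachable_iff_ent_eq.mpr (H.ent_b.trans ht.symm)) ⟨H.ent_b, hb⟩).2
  have hZ := H.isSw_middle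
  have ha : a ∈ S := hS b a hZ.adj_ac.symm hb
  have hc : c ∈ S := hS d c hZ.adj_bd.symm (hcomp_m d H.ent_d)
  have hcomp : ∀ z, z ∈ entries W' → ∀ t, ent W' t = z → t ∈ S := by
    refine IsNextIn.induction (fun z z' hzz' hz => ?_) (show m ∈ entries W' from hm) hcomp_m
    have h1 : x z ∈ S := hz _ (ent_exit H.exits' hzz'.1)
    have h2 : z' ∈ S := hS _ _ (H.middle_adj.mpr (Or.inr ⟨z, z', hzz', rfl⟩)) h1
    by_cases h3 : z' = m
    · rw [h3]
      exact hcomp_m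
    · refine component_subset hW' hk s(z', x z') (fun p q hpq hp hpS hqS => ?_)
        (isEntry_iff.mp hzz'.2.1) h2
      by_contra hcon
      refine hqS (hin hpq ?_ ?_ ?_ hpS)
      · intro he
        rw [Sym2.eq_iff] at he
        rcases he with ⟨_, rfl⟩ | ⟨_, rfl⟩
        · exact hqS hc
        · exact hqS ha
      · refine sym2_ne_of_left ?_ ?_ <;> rintro rfl
        · exact h3 (hp.symm.trans H.ent_b)
        · exact h3 (hp.symm.trans H.ent_d)
      · intro y hy he
        exact hcon ((hbridge hpq hp hy he) ▸ he)
  exact fun t => hcomp _ (isEntry_ent W' t) t rfl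

end Splitting

/-- Only the exits of the old entry `v` and the new entry `m` need a special choice. An edge of `W`
between the two parts must be `ab` or `cd`; hence each requirement that a new chain edge be absent
from `W` excludes at most one neighbour. -/
theorem IsSw.exists_splitting {k : ℕ} (hW : Reg W k) (hk : Even k) (hk4 : 4 ≤ k)
    (h : IsSw W W' a b c d) (hac : ent W a = ent W c) (hne : ent W' a ≠ ent W' b)
    (hv : ent W' a = ent W a) :
    ∃ x u w, Splitting W W' x a b c d u w (ent W' b) ∧
      ∀ z, z ≠ ent W a → z ≠ ent W' b → x z = topNeighbor W z := by
  have hW' := h.reg hW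
  obtain ⟨hm, hentries⟩ := h.entries_eq_insert hac hne hv
  have hb' := ent_eq_of_adj h.adj_bd
  have ha' := ent_eq_of_adj h.adj_ac
  set v := ent W a with hvdef
  set m := ent W' b with hmdef
  have hvW : IsEntry W v := isEntry_ent W a
  have hvm : v ≠ m := fun e => hm (e ▸ hvW)
  have hmW' : ent W' m = m := ent_ent W' b
  have hvW' : ent W' v = v := h.ent_entry hac
  obtain ⟨u, hu, w, hw, h1, h2, h3, h4⟩ := exists_isNextIn_insert hm ⟨v, hvW⟩
  rw [← hentries] at h2 h3 h4
  have hwm : w ≠ m := fun e => hm (e ▸ hw)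
  have hwW' : ent W' w = w := isEntry_iff.mp h3.2.1
  -- The exit of `v` must keep its bridge edge undeleted and must not be adjacent to `m`, because
  -- `x₀m` becomes a chain edge if `v` precedes `m`. The adjacency condition is restricted to
  -- surviving bridge edges so that it excludes only `a` (if `m = b`) or `c` (if `m = d`).
  obtain ⟨x₀, hx₀, hx₁, hx₂, hx₃⟩ := exists_mem_avoiding (s := nbrs W v) (by rw [hW]; exact hk4)
    (P := fun t => s(v, t) = s(a, b)) (Q := fun t => s(v, t) = s(c, d))
    (R := fun t => (s(v, t) ≠ s(a, b) ∧ s(v, t) ≠ s(c, d)) ∧ W.Adj t m)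
    (fun t _ t' _ e e' => Sym2.congr_right.mp (e.trans e'.symm))
    (fun t _ t' _ e e' => Sym2.congr_right.mp (e.trans e'.symm)) (by
      have key : ∀ t ∈ nbrs W v, (s(v, t) ≠ s(a, b) ∧ s(v, t) ≠ s(c, d)) ∧ W.Adj t m →
          (t = a ∧ m = b) ∨ (t = c ∧ m = d) := by
        rintro t ht ⟨⟨e1, e2⟩, e3⟩
        have e4 := ent_eq_of_adj (h.adj_of_ne (mem_nbrs.mp ht) e1 e2)
        rw [hvW'] at e4
        by_cases e5 : s(t, m) = s(a, b)
        · rw [Sym2.eq_iff] at e5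
          rcases e5 with e5 | ⟨rfl, _⟩
          · exact Or.inl e5
          · exact absurd e4 hvm
        by_cases e6 : s(t, m) = s(c, d)
        · rw [Sym2.eq_iff] at e6
          rcases e6 with e6 | ⟨rfl, _⟩
          · exact Or.inr e6
          · exact absurd (e4.trans hb'.symm) hvm
        · have e7 := ent_eq_of_adj (h.adj_of_ne e3 e5 e6)
          exact absurd (e4.trans (e7.trans hmW')) hvm
      intro t ht t' ht' e e'
      rcases key t ht e with ⟨e1, e2⟩ | ⟨e1, e2⟩ <;> rcases key t' ht' e' with ⟨e3, e4⟩ | ⟨e3, e4⟩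
      · exact e1.trans e3.symm
      · exact absurd (e2.symm.trans e4) h.hbd
      · exact absurd (e4.symm.trans e2) h.hbd
      · exact e1.trans e3.symm)
  rw [mem_nbrs] at hx₀
  have hx₄ : ¬ W.Adj x₀ m := fun e => hx₃ ⟨⟨hx₁, hx₂⟩, e⟩
  -- The exit of `m` is chosen in `W'` so that its bridge edge is not `bd`, does not form a cut with
  -- `bd`, and leads to a vertex that is not adjacent in `W` to the next entry `w`.
  obtain ⟨t₀, ht₀, ht₁, ht₂, ht₃⟩ := exists_neighbor_not_cut (m := m) (b := b) (d := d) hW' hk hk4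
    (P := fun t => W.Adj w t) (by
      have key : ∀ t, W'.Adj m t → W.Adj w t → (w = a ∧ t = b) ∨ (w = c ∧ t = d) := by
        intro t ht e
        have e1 := ent_eq_of_adj ht
        rw [hmW'] at e1
        by_cases e5 : s(w, t) = s(a, b)
        · rw [Sym2.eq_iff] at e5
          rcases e5 with e5 | ⟨rfl, _⟩
          · exact Or.inl e5
          · exact absurd hwW'.symm hwm
        by_cases e6 : s(w, t) = s(c, d)
        · rw [Sym2.eq_iff] at e6
          rcases e6 with e6 | ⟨rfl, _⟩
          · exact Or.inr e6
          · exact absurd (hwW'.symm.trans hb'.symm) hwm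
        · have e7 := ent_eq_of_adj (h.adj_of_ne e e5 e6)
          exact absurd (hwW'.symm.trans (e7.trans e1.symm)) hwm
      intro t t' ht ht' e e'
      rcases key t ht e with ⟨e1, e2⟩ | ⟨e1, e2⟩ <;> rcases key t' ht' e' with ⟨e3, e4⟩ | ⟨e3, e4⟩
      · exact e2.trans e4.symm
      · exact absurd (e1.symm.trans e3) h.hac
      · exact absurd (e3.symm.trans e1) h.hac
      · exact e2.trans e4.symm)
  have htop := isExitChoice_topNeighbor hW (by omega)
  set x := Function.update (Function.update (topNeighbor W) v x₀) m t₀ with hx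
  have hxm : x m = t₀ := by rw [hx, Function.update_self]
  have hxv : x v = x₀ := by rw [hx, Function.update_of_ne hvm, Function.update_self]
  have hxz : ∀ z, z ≠ v → z ≠ m → x z = topNeighbor W z := fun z hz hz' => by
    rw [hx, Function.update_of_ne hz', Function.update_of_ne hz]
  have ex : IsExitChoice W x := by
    intro z hz
    by_cases hzv : z = v
    · rw [hzv, hxv]; exact hx₀
    · rw [hxz z hzv fun e => hm (e ▸ hz)]; exact htop z hz
  have ex' : IsExitChoice W' x := by
    intro z hz
    have hz' : z ∈ insert m (entries W) := by
      rw [← hentries]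
      exact hz
    by_cases hzm : z = m
    · rw [hzm, hxm]; exact ht₀
    by_cases hzv : z = v
    · rw [hzv, hxv]; exact h.adj_of_ne hx₀ hx₁ hx₂
    · rw [← h.adj_congr_of_entry hac (hz'.resolve_left hzm) hzv]
      exact ex z (hz'.resolve_left hzm)
  have hadj : W.Adj m t₀ := by
    rcases (h.adj_iff m t₀).mp ht₀ with h5 | h5 | h5
    · exact h5.1
    · rw [Sym2.eq_iff] at h5
      rcases h5 with ⟨h5, _⟩ | ⟨h5, _⟩
      · rw [← h5, hmW'] at hv
        exact absurd hv.symm hvm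
      · rw [ha', ← h5, hmW'] at hv
        exact absurd hv.symm hvm
    · exact absurd h5 ht₁
  refine ⟨x, u, w, ⟨h, rfl, hne, hentries, hm, h1, h2, h3, h4, ex, ex', ?_, ?_, ?_⟩, hxz⟩
  · rw [hxm]
    exact hadj
  · intro z z' hzz' e
    have hWm : ent W m = v := by
      have : ent W m = ent W b := h.ent_eq_of_ent_eq hac hmW'
      rw [this, ← ent_eq_of_adj h.adj_ab]
    by_cases hzu : z = u
    · have hz' : z' = m := by
        subst hzu
        exact IsNextIn.right_unique (isNextEntry_iff.mp hzz') h2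
      rw [hz'] at e
      have e1 := ent_eq_of_adj e
      rw [hWm, ent_exit ex (hzu ▸ hu)] at e1
      rw [e1, hxv] at e
      exact hx₄ e
    by_cases hzm : z = m
    · have hz' : z' = w := by
        subst hzm
        exact IsNextIn.right_unique (isNextEntry_iff.mp hzz') h3
      rw [hz', hzm, hxm] at e
      exact ht₂ e.symm
    · have hzW : z ∈ entries W := by
        have : z ∈ insert m (entries W) := by
          rw [← hentries]
          exact hzz'.1
        exact this.resolve_left hzm
      obtain ⟨y, hy⟩ := exists_isNextIn hzW
      have hyz : z' = y := IsNextIn.right_unique (isNextEntry_iff.mp hzz') (h4 z y hy hzu)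
      have e1 := ent_eq_of_adj e
      rw [ent_exit ex hzW, hyz, isEntry_iff.mp hy.2.1] at e1
      exact IsNextIn.ne hy hzW hu hzu e1
  · intro S hS
    exact ht₃ S fun p q e1 e2 e3 => by
      rw [← hxm]
      exact hS p q e1 e2 e3

/-- The simulation of a switch that splits off a component. -/
theorem disconnecting_simulation {k : ℕ} (hW : Reg W k) (hk : Even k) (hk4 : 4 ≤ k)
    (h : IsSw W W' a b c d) (hac : ent W a = ent W c) (hne : ent W' a ≠ ent W' b) :
    numComponents W' = numComponents W + 1 ∧ ∃ x Z y, IsExitChoice W x ∧ IsExitChoice W' x ∧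
      IsExitChoice W' y ∧ Reg Z k ∧ Z.Connected ∧ SameSwitch Z (chainWith W' x) W W' ∧
      SimStep W W' (chain W) (chainWith W x) ∧ SimStep W W' (chainWith W x) Z ∧
      SimStep W W' Z (chainWith W' x) ∧ SimStep W W' (chainWith W' x) (chainWith W' y) ∧
      SimStep W W' (chainWith W' y) (chain W') := by
  -- By symmetry of the switch, `a` lies in the part that keeps the old entry vertex.
  wlog hv : ent W' a = ent W a generalizing a b c d
  · have hv' : ent W' b = ent W b := by
      rw [← ent_eq_of_adj h.adj_ab]
      rcases h.ent_eq_or_of_ent_eq (ent_ent W a) with h1 | h1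
      · exact absurd (h1.symm.trans (h.ent_entry hac)) hv
      · exact h1.symm.trans (h.ent_entry hac)
    refine this h.flip ?_ hne.symm hv'
    rw [← ent_eq_of_adj h.adj_ab, ← ent_eq_of_adj h.adj_cd, hac]
  have hW' := h.reg hW
  obtain ⟨x, u, w, H, hxz⟩ := h.exists_splitting hW hk hk4 hac hne hv
  have hZ := H.isSw_middle
  have hH := H.isSw_housekeeping
  have hsame := sameSwitch_of_isSw hZ.symm h
  have htop := isExitChoice_topNeighbor hW (by omega)
  have htop' := isExitChoice_topNeighbor hW' (by omega)
  set m := ent W' b with hm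
  have hmW' : IsEntry W' m := isEntry_ent W' b
  have hmem : ∀ z, IsEntry W' z → z ≠ m → IsEntry W z := fun z hz hzm => by
    have : z ∈ insert m (entries W) := by
      rw [← H.entries_eq]
      exact hz
    exact this.resolve_left hzm
  have hy : ∀ z, z ≠ m → Function.update x m (topNeighbor W' m) z = x z := fun z hz => by
    rw [Function.update_of_ne hz]
  have hym : Function.update x m (topNeighbor W' m) m = topNeighbor W' m := by
    rw [Function.update_self]
  -- The two rectifications: first the exit of `m` is reset to the canonical one, then that of the
  -- old entry vertex.
  set y := Function.update x m (topNeighbor W' m) with hydef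
  have ey : IsExitChoice W' y := by
    intro z hz
    by_cases hzm : z = m
    · rw [hzm, hym]
      exact htop' m hmW'
    · rw [hy z hzm]
      exact H.exits' z hz
  refine ⟨?_, x, _, y, H.exits, H.exits', ey, hZ.reg (chainWith_reg hW' H.exits'),
    H.middle_connected hW' hk, hsame, ?_, ?_, ?_, ?_, ?_⟩
  · rw [numComponents_eq, numComponents_eq, H.entries_eq, Set.ncard_insert_of_notMem H.notMem]
  · exact simStep_bridge_change htop H.exits
      (fun z hz hzv => (hxz z hzv fun e => H.notMem (e ▸ hz)).symm) (isEntry_ent W a) W'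
  · exact Or.inr ⟨⟨_, _, _, _, hH⟩, Or.inl ⟨x, u, w, H.exits, rfl, H.next, hH.adj_ab, hH.not_ab⟩⟩
  · exact Or.inr ⟨⟨_, _, _, _, hZ.symm⟩, Or.inr (Or.inr (Or.inr ⟨x, H.exits', rfl,
      sameSwitch_of_isSw hZ h.symm⟩))⟩
  · exact (simStep_bridge_change ey H.exits' (fun z _ hzm => hy z hzm) hmW' W).symm
  · refine (simStep_bridge_change htop' ey (fun z hz hzv => ?_)
      (H.entry_of_entry (isEntry_ent W a)) W).symm
    by_cases hzm : z = m
    · rw [hzm, hym]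
    · rw [hy z hzm, hxz z hzv hzm]
      exact (topNeighbor_congr (h.adj_congr_of_entry hac (hmem z hz hzm) hzv)).symm

end Splitting

/-! ### Simulation paths -/

section PathAlong

open FinChain

variable {Ω β : Type*} {M : FinChain Ω} {f : Ω → β} [DecidableRel fun s t : β => s ≠ t]
  {Q : Ω → Ω → Prop} {x y z : Ω} {L : List β}

/-- There is a path from `x` to `y` along the stages `L`, all transitions of which satisfy `Q`. -/
def PathAlong (M : FinChain Ω) (f : Ω → β)
    (Q : Ω → Ω → Prop) (x y : Ω) (L : List β) : Prop :=
  ∃ p : M.Path x y, p.length ≤ L.length ∧ (∀ e ∈ p.edges, Q e.1 e.2) ∧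
    p.states.map f = (f x :: L).destutter fun s t => s ≠ t

theorem PathAlong.nil : PathAlong M f Q x x [] :=
  ⟨.nil x, le_rfl, by simp [Path.edges], by simp [Path.states]⟩

/-- An absent step repeats a stage, which `destutter` removes, so it adds no transition to the path.
-/
theorem PathAlong.cons (hf : Function.Injective f) (h : x = y ∨ M.Edge x y ∧ Q x y)
    (hp : PathAlong M f Q y z L) : PathAlong M f Q x z (f y :: L) := by
  obtain ⟨p, h1, h2, h3⟩ := hp
  rcases h with rfl | ⟨h4, h5⟩
  · refine ⟨p, h1.trans (by simp), h2, ?_⟩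
    rw [h3, List.destutter_cons', List.destutter_cons', List.destutter'_cons_neg]
    simp
  · refine ⟨.cons h4 p, by simpa [Path.length] using h1, ?_, ?_⟩
    · intro e he
      rw [Path.edges, List.mem_cons] at he
      rcases he with rfl | he
      · exact h5
      · exact h2 e he
    · rw [Path.states, List.map_cons, h3, List.destutter_cons', List.destutter_cons',
        List.destutter'_cons_pos]
      exact fun e => h4.1 (hf e)

end PathAlong

/-! ### Assembling the simulation paths. -/

section Simulation

open FinChain

variable {n r : ℕ} {W W' : OmegaS n r}

open Classical in
theorem OmegaS.reg (W : OmegaS n r) : Reg W.1 (2 * r) := (reg_iff _ _).mp W.2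

open Classical in
/-- A connected regular graph, as a state of the connected switch chain. -/
def mkF (G : SimpleGraph (Fin n)) (h : Reg G (2 * r)) (hc : G.Connected) : OmegaF n r :=
  ⟨⟨G, (reg_iff _ _).mpr h⟩, hc⟩

theorem coe_injective : Function.Injective fun Z : OmegaF n r => Z.1.1 :=
  fun _ _ h => Subtype.ext (Subtype.ext h)

theorem connectedSwitchChain_P {u v : OmegaF n r} (h : u ≠ v) :
    (connectedSwitchChain n r).P u v = switchProb u.1.1 v.1.1 := by
  simp [connectedSwitchChain, switchChain, h]

theorem edge_of_isSw {u v : OmegaF n r} {a b c d : Fin n} (h : IsSw u.1.1 v.1.1 a b c d) :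
    (connectedSwitchChain n r).Edge u v := by
  have hne : u ≠ v := fun e => h.ne (by rw [e])
  refine ⟨hne, ?_⟩
  rw [connectedSwitchChain_P hne]
  exact h.switchProb_pos

theorem SimStep.edge {U V : SimpleGraph (Fin n)} (h : SimStep W.1 W'.1 U V)
    (hU : Reg U (2 * r)) (hU' : U.Connected) (hV : Reg V (2 * r)) (hV' : V.Connected) :
    mkF U hU hU' = mkF V hV hV' ∨ (connectedSwitchChain n r).Edge (mkF U hU hU') (mkF V hV hV') ∧
      UsedIn W.1 W'.1 U V := by
  rcases h with rfl | ⟨⟨a, b, c, d, h1⟩, h2⟩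
  · exact Or.inl rfl
  · exact Or.inr ⟨edge_of_isSw h1, h2⟩

theorem exists_isSw_of_edge (h : (switchChain n r).Edge W W') :
    ∃ a b c d, IsSw W.1 W'.1 a b c d :=
  exists_isSw_of_switchProb_pos (fun e => h.1 (Subtype.ext e)) h.2

/-- The graph obtained by chaining, as a state of the connected switch chain. -/
noncomputable def chainF (hr : 2 ≤ r) (hn : 0 < n) (W : OmegaS n r) : OmegaF n r :=
  mkF (chain W.1) (chainWith_reg W.reg (isExitChoice_topNeighbor W.reg (by omega)))
    (chainWith_connected W.reg (even_two_mul r) (isExitChoice_topNeighbor W.reg (by omega)) ⟨0, hn⟩)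

theorem exists_simulation_path (hr : 2 ≤ r) (hn : 0 < n) (h : (switchChain n r).Edge W W') :
    ∃ p : (connectedSwitchChain n r).Path (chainF hr hn W) (chainF hr hn W'), p.length ≤ 5 ∧
      IsSimulationSequence W.1 W'.1 (p.states.map fun Z => Z.1.1) ∧
      ∀ e ∈ p.edges, UsedIn W.1 W'.1 e.1.1.1 e.2.1.1 := by
  classical
  obtain ⟨a, b, c, d, h⟩ := exists_isSw_of_edge h
  have hk : Even (2 * r) := even_two_mul r
  have hk4 : 4 ≤ 2 * r := by omega
  have hW := W.reg
  have hW' := W'.reg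
  have reg1 : ∀ {x}, IsExitChoice W.1 x → Reg (chainWith W.1 x) (2 * r) := chainWith_reg hW
  have reg2 : ∀ {x}, IsExitChoice W'.1 x → Reg (chainWith W'.1 x) (2 * r) := chainWith_reg hW'
  have con1 : ∀ {x}, IsExitChoice W.1 x → (chainWith W.1 x).Connected := fun hx =>
    chainWith_connected hW hk hx ⟨0, hn⟩
  have con2 : ∀ {x}, IsExitChoice W'.1 x → (chainWith W'.1 x).Connected := fun hx =>
    chainWith_connected hW' hk hx ⟨0, hn⟩
  have htop := isExitChoice_topNeighbor hW (by omega)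
  have htop' := isExitChoice_topNeighbor hW' (by omega)
  have cons := @PathAlong.cons (OmegaF n r) (SimpleGraph (Fin n)) (connectedSwitchChain n r)
    (fun Z => Z.1.1) _ (fun u v => UsedIn W.1 W'.1 u.1.1 v.1.1)
  by_cases hac : ent W.1 a = ent W.1 c
  · by_cases hab : ent W'.1 a = ent W'.1 b
    · obtain ⟨x, hx, hx', hs, s1, s2, s3⟩ := neutral_simulation hW hk4 h hac hab
      obtain ⟨p, h1, h2, h3⟩ := cons coe_injective
        (s1.edge (reg1 htop) (con1 htop) (reg1 hx) (con1 hx))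
        (cons coe_injective (s2.edge _ _ (reg2 hx') (con2 hx'))
        (cons coe_injective (s3.edge _ _ (reg2 htop') (con2 htop')) PathAlong.nil))
      refine ⟨p, h1.trans (by simp), Or.inl ⟨?_, x, x, hx, hx', hs, h3⟩, h2⟩
      rw [numComponents_eq, numComponents_eq]
      congr 1
      ext z
      exact isEntry_iff.trans ((by rw [h.ent_eq_of_neutral hac hab]) : _ ↔ _) |>.trans
        isEntry_iff.symm
    · obtain ⟨hc, x, Z, y, hx, hx', hy, hZ, hZ', hs, s1, s2, s3, s4, s5⟩ :=
        disconnecting_simulation hW hk hk4 h hac hab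
      obtain ⟨p, h1, h2, h3⟩ := cons coe_injective
        (s1.edge (reg1 htop) (con1 htop) (reg1 hx) (con1 hx))
        (cons coe_injective (s2.edge _ _ hZ hZ')
        (cons coe_injective (s3.edge _ _ (reg2 hx') (con2 hx'))
        (cons coe_injective (s4.edge _ _ (reg2 hy) (con2 hy))
        (cons coe_injective (s5.edge _ _ (reg2 htop') (con2 htop')) PathAlong.nil))))
      exact ⟨p, h1.trans (by simp), Or.inr (Or.inl ⟨hc, x, Z, x, y, hx, hx', hy, hs, h3⟩), h2⟩
  -- The deleted edges lie in different components, so the reversed switch is disconnecting; its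
  -- simulation is traversed backwards.
  · obtain ⟨hc, x, Z, y, hx, hx', hy, hZ, hZ', hs, s1, s2, s3, s4, s5⟩ :=
      disconnecting_simulation hW' hk hk4 h.symm (h.ent_eq_of_ent_ne hW hk hac) hac
    obtain ⟨p, h1, h2, h3⟩ := cons coe_injective
      (s5.symm.edge (reg1 htop) (con1 htop) (reg1 hy) (con1 hy))
      (cons coe_injective (s4.symm.edge _ _ (reg1 hx') (con1 hx'))
      (cons coe_injective (s3.symm.edge _ _ hZ hZ')
      (cons coe_injective (s2.symm.edge _ _ (reg2 hx) (con2 hx))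
      (cons coe_injective (s1.symm.edge _ _ (reg2 htop') (con2 htop')) PathAlong.nil))))
    exact ⟨p, h1.trans (by simp), Or.inr (Or.inr ⟨hc.symm, y, x, Z, x, hy, hx', hx,
      ⟨hs.2, hs.1⟩, h3⟩), h2⟩

end Simulation

/-! ### The number of switches that are simulated through a given transition -/

section Counting

open Classical

variable {n k : ℕ} {W W' U V : SimpleGraph (Fin n)}

/-- Once the first graph is known, the second is one of at most `N` outcomes of a switch. -/
theorem card_pairs_le_left {N : ℕ} (hN : ∀ G : SimpleGraph (Fin n), Reg G k → (switchChoices G).card = N)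
    (s : Finset (SimpleGraph (Fin n) × SimpleGraph (Fin n))) (A : Finset (SimpleGraph (Fin n)))
    (h : ∀ p ∈ s, p.1 ∈ A ∧ Reg p.1 k ∧ ∃ a b c d, IsSw p.1 p.2 a b c d) :
    s.card ≤ A.card * N := by
  rw [mul_comm]
  refine Finset.card_le_mul_card_image_of_maps_to (f := Prod.fst) (fun p hp => (h p hp).1) N ?_
  intro G _
  by_cases hG : Reg G k
  · rw [← hN G hG]
    refine (Finset.card_le_card_of_injOn Prod.snd (t := (s.filter fun p => p.1 = G).image Prod.snd)
      (fun p hp => Finset.mem_image_of_mem _ hp) ?_).trans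
      (card_le_card_switchChoices _ fun G' hG' => ?_)
    · intro p hp q hq hpq
      rw [Finset.mem_coe, Finset.mem_filter] at hp hq
      exact Prod.ext (hp.2.trans hq.2.symm) hpq
    · obtain ⟨p, hp, rfl⟩ := Finset.mem_image.mp hG'
      rw [Finset.mem_filter] at hp
      rw [← hp.2]
      exact (h p hp.1).2.2
  · rw [Finset.filter_false_of_mem, Finset.card_empty]
    · exact Nat.zero_le _
    · rintro p hp rfl
      exact hG (h p hp).2.1

theorem card_swap (s : Finset (SimpleGraph (Fin n) × SimpleGraph (Fin n))) :
    (s.image Prod.swap).card = s.card :=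
  Finset.card_image_of_injective _ Prod.swap_injective

/-- The chain edge is one of the two edges deleted from `U`, in one of two directions, and for each
of these four darts at most `n / (k - 1)` graphs are possible. -/
theorem card_deletesChainEdge_mul_le (hk : Even k) (hk2 : 2 ≤ k) (hn : 0 < n) {a b c d : Fin n}
    (h : IsSw U V a b c d) :
    (Finset.univ.filter fun W => Reg W k ∧ DeletesChainEdge W U V).card * (k - 1) ≤ 4 * n := by
  set A : Fin n → Fin n → Finset (SimpleGraph (Fin n)) := fun p q =>
    Finset.univ.filter fun W => Reg W k ∧ ∃ x v, IsExitChoice W x ∧ chainWith W x = U ∧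
      IsNextEntry W v q ∧ x v = p with hA
  have hsub : (Finset.univ.filter fun W => Reg W k ∧ DeletesChainEdge W U V) ⊆
      (A a b ∪ A b a) ∪ (A c d ∪ A d c) := by
    intro W hW
    rw [Finset.mem_filter] at hW
    obtain ⟨-, hreg, x, z, z', h1, h2, h3, h4, h5⟩ := hW
    have key : ∀ p q, x z = p → z' = q → W ∈ A p q := by
      rintro p q rfl rfl
      exact Finset.mem_filter.mpr ⟨Finset.mem_univ _, hreg, x, z, h1, h2, h3, rfl⟩
    simp only [Finset.mem_union]
    by_cases h6 : s(x z, z') = s(a, b)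
    · rw [Sym2.eq_iff] at h6
      rcases h6 with h6 | h6
      · exact Or.inl (Or.inl (key _ _ h6.1 h6.2))
      · exact Or.inl (Or.inr (key _ _ h6.1 h6.2))
    by_cases h7 : s(x z, z') = s(c, d)
    · rw [Sym2.eq_iff] at h7
      rcases h7 with h7 | h7
      · exact Or.inr (Or.inl (key _ _ h7.1 h7.2))
      · exact Or.inr (Or.inr (key _ _ h7.1 h7.2))
    · exact absurd (h.adj_of_ne h4 h6 h7) h5
  have h0 := Finset.card_le_card hsub
  have h1 := Finset.card_union_le (A a b ∪ A b a) (A c d ∪ A d c)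
  have h2 := Finset.card_union_le (A a b) (A b a)
  have h3 := Finset.card_union_le (A c d) (A d c)
  have h4 : ∀ p q, (A p q).card * (k - 1) ≤ n := card_chainings_through_le hk hk2 hn U
  have h5 := Nat.mul_le_mul_right (k - 1) (h0.trans (h1.trans (Nat.add_le_add h2 h3)))
  rw [add_mul, add_mul, add_mul] at h5
  have e1 := h4 a b
  have e2 := h4 b a
  have e3 := h4 c d
  have e4 := h4 d c
  omega

theorem eq_of_sameSwitch {W'' : SimpleGraph (Fin n)} (h : SameSwitch U V W W')
    (h' : SameSwitch U V W W'') : W' = W'' := by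
  have h1 := h.1.symm.trans h'.1
  have h2 := h.2.symm.trans h'.2
  rw [← SimpleGraph.edgeSet_inj]
  ext e
  have e1 := Set.ext_iff.mp h1 e
  have e2 := Set.ext_iff.mp h2 e
  simp only [Set.mem_sdiff] at e1 e2
  tauto

/-- Here the step itself shows which edges are switched, so the second graph is determined by the
first, and no factor for the choice of the switch is lost. -/
theorem card_simulatesFrom_le (hk : Even k) (hn : 0 < n) (hU : Reg U k)
    (s : Finset (SimpleGraph (Fin n) × SimpleGraph (Fin n)))
    (h : ∀ p ∈ s, Reg p.1 k ∧ SimulatesFrom p.1 p.2 U V) : s.card ≤ k * n := by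
  refine le_trans (Finset.card_le_card_of_injOn Prod.fst (fun p hp => ?_) ?_)
    (card_chainings_le hk hn U hU)
  · obtain ⟨h1, x, h2, h3, _⟩ := h p hp
    exact Finset.mem_coe.mpr (Finset.mem_filter.mpr ⟨Finset.mem_univ _, h1, x, h2, h3⟩)
  · intro p hp q hq hpq
    obtain ⟨_, _, _, _, h1⟩ := h p hp
    obtain ⟨_, _, _, _, h2⟩ := h q hq
    have hpq : p.1 = q.1 := hpq
    rw [← hpq] at h2
    exact Prod.ext hpq (eq_of_sameSwitch h1 h2)

/-- Each of the two uses of a chain edge allows `4n / (2r-1)` graphs at one end and at most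
`(3/2)(rn)²` switches; each of the two simulating uses allows `2rn` pairs. The sum is of order `r
n³` because the division by `2r - 1` saves one factor `r`. -/
theorem card_usedIn_le {r : ℕ} (hr : 2 ≤ r) (hn : 0 < n) {a b c d : Fin n}
    (hU : Reg U (2 * r)) (h : IsSw U V a b c d) :
    (Finset.univ.filter fun p : SimpleGraph (Fin n) × SimpleGraph (Fin n) =>
      Reg p.1 (2 * r) ∧ (∃ a b c d, IsSw p.1 p.2 a b c d) ∧ UsedIn p.1 p.2 U V).card ≤
      18 * r * n ^ 3 := by
  have hk : Even (2 * r) := even_two_mul r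
  have hV := h.reg hU
  set S := Finset.univ.filter fun p : SimpleGraph (Fin n) × SimpleGraph (Fin n) =>
      Reg p.1 (2 * r) ∧ (∃ a b c d, IsSw p.1 p.2 a b c d) ∧ UsedIn p.1 p.2 U V with hS
  have hS' : ∀ p ∈ S, Reg p.1 (2 * r) ∧ (∃ a b c d, IsSw p.1 p.2 a b c d) ∧
      UsedIn p.1 p.2 U V := fun p hp => (Finset.mem_filter.mp hp).2
  set N := (switchChoices U).card with hNdef
  have hN : ∀ G, Reg G (2 * r) → (switchChoices G).card = N := fun G hG =>
    card_switchChoices_eq hG hU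
  have hreg : ∀ p ∈ S, Reg p.2 (2 * r) := fun p hp => by
    obtain ⟨h1, ⟨a, b, c, d, h2⟩, _⟩ := hS' p hp
    exact h2.reg h1
  have c1 := card_pairs_le_left hN (S.filter fun p => DeletesChainEdge p.1 U V)
    (Finset.univ.filter fun W => Reg W (2 * r) ∧ DeletesChainEdge W U V) (fun p hp => by
      rw [Finset.mem_filter] at hp
      obtain ⟨h1, h2, _⟩ := hS' p hp.1
      exact ⟨Finset.mem_filter.mpr ⟨Finset.mem_univ _, h1, hp.2⟩, h1, h2⟩)
  have c2 := card_pairs_le_left hN ((S.filter fun p => DeletesChainEdge p.2 V U).image Prod.swap)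
    (Finset.univ.filter fun W => Reg W (2 * r) ∧ DeletesChainEdge W V U) (fun q hq => by
      obtain ⟨p, hp, rfl⟩ := Finset.mem_image.mp hq
      rw [Finset.mem_filter] at hp
      obtain ⟨_, ⟨a, b, c, d, h2⟩, _⟩ := hS' p hp.1
      have h3 := hreg p hp.1
      exact ⟨Finset.mem_filter.mpr ⟨Finset.mem_univ _, h3, hp.2⟩, h3, a, c, b, d, h2.symm⟩)
  rw [card_swap] at c2
  have c3 := card_simulatesFrom_le hk hn hU (V := V) (S.filter fun p => SimulatesFrom p.1 p.2 U V)
    (fun p hp => by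
      rw [Finset.mem_filter] at hp
      exact ⟨(hS' p hp.1).1, hp.2⟩)
  have c4 := card_simulatesFrom_le hk hn hV (V := U)
    ((S.filter fun p => SimulatesFrom p.2 p.1 V U).image Prod.swap) (fun q hq => by
      obtain ⟨p, hp, rfl⟩ := Finset.mem_image.mp hq
      rw [Finset.mem_filter] at hp
      exact ⟨hreg p hp.1, hp.2⟩)
  rw [card_swap] at c4
  have hsub : S ⊆ ((S.filter fun p => DeletesChainEdge p.1 U V) ∪
      (S.filter fun p => DeletesChainEdge p.2 V U)) ∪
      ((S.filter fun p => SimulatesFrom p.1 p.2 U V) ∪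
      (S.filter fun p => SimulatesFrom p.2 p.1 V U)) := by
    intro p hp
    have h1 := (hS' p hp).2.2
    simp only [Finset.mem_union, Finset.mem_filter, hp, true_and]
    unfold UsedIn at h1
    tauto
  have hcard := ((Finset.card_le_card hsub).trans (Finset.card_union_le _ _)).trans
    (Nat.add_le_add (Finset.card_union_le _ _) (Finset.card_union_le _ _))
  have d1 := card_deletesChainEdge_mul_le hk (by omega) hn h
  have d2 := card_deletesChainEdge_mul_le hk (by omega) hn h.symm
  have hNle := two_mul_card_switchChoices_le (by omega) hU
  rw [← hNdef] at hNle
  set A1 := (Finset.univ.filter fun W => Reg W (2 * r) ∧ DeletesChainEdge W U V).card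
  set A2 := (Finset.univ.filter fun W => Reg W (2 * r) ∧ DeletesChainEdge W V U).card
  have hB : S.card ≤ A1 * N + A2 * N + (2 * r * n + 2 * r * n) := by omega
  obtain ⟨t, rfl⟩ : ∃ t, r = t + 1 := ⟨r - 1, by omega⟩
  have ht : 2 * (t + 1) - 1 = 2 * t + 1 := by omega
  rw [ht] at d1 d2
  -- Multiplication by `2r - 1 = 2t + 1` clears the denominators; the part from chain edges becomes
  -- at most `12 r² n³`, and the linear part is absorbed by `n ≤ n³`.
  refine Nat.le_of_mul_le_mul_right (c := 2 * t + 1) ?_ (by omega)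
  have e1 := Nat.mul_le_mul_right (2 * t + 1) hB
  have e2 := Nat.mul_le_mul_right N (Nat.add_le_add d1 d2)
  have e3 := Nat.mul_le_mul_left (4 * n) hNle
  have e4 : n ≤ n ^ 3 := Nat.le_self_pow (by norm_num) n
  have e5 := Nat.mul_le_mul_left ((4 * (t + 1)) * (2 * t + 1)) e4
  have e6 := Nat.zero_le (t ^ 2 * n ^ 3)
  have e7 := Nat.zero_le (t * n ^ 3)
  have e8 := Nat.zero_le (n ^ 3)
  nlinarith

end Counting

/-! ### Congestion of simulated flows -/

namespace FinChain

variable {Ω Ω' : Type*} {M : FinChain Ω} {M' : FinChain Ω'} {h : Ω' → Ω}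

namespace Path

theorem length_append {x y z : Ω} (p : M.Path x y) (q : M.Path y z) :
    (p.append q).length = p.length + q.length := by
  induction p with
  | nil x => simp [append, length]
  | cons e p ih => simp [append, length, ih]; omega

theorem mem_edges_append {x y z : Ω} (p : M.Path x y) (q : M.Path y z) {e : Ω × Ω} :
    e ∈ (p.append q).edges ↔ e ∈ p.edges ∨ e ∈ q.edges := by
  induction p with
  | nil x => simp [append, edges]
  | cons e p ih => simp [append, edges, ih, or_assoc]

theorem length_copy {x y x' y' : Ω} (p : M.Path x y) (hx : x = x') (hy : y = y') :
    (p.copy hx hy).length = p.length := by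
  subst hx hy
  rfl

theorem edges_copy {x y x' y' : Ω} (p : M.Path x y) (hx : x = x') (hy : y = y') :
    (p.copy hx hy).edges = p.edges := by
  subst hx hy
  rfl

end Path

namespace SimulationPaths

variable (σ : SimulationPaths M M' h)

theorem length_run_le {L : ℕ} (hσ : ∀ z w e, (σ z w e).length ≤ L) {z w : Ω'}
    (p : M'.Path z w) : (σ.run p).length ≤ L * p.length := by
  induction p with
  | nil z => simp [run, Path.length]
  | cons e p ih =>
    rw [run, Path.length_append, Path.length, mul_add, mul_one, add_comm]
    exact Nat.add_le_add ih (hσ _ _ e)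

theorem exists_of_mem_edges_run {z w : Ω'} (p : M'.Path z w) {e : Ω × Ω}
    (he : e ∈ (σ.run p).edges) :
    ∃ e' ∈ p.edges, ∃ h' : M'.Edge e'.1 e'.2, e ∈ (σ _ _ h').edges := by
  induction p with
  | nil z => simp [run, Path.edges] at he
  | @cons x y z h' p ih =>
    rw [run, Path.mem_edges_append] at he
    rcases he with he | he
    · exact ⟨(x, y), by simp [Path.edges], h', he⟩
    · obtain ⟨e', h1, h2⟩ := ih he
      exact ⟨e', by simp [Path.edges, h1], h2⟩

end SimulationPaths

/-- Canonical paths as a flow. -/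
noncomputable def CanonicalPaths.toFlow (Γ : M.CanonicalPaths) : M.Flow where
  frac x y := Finsupp.single (Γ x y) 1
  nonneg x y p := by
    classical
    rw [Finsupp.single_apply]
    split_ifs <;> norm_num
  sum_eq_one x y := Finsupp.sum_single_index rfl

/-- Simulation commutes with viewing canonical paths as a flow, so the congestion estimate is only
needed for flows. -/
theorem CanonicalPaths.simulate_toFlow (Γ : M'.CanonicalPaths) (σ : SimulationPaths M M' h)
    (ι : Ω → Ω') (hι : ∀ x, h (ι x) = x) :
    Γ.toFlow.simulate σ ι hι = (Γ.simulate σ ι hι).toFlow := by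
  simp [Flow.simulate, CanonicalPaths.toFlow, CanonicalPaths.simulate]

section

variable [Fintype Ω] [Fintype Ω']

open Classical in
/-- The total length of the flow paths through a transition. -/
noncomputable def load (frac : ∀ x y : Ω, M.Path x y →₀ ℝ) (e : Ω × Ω) : ℝ :=
  ∑ x, ∑ y, (frac x y).sum fun p c => if e ∈ p.edges then c * (p.length : ℝ) else 0

open Classical in
theorem sum_eq_load {π : ℝ} (hπ : ∀ x, M.π x = π) (frac : ∀ x y : Ω, M.Path x y →₀ ℝ)
    (e : Ω × Ω) :
    (∑ x, ∑ y, (frac x y).sum fun p c =>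
      if e ∈ p.edges then M.π x * M.π y * c * (p.length : ℝ) else 0) = π * π * load frac e := by
  rw [load, Finset.mul_sum]
  refine Finset.sum_congr rfl fun x _ => ?_
  rw [Finset.mul_sum]
  refine Finset.sum_congr rfl fun y _ => ?_
  rw [Finsupp.sum, Finsupp.sum, Finset.mul_sum]
  refine Finset.sum_congr rfl fun p _ => ?_
  rw [hπ, hπ]
  split_ifs <;> ring

theorem fracCongestion_nonneg {π P : ℝ} (hπ : ∀ x, M.π x = π)
    (hP : ∀ x y, M.Edge x y → M.P x y = P) (hπ0 : 0 ≤ π) (hP0 : 0 ≤ P)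
    {frac : ∀ x y : Ω, M.Path x y →₀ ℝ} (hfrac : ∀ x y p, 0 ≤ frac x y p) :
    0 ≤ M.fracCongestion frac := by
  refine Real.iSup_nonneg fun e => ?_
  rw [sum_eq_load hπ, hπ, hP _ _ e.2]
  refine mul_nonneg (by positivity) (mul_nonneg (by positivity) ?_)
  refine Finset.sum_nonneg fun x _ => Finset.sum_nonneg fun y _ => Finset.sum_nonneg fun p _ => ?_
  have := hfrac x y p
  dsimp only
  split_ifs <;> positivity

theorem load_le {π P : ℝ} (hπ : ∀ x, M.π x = π) (hP : ∀ x y, M.Edge x y → M.P x y = P)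
    (hπ0 : 0 < π) (hP0 : 0 < P) (frac : ∀ x y : Ω, M.Path x y →₀ ℝ) {e : Ω × Ω}
    (he : M.Edge e.1 e.2) : load frac e ≤ P / π * M.fracCongestion frac := by
  have h1 : (M.π e.1 * M.P e.1 e.2)⁻¹ * (π * π * load frac e) ≤ M.fracCongestion frac := by
    rw [← sum_eq_load hπ]
    exact le_ciSup_of_le (Set.finite_range _).bddAbove (⟨e, he⟩ : {e : Ω × Ω // M.Edge e.1 e.2})
      le_rfl
  rw [hπ, hP _ _ he] at h1
  have h2 : load frac e = P / π * ((π * P)⁻¹ * (π * π * load frac e)) := by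
    field_simp
  rw [h2]
  exact mul_le_mul_of_nonneg_left h1 (by positivity)

-- A simulated path uses `e` only if the original path has a transition whose simulation uses `e`,
-- and it is at most `L` times as long. So its contribution is charged to the loads of those
-- transitions; enlarging the sum from the states of `M` to all states of `M'` only increases it.
open Classical in
theorem load_simulate_le (f : M'.Flow) (σ : SimulationPaths M M' h) (ι : Ω → Ω')
    (hι : ∀ x, h (ι x) = x) {L : ℕ} (hσ : ∀ z w e, (σ z w e).length ≤ L) (e : Ω × Ω) :
    load (f.simulate σ ι hι).frac e ≤ L * ∑ e' ∈ Finset.univ.filter fun e' : Ω' × Ω' =>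
      ∃ h' : M'.Edge e'.1 e'.2, e ∈ (σ _ _ h').edges, load f.frac e' := by
  set S := Finset.univ.filter fun e' : Ω' × Ω' =>
      ∃ h' : M'.Edge e'.1 e'.2, e ∈ (σ _ _ h').edges with hS
  set F : Ω' → Ω' → Ω' × Ω' → ℝ := fun z w e' => (f.frac z w).sum fun q c =>
    if e' ∈ q.edges then c * (q.length : ℝ) else 0 with hF
  have hF0 : ∀ z w e', 0 ≤ F z w e' := fun z w e' => Finset.sum_nonneg fun q _ => by
    have := f.nonneg z w q
    dsimp only
    split_ifs <;> positivity
  -- The map `ι` has the left inverse `h`, so a sum over the states of `M` is part of the sum over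
  -- those of `M'`.
  have hinj : Function.Injective ι := fun x y hxy => by rw [← hι x, hxy, hι]
  have hsum : ∀ g : Ω' → ℝ, (∀ z, 0 ≤ g z) → ∑ x, g (ι x) ≤ ∑ z, g z := fun g hg => by
    rw [← Finset.sum_image (f := g) (s := Finset.univ) fun x _ y _ hxy => hinj hxy]
    exact Finset.sum_le_univ_sum_of_nonneg hg
  have key : ∀ x y, ((f.simulate σ ι hι).frac x y).sum
      (fun p c => if e ∈ p.edges then c * (p.length : ℝ) else 0) ≤
      L * ∑ e' ∈ S, F (ι x) (ι y) e' := by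
    intro x y
    simp only [Flow.simulate]
    rw [Finsupp.sum_mapDomain_index (fun _ => by simp) (fun p c₁ c₂ => by split_ifs <;> ring)]
    simp only [hF, Finsupp.sum]
    rw [Finset.sum_comm, Finset.mul_sum]
    refine Finset.sum_le_sum fun q _ => ?_
    have hq := f.nonneg (ι x) (ι y) q
    have h0 : ∀ e' ∈ S, 0 ≤ if e' ∈ q.edges then f.frac (ι x) (ι y) q * (q.length : ℝ) else 0 :=
      fun e' _ => by split_ifs <;> positivity
    split_ifs with he
    · rw [SimulationPaths.runBetween, Path.edges_copy] at he
      obtain ⟨e', h1, h2⟩ := σ.exists_of_mem_edges_run q he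
      have h3 := Finset.single_le_sum h0 (Finset.mem_filter.mpr ⟨Finset.mem_univ e', h2⟩)
      rw [if_pos h1] at h3
      rw [SimulationPaths.runBetween, Path.length_copy]
      have h4 : ((σ.run q).length : ℝ) ≤ L * q.length := by
        exact_mod_cast σ.length_run_le hσ q
      calc f.frac (ι x) (ι y) q * ((σ.run q).length : ℝ)
          ≤ f.frac (ι x) (ι y) q * (L * q.length) := mul_le_mul_of_nonneg_left h4 hq
        _ = L * (f.frac (ι x) (ι y) q * q.length) := by ring
        _ ≤ _ := mul_le_mul_of_nonneg_left h3 (Nat.cast_nonneg L)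
    · exact mul_nonneg (Nat.cast_nonneg L) (Finset.sum_nonneg h0)
  calc load (f.simulate σ ι hι).frac e
      ≤ ∑ x, ∑ y, L * ∑ e' ∈ S, F (ι x) (ι y) e' :=
        Finset.sum_le_sum fun x _ => Finset.sum_le_sum fun y _ => key x y
    _ ≤ ∑ z, ∑ y, L * ∑ e' ∈ S, F z (ι y) e' :=
        hsum (fun z => ∑ y, L * ∑ e' ∈ S, F z (ι y) e') fun z => Finset.sum_nonneg fun y _ =>
          mul_nonneg (Nat.cast_nonneg L) (Finset.sum_nonneg fun e' _ => hF0 _ _ _)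
    _ ≤ ∑ z, ∑ w, L * ∑ e' ∈ S, F z w e' :=
        Finset.sum_le_sum fun z _ => hsum (fun w => L * ∑ e' ∈ S, F z w e') fun w =>
          mul_nonneg (Nat.cast_nonneg L) (Finset.sum_nonneg fun e' _ => hF0 _ _ _)
    _ = L * ∑ e' ∈ S, load f.frac e' := by
        have h1 : ∀ e', load f.frac e' = ∑ z, ∑ w, F z w e' := fun _ => rfl
        simp only [h1, ← Finset.mul_sum]
        congr 1
        symm
        rw [Finset.sum_comm]
        refine Finset.sum_congr rfl fun z _ => ?_
        rw [Finset.sum_comm]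

open Classical in
/-- The congestion of a simulated flow, for chains whose transitions all have the same
probability. -/
theorem congestion_simulate_le (f : M'.Flow) (σ : SimulationPaths M M' h) (ι : Ω → Ω')
    (hι : ∀ x, h (ι x) = x) {L : ℕ} (hσ : ∀ z w e, (σ z w e).length ≤ L) {π π' P B : ℝ}
    (hπ : ∀ x, M.π x = π) (hπ' : ∀ x, M'.π x = π') (hπ0 : 0 < π) (hπ0' : 0 < π') (hP0 : 0 < P)
    (hB0 : 0 ≤ B)
    (hP : ∀ x y, M.Edge x y → M.P x y = P) (hP' : ∀ x y, M'.Edge x y → M'.P x y = P)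
    (hB : ∀ e : Ω × Ω, M.Edge e.1 e.2 → ((Finset.univ.filter fun e' : Ω' × Ω' =>
      ∃ h' : M'.Edge e'.1 e'.2, e ∈ (σ _ _ h').edges).card : ℝ) ≤ B) :
    (f.simulate σ ι hι).congestion ≤ L * (π / π') * B * f.congestion := by
  have hf : 0 ≤ f.congestion := fracCongestion_nonneg hπ' hP' hπ0'.le hP0.le f.nonneg
  -- A real supremum over no transitions is 0, so nonnegativity of the bound is needed too.
  refine Real.iSup_le (fun e => ?_) (by positivity)
  rw [sum_eq_load hπ, hπ, hP _ _ e.2]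
  have h1 := load_simulate_le f σ ι hι hσ e.1
  have h2 := Finset.sum_le_card_nsmul (Finset.univ.filter fun e' : Ω' × Ω' =>
    ∃ h' : M'.Edge e'.1 e'.2, e.1 ∈ (σ _ _ h').edges) (load f.frac) (P / π' * f.congestion)
    fun e' he' => load_le hπ' hP' hπ0' hP0 f.frac (Finset.mem_filter.mp he').2.1
  rw [nsmul_eq_mul] at h2
  have h3 := mul_le_mul_of_nonneg_right (hB e.1 e.2)
    (show 0 ≤ P / π' * f.congestion by positivity)
  have h4 := h1.trans (mul_le_mul_of_nonneg_left (h2.trans h3) (Nat.cast_nonneg L))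
  have h5 := mul_le_mul_of_nonneg_left h4 (show 0 ≤ (π * P)⁻¹ * (π * π) by positivity)
  calc (π * P)⁻¹ * (π * π * load (f.simulate σ ι hι).frac e.1)
      = (π * P)⁻¹ * (π * π) * load (f.simulate σ ι hι).frac e.1 := by ring
    _ ≤ _ := h5
    _ = _ := by field_simp

theorem CanonicalPaths.congestion_toFlow (Γ : M.CanonicalPaths) :
    Γ.toFlow.congestion = M.congestion Γ := by
  rw [Flow.congestion, fracCongestion, FinChain.congestion]
  refine iSup_congr fun e => ?_
  congr 1
  refine Finset.sum_congr rfl fun x _ => Finset.sum_congr rfl fun y _ => ?_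
  rw [CanonicalPaths.toFlow, Finsupp.sum_single_index] <;> simp

end

end FinChain

/-! ### The congestion of the connected switch chain -/

section Final

open FinChain

variable {n r : ℕ}

theorem chainF_fix (hr : 2 ≤ r) (hn : 0 < n) (G : OmegaF n r) : chainF hr hn G.1 = G :=
  coe_injective (chainWith_eq_self (isExitChoice_topNeighbor G.1.reg (by omega))
    ((connected_iff_ent ⟨0, hn⟩).mp G.2))

theorem card_fibre_le (hr : 2 ≤ r) (hn : 0 < n) (G : OmegaF n r) :
    Nat.card {W : OmegaS n r // chainF hr hn W = G} ≤ 2 * r * n := by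
  classical
  refine le_trans ?_ (card_chainings_le (even_two_mul r) hn G.1.1 G.1.reg)
  rw [← Nat.card_eq_finsetCard]
  refine Nat.card_le_card_of_injective (fun W => ⟨W.1.1, Finset.mem_filter.mpr
    ⟨Finset.mem_univ _, W.1.reg, _, isExitChoice_topNeighbor W.1.reg (by omega),
      congrArg (fun Z : OmegaF n r => Z.1.1) W.2⟩⟩) fun W W' h => ?_
  exact Subtype.ext (Subtype.ext (Subtype.mk.inj h))

-- At least 15/16 of the regular graphs are connected; the weaker factor 3/4 is all that the final
-- constant needs.
open Classical in
theorem three_mul_card_omegaS_le (hr : 2 ≤ r) (hn : 0 < n) :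
    3 * Fintype.card (OmegaS n r) ≤ 4 * Fintype.card (OmegaF n r) := by
  have h1 : Fintype.card (OmegaS n r) =
      (Finset.univ.filter fun G : SimpleGraph (Fin n) => Reg G (2 * r)).card := by
    rw [← Fintype.card_coe]
    refine Fintype.card_congr (Equiv.subtypeEquivRight fun G => ?_)
    rw [reg_iff]
    simp
  have h2 : Fintype.card (OmegaF n r) =
      (Finset.univ.filter fun G : OmegaS n r => G.1.Connected).card := by
    rw [← Fintype.card_coe]
    exact Fintype.card_congr (Equiv.subtypeEquivRight fun G => by simp)
  have h3 := Finset.card_filter_add_card_filter_not (s := (Finset.univ : Finset (OmegaS n r)))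
    (fun G => G.1.Connected)
  rw [Finset.card_univ] at h3
  have h4 : (Finset.univ.filter fun G : OmegaS n r => ¬ G.1.Connected).card ≤
      (Finset.univ.filter fun G : SimpleGraph (Fin n) =>
        Reg G (2 * r) ∧ ¬ G.Connected).card := by
    refine Finset.card_le_card_of_injOn (fun G => G.1) (fun G hG => ?_)
      (fun G _ G' _ h => Subtype.ext h)
    rw [Finset.mem_coe, Finset.mem_filter] at hG ⊢
    exact ⟨Finset.mem_univ _, G.reg, hG.2⟩
  have h5 := card_disconnected_le hr hn
  omega

theorem exists_edge_probability (n r : ℕ) :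
    ∃ P : ℝ, 0 < P ∧ ∀ W W', (switchChain n r).Edge W W' → (switchChain n r).P W W' = P := by
  by_cases h : ∃ W W', (switchChain n r).Edge W W'
  · obtain ⟨W, W', h1⟩ := h
    obtain ⟨a, b, c, d, h2⟩ := exists_isSw_of_edge h1
    -- The common value is the probability of an arbitrary transition; if there is none, any
    -- positive number serves.
    refine ⟨_, h1.2, fun U U' h3 => ?_⟩
    obtain ⟨_, _, _, _, h4⟩ := exists_isSw_of_edge h3
    exact h4.switchProb_eq.trans ((by rw [card_switchChoices_eq U.reg W.reg]) :
      _ = ((switchChoices W.1).card : ℝ)⁻¹) |>.trans h2.switchProb_eq.symm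
  · exact ⟨1, one_pos, fun W W' h1 => absurd ⟨W, W', h1⟩ h⟩

theorem edge_of_connected_edge {u v : OmegaF n r} (h : (connectedSwitchChain n r).Edge u v) :
    (switchChain n r).Edge u.1 v.1 :=
  ⟨fun e => h.1 (Subtype.ext e), h.2.trans_eq (connectedSwitchChain_P h.1)⟩

theorem flow_congestion_simulate_le (hr : 2 ≤ r) (hn : 0 < n)
    (σ : SimulationPaths (connectedSwitchChain n r) (switchChain n r) (chainF hr hn))
    (hσ : ∀ W W' e, (σ W W' e).length ≤ 5)
    (hused : ∀ W W' e, ∀ t ∈ (σ W W' e).edges, UsedIn W.1 W'.1 t.1.1.1 t.2.1.1)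
    (f : (switchChain n r).Flow) :
    (f.simulate σ (fun G => G.1) (chainF_fix hr hn)).congestion ≤
      120 * (r : ℝ) * (n : ℝ) ^ 3 * f.congestion := by
  classical
  obtain ⟨P, hP0, hP⟩ := exists_edge_probability n r
  have hf : 0 ≤ f.congestion :=
    fracCongestion_nonneg (π := (Fintype.card (OmegaS n r) : ℝ)⁻¹) (fun _ => rfl) hP
      (by positivity) hP0.le f.nonneg
  rcases isEmpty_or_nonempty (OmegaF n r) with hE | hE
  · refine Real.iSup_le (fun e => isEmptyElim e.1.1) (by positivity)
  have : Nonempty (OmegaS n r) := hE.map fun G => G.1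
  have hF0 : (0 : ℝ) < Fintype.card (OmegaF n r) := by exact_mod_cast Fintype.card_pos
  have hS0 : (0 : ℝ) < Fintype.card (OmegaS n r) := by exact_mod_cast Fintype.card_pos
  have hratio : (Fintype.card (OmegaF n r) : ℝ)⁻¹ / (Fintype.card (OmegaS n r) : ℝ)⁻¹ ≤ 4 / 3 := by
    have h1 : (3 : ℝ) * Fintype.card (OmegaS n r) ≤ 4 * Fintype.card (OmegaF n r) := by
      exact_mod_cast three_mul_card_omegaS_le hr hn
    rw [inv_div_inv, div_le_div_iff₀ hF0 (by norm_num)]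
    linarith
  have hmain := congestion_simulate_le f σ (fun G => G.1) (chainF_fix hr hn) hσ
    (π := (Fintype.card (OmegaF n r) : ℝ)⁻¹) (π' := (Fintype.card (OmegaS n r) : ℝ)⁻¹)
    (P := P) (B := ((18 * r * n ^ 3 : ℕ) : ℝ)) (fun _ => rfl) (fun _ => rfl) (by positivity)
    (by positivity) hP0 (by positivity)
    (fun u v h => (connectedSwitchChain_P h.1).trans (hP _ _ (edge_of_connected_edge h))) hP
    (fun e he => by
      obtain ⟨a, b, c, d, h1⟩ := exists_isSw_of_edge (edge_of_connected_edge he)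
      refine Nat.cast_le.mpr (le_trans ?_ (card_usedIn_le hr hn e.1.1.reg h1))
      refine Finset.card_le_card_of_injOn (fun p => (p.1.1, p.2.1)) (fun p hp => ?_)
        (fun p _ q _ h => ?_)
      · rw [Finset.mem_coe, Finset.mem_filter] at hp ⊢
        obtain ⟨_, h2, h3⟩ := hp
        exact ⟨Finset.mem_univ _, p.1.reg, exists_isSw_of_edge h2, hused _ _ h2 _ h3⟩
      · rw [Prod.mk.injEq] at h
        exact Prod.ext (Subtype.ext h.1) (Subtype.ext h.2))
  refine hmain.trans (mul_le_mul_of_nonneg_right ?_ hf)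
  -- Path length 5, ratio of state spaces at most 4/3, and at most `18 r n³` simulated transitions:
  -- `5 · 4/3 · 18 = 120`.
  calc ((5 : ℕ) : ℝ) * ((Fintype.card (OmegaF n r) : ℝ)⁻¹ / (Fintype.card (OmegaS n r) : ℝ)⁻¹) *
        ((18 * r * n ^ 3 : ℕ) : ℝ)
      ≤ ((5 : ℕ) : ℝ) * (4 / 3) * ((18 * r * n ^ 3 : ℕ) : ℝ) := by gcongr
    _ = 120 * (r : ℝ) * (n : ℝ) ^ 3 := by push_cast; ring

end Final

end SwitchChain

theorem mainTheorem4 (n r : ℕ) (hr : 2 ≤ r) (hn : 2 * r + 1 ≤ n) :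
    ∃ h : SwitchChain.OmegaS n r → SwitchChain.OmegaF n r,
      (∀ G : SwitchChain.OmegaS n r, (h G).1.1 = SwitchChain.chain G.1) ∧
      Function.Surjective h ∧
      (∀ G : SwitchChain.OmegaF n r,
        Nat.card {W : SwitchChain.OmegaS n r // h W = G} ≤ 2 * r * n) ∧
      ∃ hfix : ∀ G : SwitchChain.OmegaF n r, h G.1 = G,
      ∃ σ : SwitchChain.FinChain.SimulationPaths
          (SwitchChain.connectedSwitchChain n r) (SwitchChain.switchChain n r) h,
        (∀ (W W' : SwitchChain.OmegaS n r) (e : (SwitchChain.switchChain n r).Edge W W'),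
          (σ W W' e).length ≤ 5 ∧
          SwitchChain.IsSimulationSequence W.1 W'.1
            ((σ W W' e).states.map fun Z => Z.1.1)) ∧
        (∀ Γ : (SwitchChain.switchChain n r).CanonicalPaths,
          (SwitchChain.connectedSwitchChain n r).congestion
              (Γ.simulate σ (fun G => G.1) hfix) ≤
            120 * (r : ℝ) * (n : ℝ) ^ 3 * (SwitchChain.switchChain n r).congestion Γ) ∧
        (∀ f : (SwitchChain.switchChain n r).Flow,
          (f.simulate σ (fun G => G.1) hfix).congestion ≤
            120 * (r : ℝ) * (n : ℝ) ^ 3 * f.congestion) := by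
  have hn0 : 0 < n := by omega
  choose σ h1 h2 h3 using fun (W W' : SwitchChain.OmegaS n r)
    (e : (SwitchChain.switchChain n r).Edge W W') =>
    SwitchChain.exists_simulation_path hr hn0 e
  have hflow := SwitchChain.flow_congestion_simulate_le hr hn0 σ h1 h3
  refine ⟨SwitchChain.chainF hr hn0, fun _ => rfl,
    fun G => ⟨G.1, SwitchChain.chainF_fix hr hn0 G⟩, SwitchChain.card_fibre_le hr hn0,
    SwitchChain.chainF_fix hr hn0, σ, fun W W' e => ⟨h1 W W' e, h2 W W' e⟩, fun Γ => ?_, hflow⟩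
  rw [← SwitchChain.FinChain.CanonicalPaths.congestion_toFlow,
    ← SwitchChain.FinChain.CanonicalPaths.congestion_toFlow]
  exact (congrArg SwitchChain.FinChain.Flow.congestion
    (SwitchChain.FinChain.CanonicalPaths.simulate_toFlow Γ σ (fun G => G.1)
      (SwitchChain.chainF_fix hr hn0))).symm.trans_le (hflow Γ.toFlow)
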